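/- **Setting.** Let $\mathbb G$ be a locally compact second countable Hausdorff group with left Haar measure $|\cdot|$ (counting measure if $\mathbb G$ is discrete) and a compatible left-invariant metric $d$; $\mathbf B_t(\phi)$ is the closed ball of radius $t$ around $\phi$ and $\mathbf B_t=\mathbf B_t(e)$. Let $\mathbf A_n\subset\mathbb G$ be compact sets such that $(\mathbf A_n^{-1})$ is a Følner sequence: $|\mathbf A_n^{-1}|>0$ and $|\mathbf A_n^{-1}\triangle K\mathbf A_n^{-1}|/|\mathbf A_n^{-1}|\to0$ for every non-empty compact $K$. $\mathbb G$ acts measurably on a standard Borel space $\mathcal X$, $X_n$ is a random element of $\mathcal X$, $f_n:\mathcal X\to\{0,1\}$ is measurable, and $b_n$ is a positive integer. Conditioning on $\mathbb G$ means conditioning, through the regular conditional law, on $X_n^{-1}\sigma(\mathbb G)$, where $\sigma(\mathbb G)$ consists of the Borel sets $B$ with $\phi^{-1}B=B$ for all $\phi$. Let $\nu_n$ be a probability measure on $\mathbf A_n$, let $\phi_{n1},\phi_{n2},\dots\sim\nu_n$ be i.i.d., let $J_n$ take values in $\{0,1,2,\dots\}$, with $X_n$, $J_n$ and $(\phi_{ni})_i$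 independent, and put $W_n=\sum_{i\le J_n}f_n(\phi_{ni}X_n)$. Assume that $(\nu_n)$ is well-spread: for some $\mathcal S>0$, all $n$ and all $\phi\in\mathbf A_n$, $\nu_n(\mathbf B_b(\phi))\le\mathcal S|\mathbf B_b|/|\mathbf A_n|$ for all integers $b\ge1$, and $\nu_n(\mathbf B_b(\phi)\setminus\mathbf B_a(\phi))\le\mathcal S|\mathbf B_b\setminus\mathbf B_a|/|\mathbf A_n|$ for all integers $b>a\ge1$. **Mixing.** Let $\sigma_n(H)$ be the $\sigma$-algebra generated by $f_n(\phi X_n)$, $\phi\in H$. Put $$\Psi_{n,p}(t|\mathbb G)=\Big\|\sup|\mathbb P(B|A,\mathbb G)-\mathbb P(B|\mathbb G)|\Big\|_p ,$$ the supremum over $A\in\sigma_n(\{\phi\})$ (with $\mathbb P(A|\mathbb G)>0$) and $B\in\sigma_n(H)$, where $\phi\in\mathbb G$, $H\subset\mathbb G$ and $d(\phi,\psi)\ge t$ for all $\psi\in H$. Put $$\xi^b_{n,p}(t|\mathbb G)=\Big\|\sup\Big|\sum_k\frac{\mathbb P(A_k|\mathbb G)\big(\mathbb P(B_k|A_k,\mathbb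 G)-\mathbb P(B_k|\mathbb G)\big)}{\mathbb P(\bigcup_kA_k|\mathbb G)}\Big|\Big\|_p$$ (terms with $\mathbb P(A_k|\mathbb G)=0$ being $0$), the supremum over sequences of pairs $(A_k,B_k)$ with pairwise disjoint $A_k$, where each pair satisfies $A_k\in\sigma\big(f_n(\phi X_n),\sum_{i\le m}f_n(\psi_iX_n)\big)$ and $B_k\in\sigma_n(H)$ for some $\phi\in\mathbb G$, some finite family $\psi_1,\dots,\psi_m\in\mathbf B_b(\phi)$ (repetitions allowed) and some $H\subset\mathbb G$ with $d(\phi,\psi)\ge t$ for all $\psi\in H$. Put $\mathcal R_\Psi(n,p,b)=\sum_{i\ge b}|\mathbf B_{i+1}\setminus\mathbf B_i|\,\Psi_{n,p}(i|\mathbb G)$ and $\mathcal R_\xi(n,p,b)=\sum_{i\ge2b}|\mathbf B_{i+1}\setminus\mathbf B_i|\,\xi^b_{n,p}(i|\mathbb G)$ (with $0\cdot\infty=0$). **Remaining conditions.** With $Q_n(\phi)=\mathbb P(f_n(\phi X_n)=1|\mathbb G)$: * (C0) $\sup_n\sup_{\phi\in\mathbf A_n}|\mathbf A_n|\,\|Q_n(\phi)\|_2<\infty$;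 * (C1) $\sup_n\big\|\mathbb E[W_n|\mathbb G]\big\|_\infty<\infty$, where $\mathbb E[W_n|\mathbb G]=\mathbb E[\sum_{i\le J_n}Q_n(\phi_{ni})|\mathbb G]$; * (C2) $|\mathbf B_{2b_n}|/|\mathbf A_n|\to0$ and (C2') $|\mathbf B_{b_n}|/|\mathbf A_n|^{1/2}\to0$; * (C3) $\mathcal R_\Psi(n,2,b_n)\to0$ and $\mathcal R_\xi(n,2,b_n)\to0$; * (C4) $\sup_n\Psi_{n,2}(t|\mathbb G)\to0$ as $t\to\infty$. The conditions on $J_n$ are $$\text{(J1)}\ \ \sup_n\frac{\|J_n\|_3}{|\mathbf A_n|}<\infty,\qquad\text{(J2)}\ \ \frac{|\mathbf B_{b_n}|}{|\mathbf A_n|}\max\{|\mathbf A_n|^{1/2},\mathrm{Var}(J_n)^{1/2}\}\to0 .$$ **Rates.** For an integer $m\ge0$ and $k\ge1$ let $$\lambda_n^{(m)}(k)=\frac1k\,\mathbb P\Big(f_n(\phi_{n1}X_n)=1\ \text{and}\ \sum_{i\le m,\ d(\phi_{n1},\phi_{ni})\le b_n}f_n(\phi_{ni}X_n)=k\,\Big|\,\mathbb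 G\Big).$$ $Z(\lambda)$ denotes a compound Poisson variable: a sum of $N\sim\mathrm{Poisson}(\sum_k\lambda(k))$ independent variables $M_i$, independent of $N$, with $\mathbb P(M_i=k)=\lambda(k)/\sum_j\lambda(j)$. Let $d_{TV}(W_n,Z|\mathbb G)=\sup_{B\subset\{0,1,2,\dots\}}|\mathbb P(W_n\in B|\mathbb G)-\mathbb P(Z\in B|\mathbb G)|$. **Claim.** (i) Let $J_n=j_n$ almost surely, for non-random positive integers $j_n$ with $j_n=O(|\mathbf A_n|)$. Then (J1) holds, and (J2) holds whenever (C2') does. If the remaining conditions (C0)–(C4) hold, then $\mathbb E[d_{TV}(W_n,Z(j_n\lambda_n^{(j_n)})|\mathbb G)]\to0$. (ii) Let $J_n\sim\mathrm{Poisson}(\theta_n)$ with $\theta_n=O(|\mathbf A_n|)$. Then (J1) holds, and (J2) holds whenever (C2') does. If the remaining conditions (C0)–(C4) hold, then $\mathbb E[d_{TV}(W_n,Z(\lfloor\theta_n\rfloor\lambda_n^{(\lfloor\theta_n\rfloor)})|\mathbb G)]\to0$. -/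

import Mathlib

open MeasureTheory ProbabilityTheory Filter Topology Asymptotics
open scoped NNReal ENNReal Pointwise

noncomputable section

/-! ### Compound Poisson laws and total variation -/

/-- Total variation distance `sup_A |μ(A) - ν(A)|` between probability measures on `ℕ`. -/
def tvDist (μ ν : Measure ℕ) : ℝ := ⨆ A : Set ℕ, |μ.real A - ν.real A|

/-- Law of the sum of `m` independent variables with law `ρ`. -/
def iidSumLaw (ρ : Measure ℕ) : ℕ → Measure ℕ
  | 0 => Measure.dirac 0
  | m + 1 => ρ.conv (iidSumLaw ρ m)

/-- The jump law `k ↦ r k / ∑ j, r j`. -/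
def jumpLaw (r : ℕ → ℝ≥0) : Measure ℕ :=
  Measure.sum fun k => ((r k / ∑' j, r j : ℝ≥0) : ℝ≥0∞) • Measure.dirac k

/-- The law of `Z(r) = ∑_{i ≤ N} M_i`, where `N ∼ Poisson (∑ k, r k)` and the `M_i` are independent
with law `jumpLaw r`, independent of `N`. It is used for summable `r` with `r 0 = 0`. -/
def compoundPoisson (r : ℕ → ℝ≥0) : Measure ℕ :=
  (poissonMeasure (∑' k, r k)).bind (iidSumLaw (jumpLaw r))

/-! ### Følner sequences and well-spread measures -/

section Group

variable {G : Type*} [Group G] [MetricSpace G] [MeasurableSpace G]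

/-- `(F n)` is a Følner sequence of compact sets of positive measure. -/
def IsFolner (haar : Measure G) (F : ℕ → Set G) : Prop :=
  (∀ n, IsCompact (F n) ∧ 0 < haar (F n)) ∧
    ∀ K : Set G, IsCompact K → K.Nonempty →
      Tendsto (fun n => haar (symmDiff (F n) (K * F n)) / haar (F n)) atTop (𝓝 0)

/-- The measures `ν n` are well-spread over the sets `A n`: up to a constant, balls and annuli
centred in `A n` have at most the mass they have under the normalized Haar measure. -/
def WellSpread (haar : Measure G) (A : ℕ → Set G) (ν : ℕ → Measure G) : Prop :=
  ∃ S : ℝ≥0, 0 < S ∧ ∀ n, ∀ φ ∈ A n,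
    (∀ b : ℕ, 1 ≤ b → ν n (Metric.closedBall φ b) ≤
      S * (haar (Metric.closedBall 1 b) / haar (A n))) ∧
    (∀ a b : ℕ, 1 ≤ a → a < b → ν n (Metric.closedBall φ b \ Metric.closedBall φ a) ≤
      S * (haar (Metric.closedBall 1 b \ Metric.closedBall 1 a) / haar (A n)))

end Group

/-! ### Conditioning on the invariant σ-algebra -/

section Conditioning

variable (G : Type*) {𝒳 Ω S : Type*} [Group G] [MeasurableSpace 𝒳] [MulAction G 𝒳]
  [MeasurableSpace Ω] [MeasurableSpace S] [StandardBorelSpace S] [Nonempty S]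

/-- The measurable sets `B` with `φ⁻¹ B = B` for all `φ`. -/
def invariantSigma (𝒳 : Type*) [MeasurableSpace 𝒳] [MulAction G 𝒳] : MeasurableSpace 𝒳 :=
  ⨅ φ : G, MeasurableSpace.invariants (fun x : 𝒳 => φ • x)

/-- `condLaw G P X Y (X ω)` is the regular conditional law at `ω` of `Y` given the `σ`-algebra
`X⁻¹ (invariantSigma G 𝒳)`, that is, given the invariant events of `X`. -/
def condLaw (P : Measure Ω) [IsFiniteMeasure P] (X : Ω → 𝒳) (Y : Ω → S) (x : 𝒳) : Measure S :=
  letI : MeasurableSpace 𝒳 := invariantSigma G 𝒳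
  condDistrib Y X P x

end Conditioning

section Sampling

variable {G 𝒳 Ω : Type*} [Group G] [MetricSpace G] [MeasurableSpace G]
  [MeasurableSpace 𝒳] [StandardBorelSpace 𝒳] [Nonempty 𝒳] [MulAction G 𝒳] [MeasurableSpace Ω]

/-- `Q(φ) = P(f(φ X) = 1 | G)`. -/
def condHit (P : Measure Ω) [IsFiniteMeasure P] (X : Ω → 𝒳) (f : 𝒳 → ℕ) (φ : G) (ω : Ω) : ℝ :=
  (condLaw G P X X (X ω)).real {x | f (φ • x) = 1}

/-! ### Mixing coefficients -/

/-- The `σ`-algebra generated by the functions `x ↦ f (φ x)`, `φ ∈ H`. -/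
def sigmaProcess (f : 𝒳 → ℕ) (H : Set G) : MeasurableSpace 𝒳 :=
  ⨆ φ ∈ H, MeasurableSpace.comap (fun x : 𝒳 => f (φ • x)) ⊤

/-- Pairs of events `A ∈ σ(φ)` and `B ∈ σ(H)`, where all points of `H` have distance at least `t`
from `φ`. -/
def psiPairs (G : Type*) [Group G] [MetricSpace G] [MulAction G 𝒳] (f : 𝒳 → ℕ) (t : ℝ) :
    Set (Set 𝒳 × Set 𝒳) :=
  {E | ∃ (φ : G) (H : Set G), (∀ ψ ∈ H, t ≤ dist φ ψ) ∧
    MeasurableSet[sigmaProcess f {φ}] E.1 ∧ MeasurableSet[sigmaProcess f H] E.2}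

/-- `Ψ_p(t|G) = ‖ sup_{(A,B)} |P(B|A,G) - P(B|G)| ‖_p`; at each point the supremum is over the
pairs for which `P(A|G)` does not vanish there. -/
def psiMix (G : Type*) [Group G] [MetricSpace G] [MulAction G 𝒳]
    (P : Measure Ω) [IsFiniteMeasure P] (X : Ω → 𝒳) (f : 𝒳 → ℕ) (p : ℝ≥0∞) (t : ℝ) : ℝ≥0∞ :=
  eLpNorm (fun ω => ⨆ E ∈ psiPairs G f t, ⨆ _ : condLaw G P X X (X ω) E.1 ≠ 0,
    ENNReal.ofReal |((condLaw G P X X (X ω))[|E.1]).real E.2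
      - (condLaw G P X X (X ω)).real E.2|) p P

/-- Pairs of events `A ∈ σ(f(φ x), ∑_{i} f(ψ_i x))`, for a finite family `ψ` in the ball of radius
`b` around `φ`, and `B ∈ σ(H)`, where all points of `H` have distance at least `t` from `φ`. -/
def xiPairs (G : Type*) [Group G] [MetricSpace G] [MulAction G 𝒳] (f : 𝒳 → ℕ) (b t : ℝ) :
    Set (Set 𝒳 × Set 𝒳) :=
  {E | ∃ (φ : G) (m : ℕ) (ψ : Fin m → G) (H : Set G),
    (∀ i, dist φ (ψ i) ≤ b) ∧ (∀ η ∈ H, t ≤ dist φ η) ∧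
    MeasurableSet[MeasurableSpace.comap (fun x : 𝒳 => (f (φ • x), ∑ i, f (ψ i • x))) ⊤] E.1 ∧
    MeasurableSet[sigmaProcess f H] E.2}

/-- `ξ_p^b(t|G)`: the `L_p` norm of the supremum, over all sequences of pairs `(A_k, B_k)` with
pairwise disjoint `A_k`, of `|∑_k P(A_k|G) (P(B_k|A_k,G) - P(B_k|G)) / P(⋃_k A_k|G)|`.
Summands with `P(A_k|G) = 0` vanish. -/
def xiMix (G : Type*) [Group G] [MetricSpace G] [MulAction G 𝒳]
    (P : Measure Ω) [IsFiniteMeasure P] (X : Ω → 𝒳) (f : 𝒳 → ℕ) (p : ℝ≥0∞) (b t : ℝ) : ℝ≥0∞ :=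
  eLpNorm (fun ω => ⨆ (E : ℕ → Set 𝒳 × Set 𝒳) (_ : ∀ k, E k ∈ xiPairs G f b t)
      (_ : Pairwise fun k l => Disjoint (E k).1 (E l).1),
    ENNReal.ofReal |∑' k, (condLaw G P X X (X ω)).real (E k).1 *
      (((condLaw G P X X (X ω))[|(E k).1]).real (E k).2
        - (condLaw G P X X (X ω)).real (E k).2)
      / (condLaw G P X X (X ω)).real (⋃ k, (E k).1)|) p P

/-- `|B_{i+1} \ B_i|` for the closed balls around the identity. -/
def growth (haar : Measure G) (i : ℕ) : ℝ≥0∞ :=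
  haar (Metric.closedBall 1 ((i + 1 : ℕ) : ℝ) \ Metric.closedBall 1 (i : ℝ))

/-- `R_Ψ(p, b) = ∑_{i ≥ b} |B_{i+1} \ B_i| Ψ_p(i|G)`. -/
def residuePsi (haar : Measure G) (P : Measure Ω) [IsFiniteMeasure P] (X : Ω → 𝒳) (f : 𝒳 → ℕ)
    (p : ℝ≥0∞) (b : ℕ) : ℝ≥0∞ :=
  ∑' i : {i : ℕ // b ≤ i}, growth haar i * psiMix G P X f p (i : ℕ)

/-- `R_ξ(p, b) = ∑_{i ≥ 2b} |B_{i+1} \ B_i| ξ_p^b(i|G)`. -/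
def residueXi (haar : Measure G) (P : Measure Ω) [IsFiniteMeasure P] (X : Ω → 𝒳) (f : 𝒳 → ℕ)
    (p : ℝ≥0∞) (b : ℕ) : ℝ≥0∞ :=
  ∑' i : {i : ℕ // 2 * b ≤ i}, growth haar i * xiMix G P X f p b (i : ℕ)

/-! ### Randomized sums -/

/-- `W = ∑_{i ≤ J} f(φ_i X)`; samples are indexed from `0`. -/
def randomSum (X : Ω → 𝒳) (f : 𝒳 → ℕ) (Φ : ℕ → Ω → G) (J : Ω → ℕ) (ω : Ω) : ℕ :=
  ∑ i ∈ Finset.range (J ω), f (Φ i ω • X ω)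

/-- The number of hits among those of the first `m` samples that lie within distance `b` of the
first one. -/
def nearbyHits (X : Ω → 𝒳) (f : 𝒳 → ℕ) (Φ : ℕ → Ω → G) (b m : ℕ) (ω : Ω) : ℕ :=
  ∑ i ∈ Finset.range m with dist (Φ 0 ω) (Φ i ω) ≤ b, f (Φ i ω • X ω)

/-- The rate per sample, as a function of the value `x` of `X`:
`k ↦ k⁻¹ P(f(φ_1 X) = 1 and ∑_{i ≤ m, d(φ_1, φ_i) ≤ b} f(φ_i X) = k | G)`, and `0` at `k = 0`. -/
def clusterRate (P : Measure Ω) [IsFiniteMeasure P] (X : Ω → 𝒳) (f : 𝒳 → ℕ) (Φ : ℕ → Ω → G)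
    (b m : ℕ) (x : 𝒳) (k : ℕ) : ℝ≥0 :=
  (k : ℝ≥0)⁻¹ * (condLaw G P X
    (fun ω => (f (Φ 0 ω • X ω), nearbyHits X f Φ b m ω)) x {(1, k)}).toNNReal

/-- `E[d_TV(W, Z(m λ) | G)]`, with `λ` the rate per sample computed from `m` samples. -/
def meanCondTV (P : Measure Ω) [IsFiniteMeasure P] (X : Ω → 𝒳) (f : 𝒳 → ℕ) (Φ : ℕ → Ω → G)
    (J : Ω → ℕ) (b m : ℕ) : ℝ≥0∞ :=
  ∫⁻ ω, ENNReal.ofReal (tvDist (condLaw G P X (randomSum X f Φ J) (X ω))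
    (compoundPoisson fun k => (m : ℝ≥0) * clusterRate P X f Φ b m (X ω) k)) ∂P

/-- The standing assumptions on the Følner sequence, the random elements `X n`, the functions
`f n`, the radii `b n`, the sampling laws `ν n`, the samples `Φ n i` and the sample sizes `J n`. -/
structure RandomizedSetting (haar : Measure G) (A : ℕ → Set G) (P : Measure Ω) (X : ℕ → Ω → 𝒳)
    (f : ℕ → 𝒳 → ℕ) (b : ℕ → ℕ) (ν : ℕ → Measure G) (Φ : ℕ → ℕ → Ω → G) (J : ℕ → Ω → ℕ) :
    Prop where
  folner : IsFolner haar (fun n => (A n)⁻¹)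
  measurable_X : ∀ n, Measurable (X n)
  measurable_f : ∀ n, Measurable (f n)
  binary : ∀ n x, f n x = 0 ∨ f n x = 1
  radius_pos : ∀ n, 0 < b n
  supported : ∀ n, ν n (A n)ᶜ = 0
  wellSpread : WellSpread haar A ν
  measurable_sample : ∀ n i, Measurable (Φ n i)
  law_sample : ∀ n i, P.map (Φ n i) = ν n
  indep_sample : ∀ n, iIndepFun (Φ n) P
  measurable_J : ∀ n, Measurable (J n)
  indep_J : ∀ n, IndepFun (J n) (fun ω i => Φ n i ω) P
  indep_X : ∀ n, IndepFun (X n) (fun ω => (J n ω, fun i => Φ n i ω)) P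

/-- `sup_n ‖J_n‖_3 / |A_n| < ∞`. -/
def SampleMoment (haar : Measure G) (A : ℕ → Set G) (P : Measure Ω) (J : ℕ → Ω → ℕ) : Prop :=
  ⨆ n, eLpNorm (fun ω => (J n ω : ℝ)) 3 P / haar (A n) < ∞

/-- `|B_{b_n}| / |A_n| * max (|A_n|^{1/2}) (Var(J_n)^{1/2}) → 0`. -/
def SampleVariance (haar : Measure G) (A : ℕ → Set G) (P : Measure Ω) (b : ℕ → ℕ)
    (J : ℕ → Ω → ℕ) : Prop :=
  Tendsto (fun n => haar (Metric.closedBall 1 (b n)) / haar (A n) *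
    max (haar (A n) ^ (1 / 2 : ℝ)) (ENNReal.ofReal √(Var[fun ω => (J n ω : ℝ); P])))
    atTop (𝓝 0)

/-- `|B_{b_n}| / |A_n| * |A_n|^{1/2} → 0`. -/
def SmallBalls (haar : Measure G) (A : ℕ → Set G) (b : ℕ → ℕ) : Prop :=
  Tendsto (fun n => haar (Metric.closedBall 1 (b n)) / haar (A n) * haar (A n) ^ (1 / 2 : ℝ))
    atTop (𝓝 0)

/-- The conditions of the limit theorem other than those on the moments of `J n`. -/
structure RemainingConditions (haar : Measure G) (A : ℕ → Set G) (P : Measure Ω)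
    [IsFiniteMeasure P] (X : ℕ → Ω → 𝒳) (f : ℕ → 𝒳 → ℕ) (b : ℕ → ℕ) (Φ : ℕ → ℕ → Ω → G)
    (J : ℕ → Ω → ℕ) : Prop where
  /-- `sup_n sup_{φ ∈ A_n} |A_n| ‖Q_n(φ)‖_2 < ∞` -/
  hit_moment : ⨆ n, ⨆ φ ∈ A n, haar (A n) * eLpNorm (condHit P (X n) (f n) φ) 2 P < ∞
  /-- `sup_n ‖E[W_n | G]‖_∞ < ∞`, where `E[W_n | G] = E[∑_{i ≤ J_n} Q_n(φ_{ni}) | G]` -/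
  mean_bounded : ⨆ n, eLpNorm (fun ω => ∫⁻ w : ℕ, (w : ℝ≥0∞)
    ∂(condLaw G P (X n) (randomSum (X n) (f n) (Φ n) (J n)) (X n ω))) ∞ P < ∞
  double_balls : Tendsto (fun n => haar (Metric.closedBall 1 (2 * b n)) / haar (A n)) atTop (𝓝 0)
  small_balls : SmallBalls haar A b
  psi_residue : Tendsto (fun n => residuePsi haar P (X n) (f n) 2 (b n)) atTop (𝓝 0)
  xi_residue : Tendsto (fun n => residueXi haar P (X n) (f n) 2 (b n)) atTop (𝓝 0)
  psi_uniform : Tendsto (fun t : ℝ => ⨆ n, psiMix G P (X n) (f n) 2 t) atTop (𝓝 0)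

end Sampling

end

noncomputable section

/-! ### Perturbations of the compound Poisson recursion -/

lemma abs_le_convolution_of_perturbed_recursion {a c e d : ℕ → ℝ} (ha : ∀ k, 0 ≤ a k) (ha0 : a 0 = 0)
    (hc : ∀ k, 0 ≤ c k) (hc0 : c 0 = 1) (he : ∀ k, 0 ≤ e k) (hd0 : d 0 = 0)
    (hcrec : ∀ w : ℕ, (w : ℝ) * c w = ∑ x ∈ Finset.HasAntidiagonal.antidiagonal w, a x.1 * c x.2)
    (hdrec : ∀ w : ℕ, |(w : ℝ) * d w - ∑ x ∈ Finset.HasAntidiagonal.antidiagonal w, a x.1 * d x.2| ≤ e w) (w : ℕ) :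
    |d w| ≤ ∑ x ∈ Finset.HasAntidiagonal.antidiagonal w, e x.1 * c x.2 := by
  induction w using Nat.strong_induction_on with
  | _ w ih =>
  rcases Nat.eq_zero_or_pos w with rfl | hw
  · simp [hd0, mul_nonneg (he 0) (hc 0)]
  have key : ∑ x ∈ Finset.HasAntidiagonal.antidiagonal w, a x.1 * ∑ y ∈ Finset.HasAntidiagonal.antidiagonal x.2, e y.1 * c y.2
      = ∑ x ∈ Finset.HasAntidiagonal.antidiagonal w, e x.1 * (x.2 * c x.2) := by
    have h1 : PowerSeries.mk a * (PowerSeries.mk e * PowerSeries.mk c)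
        = PowerSeries.mk e * PowerSeries.mk (fun w : ℕ => (w : ℝ) * c w) := by
      have : PowerSeries.mk (fun w : ℕ => (w : ℝ) * c w) = PowerSeries.mk a * PowerSeries.mk c := by
        ext w; simp [PowerSeries.coeff_mul, hcrec]
      rw [this]; ring
    have h2 := congrArg (PowerSeries.coeff w) h1
    simpa [PowerSeries.coeff_mul] using h2
  have h1 : (w : ℝ) * |d w| ≤ ∑ x ∈ Finset.HasAntidiagonal.antidiagonal w, a x.1 * |d x.2| + e w := by
    have h2 : |∑ x ∈ Finset.HasAntidiagonal.antidiagonal w, a x.1 * d x.2|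
        ≤ ∑ x ∈ Finset.HasAntidiagonal.antidiagonal w, a x.1 * |d x.2| := by
      refine (Finset.abs_sum_le_sum_abs _ _).trans (le_of_eq ?_)
      exact Finset.sum_congr rfl fun x _ => by rw [abs_mul, abs_of_nonneg (ha _)]
    have h3 := hdrec w
    have h4 := abs_sub_abs_le_abs_sub ((w : ℝ) * d w) (∑ x ∈ Finset.HasAntidiagonal.antidiagonal w, a x.1 * d x.2)
    rw [abs_mul, Nat.abs_cast] at h4
    linarith
  have h2 : ∑ x ∈ Finset.HasAntidiagonal.antidiagonal w, a x.1 * |d x.2|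
      ≤ ∑ x ∈ Finset.HasAntidiagonal.antidiagonal w, a x.1 * ∑ y ∈ Finset.HasAntidiagonal.antidiagonal x.2, e y.1 * c y.2 := by
    refine Finset.sum_le_sum fun x hx => ?_
    rcases Nat.eq_zero_or_pos x.1 with h | h
    · simp [h, ha0]
    · have := Finset.HasAntidiagonal.mem_antidiagonal.1 hx
      exact mul_le_mul_of_nonneg_left (ih _ (by omega)) (ha _)
  have h3 : ∑ x ∈ Finset.HasAntidiagonal.antidiagonal w, e x.1 * (x.2 * c x.2) + e w
      ≤ w * ∑ x ∈ Finset.HasAntidiagonal.antidiagonal w, e x.1 * c x.2 := by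
    have hmem : (w, 0) ∈ Finset.HasAntidiagonal.antidiagonal w := by simp
    rw [← Finset.add_sum_erase _ _ hmem, ← Finset.add_sum_erase _ _ hmem, mul_add, Finset.mul_sum]
    have hw1 : (1 : ℝ) ≤ w := by exact_mod_cast hw
    have : ∑ x ∈ (Finset.HasAntidiagonal.antidiagonal w).erase (w, 0), e x.1 * (x.2 * c x.2)
        ≤ ∑ x ∈ (Finset.HasAntidiagonal.antidiagonal w).erase (w, 0), (w : ℝ) * (e x.1 * c x.2) := by
      refine Finset.sum_le_sum fun x hx => ?_
      have h5 := Finset.HasAntidiagonal.mem_antidiagonal.1 (Finset.mem_of_mem_erase hx)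
      have h6 : (x.2 : ℝ) ≤ w := by exact_mod_cast (by omega : x.2 ≤ w)
      nlinarith [mul_le_mul_of_nonneg_right h6 (mul_nonneg (he x.1) (hc x.2))]
    simp only [hc0]
    push_cast
    nlinarith [mul_le_mul_of_nonneg_right hw1 (he w)]
  have h4 : (w : ℝ) * |d w| ≤ w * ∑ x ∈ Finset.HasAntidiagonal.antidiagonal w, e x.1 * c x.2 := by
    linarith
  exact le_of_mul_le_mul_left h4 (by exact_mod_cast hw)

/-- A probability vector that satisfies the recursion of a compound Poisson law up to errors `e`
is close to that law. -/
lemma tsum_abs_sub_le_of_recursion {a p q e : ℕ → ℝ} (ha : ∀ k, 0 ≤ a k) (ha0 : a 0 = 0)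
    (hq : ∀ k, 0 ≤ q k) (hq0 : 0 < q 0) (hp1 : HasSum p 1) (hq1 : HasSum q 1)
    (he : ∀ k, 0 ≤ e k) (hes : Summable e)
    (hqrec : ∀ w : ℕ, (w : ℝ) * q w = ∑ x ∈ Finset.HasAntidiagonal.antidiagonal w, a x.1 * q x.2)
    (hprec : ∀ w : ℕ, |(w : ℝ) * p w - ∑ x ∈ Finset.HasAntidiagonal.antidiagonal w, a x.1 * p x.2| ≤ e w) :
    Summable (fun w => |p w - q w|) ∧ ∑' w, |p w - q w| ≤ 2 * (q 0)⁻¹ * ∑' w, e w := by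
  set c : ℕ → ℝ := fun w => (q 0)⁻¹ * q w with hcdef
  have hc : ∀ k, 0 ≤ c k := fun k => mul_nonneg (inv_nonneg.2 hq0.le) (hq k)
  have hc0 : c 0 = 1 := inv_mul_cancel₀ hq0.ne'
  have hcs : HasSum c (q 0)⁻¹ := by simpa using hq1.mul_left (q 0)⁻¹
  have hcrec : ∀ w : ℕ, (w : ℝ) * c w = ∑ x ∈ Finset.HasAntidiagonal.antidiagonal w, a x.1 * c x.2 := by
    intro w
    have : ∑ x ∈ Finset.HasAntidiagonal.antidiagonal w, a x.1 * c x.2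
        = (q 0)⁻¹ * ∑ x ∈ Finset.HasAntidiagonal.antidiagonal w, a x.1 * q x.2 := by
      rw [Finset.mul_sum]; exact Finset.sum_congr rfl fun x _ => by simp only [hcdef]; ring
    rw [this, ← hqrec]; simp only [hcdef]; ring
  set d : ℕ → ℝ := fun w => p w - p 0 * c w with hddef
  have hd := abs_le_convolution_of_perturbed_recursion (d := d) ha ha0 hc hc0 he
    (by simp [hddef, hc0]) hcrec (fun w => by
      have : ∑ x ∈ Finset.HasAntidiagonal.antidiagonal w, a x.1 * d x.2
        = ∑ x ∈ Finset.HasAntidiagonal.antidiagonal w, a x.1 * p x.2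
          - p 0 * ∑ x ∈ Finset.HasAntidiagonal.antidiagonal w, a x.1 * c x.2 := by
        rw [Finset.mul_sum, ← Finset.sum_sub_distrib]
        exact Finset.sum_congr rfl fun x _ => by simp only [hddef]; ring
      rw [this, ← hcrec]
      convert hprec w using 2
      simp only [hddef]; ring)
  have hsn : Summable fun w => ∑ x ∈ Finset.HasAntidiagonal.antidiagonal w, e x.1 * c x.2 :=
    summable_sum_mul_antidiagonal_of_summable_mul (f := e) (g := c)
      (summable_mul_of_summable_norm (hes.norm) (hcs.summable.norm))
  have htn : ∑' w, ∑ x ∈ Finset.HasAntidiagonal.antidiagonal w, e x.1 * c x.2 = (∑' w, e w) * (q 0)⁻¹ := by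
    rw [← hcs.tsum_eq]
    exact (tsum_mul_tsum_eq_tsum_sum_antidiagonal_of_summable_norm hes.norm hcs.summable.norm).symm
  have hds : Summable fun w => |d w| := Summable.of_nonneg_of_le (fun _ => abs_nonneg _) hd hsn
  have hdt : ∑' w, |d w| ≤ (∑' w, e w) * (q 0)⁻¹ := (hds.tsum_le_tsum hd hsn).trans htn.le
  have hdsum : HasSum d (1 - p 0 * (q 0)⁻¹) := hp1.sub (hcs.mul_left (p 0))
  have h0 : |1 - p 0 * (q 0)⁻¹| ≤ (∑' w, e w) * (q 0)⁻¹ := by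
    rw [← hdsum.tsum_eq]
    have h1 : ‖∑' w, d w‖ ≤ ∑' w, ‖d w‖ := norm_tsum_le_tsum_norm hds
    exact h1.trans hdt
  have hle : ∀ w, |p w - q w| ≤ |1 - p 0 * (q 0)⁻¹| * q w + |d w| := by
    intro w
    have h1 : p w - q w = -((1 - p 0 * (q 0)⁻¹) * q w) + d w := by
      simp only [hddef, hcdef]; ring
    rw [h1]
    refine (abs_add_le _ _).trans (le_of_eq ?_)
    rw [abs_neg, abs_mul, abs_of_nonneg (hq w)]
  have hs2 : Summable fun w => |1 - p 0 * (q 0)⁻¹| * q w + |d w| :=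
    (hq1.summable.mul_left _).add hds
  have hs : Summable fun w => |p w - q w| :=
    Summable.of_nonneg_of_le (fun _ => abs_nonneg _) hle hs2
  refine ⟨hs, (hs.tsum_le_tsum hle hs2).trans ?_⟩
  rw [(hq1.summable.mul_left _).tsum_add hds, tsum_mul_left, hq1.tsum_eq]
  linarith

/-! ### Compound Poisson laws -/

lemma conv_apply_singleton (μ ν : Measure ℕ) [SFinite μ] [SFinite ν] (w : ℕ) :
    (μ.conv ν) {w} = ∑ x ∈ Finset.HasAntidiagonal.antidiagonal w, μ {x.1} * ν {x.2} := by
  rw [Measure.conv, Measure.map_apply (by fun_prop) (measurableSet_singleton w)]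
  have : (fun x : ℕ × ℕ => x.1 + x.2) ⁻¹' {w}
      = ((Finset.HasAntidiagonal.antidiagonal w : Finset (ℕ × ℕ)) : Set (ℕ × ℕ)) := by
    ext x; simp
  rw [this, ← sum_measure_singleton]
  refine Finset.sum_congr rfl fun x _ => ?_
  rw [← Prod.mk.eta (p := x), ← Set.singleton_prod_singleton, Measure.prod_prod]

lemma jumpLaw_singleton (r : ℕ → ℝ≥0) (k : ℕ) :
    jumpLaw r {k} = ((r k / ∑' j, r j : ℝ≥0) : ℝ≥0∞) := by
  rw [jumpLaw, Measure.sum_apply _ (measurableSet_singleton k), tsum_eq_single k]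
  · simp
  · intro j hj; simp [hj]

lemma isProbabilityMeasure_jumpLaw {r : ℕ → ℝ≥0} (hr : Summable r) (h0 : ∑' j, r j ≠ 0) :
    IsProbabilityMeasure (jumpLaw r) := by
  constructor
  rw [jumpLaw, Measure.sum_apply _ MeasurableSet.univ]
  have : ∑' k, r k / ∑' j, r j = 1 := by rw [tsum_div_const, div_self h0]
  simp only [Measure.smul_apply, measure_univ, smul_eq_mul, mul_one]
  rw [← ENNReal.coe_tsum (hr.div_const _), this]; rfl

lemma isProbabilityMeasure_iidSumLaw (ρ : Measure ℕ) [IsProbabilityMeasure ρ] (m : ℕ) :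
    IsProbabilityMeasure (iidSumLaw ρ m) := by
  induction m with
  | zero => rw [iidSumLaw]; infer_instance
  | succ m ih => rw [iidSumLaw]; infer_instance

lemma compoundPoisson_eq_dirac {r : ℕ → ℝ≥0} (h0 : ∑' j, r j = 0) :
    compoundPoisson r = Measure.dirac 0 := by
  have hP : poissonMeasure 0 = Measure.dirac 0 := by
    refine Measure.ext_of_singleton fun n => ?_
    rw [poissonMeasure_singleton]
    cases n <;> simp
  rw [compoundPoisson, h0, hP, Measure.dirac_bind (measurable_of_countable _), iidSumLaw]

lemma isProbabilityMeasure_compoundPoisson {r : ℕ → ℝ≥0} (hr : Summable r) :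
    IsProbabilityMeasure (compoundPoisson r) := by
  by_cases h0 : ∑' j, r j = 0
  · rw [compoundPoisson_eq_dirac h0]; infer_instance
  have := isProbabilityMeasure_jumpLaw hr h0
  constructor
  rw [compoundPoisson, Measure.bind_apply MeasurableSet.univ
    (measurable_of_countable _).aemeasurable]
  have (m : ℕ) : iidSumLaw (jumpLaw r) m Set.univ = 1 :=
    (isProbabilityMeasure_iidSumLaw _ m).measure_univ
  simp [this]

lemma iidSumLaw_real_singleton {r : ℕ → ℝ≥0} (hr : Summable r) (h0 : ∑' j, r j ≠ 0) (m w : ℕ) :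
    (iidSumLaw (jumpLaw r) m).real {w}
      = PowerSeries.coeff w ((PowerSeries.mk fun k => (r k / ∑' j, r j : ℝ)) ^ m) := by
  have := isProbabilityMeasure_jumpLaw hr h0
  induction m generalizing w with
  | zero =>
    rw [iidSumLaw, pow_zero, PowerSeries.coeff_one, measureReal_def,
      Measure.dirac_apply' _ (measurableSet_singleton w)]
    by_cases h : w = 0 <;> simp [h, eq_comm]
  | succ m ih =>
    have := isProbabilityMeasure_iidSumLaw (jumpLaw r) m
    rw [iidSumLaw, measureReal_def, conv_apply_singleton, pow_succ', PowerSeries.coeff_mul,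
      ENNReal.toReal_sum (fun _ _ => ENNReal.mul_ne_top (measure_ne_top _ _) (measure_ne_top _ _))]
    refine Finset.sum_congr rfl fun x _ => ?_
    rw [ENNReal.toReal_mul, ← measureReal_def (μ := iidSumLaw _ _), ih, jumpLaw_singleton]
    simp

lemma compoundPoisson_real_singleton {r : ℕ → ℝ≥0} (hr : Summable r) (h0 : ∑' j, r j ≠ 0)
    (w : ℕ) :
    HasSum (fun m : ℕ => Real.exp (-∑' j, (r j : ℝ)) * (∑' j, (r j : ℝ)) ^ m / m.factorial *
      PowerSeries.coeff w ((PowerSeries.mk fun k => (r k / ∑' j, r j : ℝ)) ^ m))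
      ((compoundPoisson r).real {w}) := by
  have := isProbabilityMeasure_jumpLaw hr h0
  have hi (m : ℕ) := isProbabilityMeasure_iidSumLaw (jumpLaw r) m
  have h1 : (compoundPoisson r) {w}
      = ∑' m, iidSumLaw (jumpLaw r) m {w} * poissonMeasure (∑' j, r j) {m} := by
    rw [compoundPoisson, Measure.bind_apply (measurableSet_singleton w)
      (measurable_of_countable _).aemeasurable, lintegral_countable']
  have hfin (m : ℕ) : iidSumLaw (jumpLaw r) m {w} * poissonMeasure (∑' j, r j) {m} ≠ ∞ :=
    ENNReal.mul_ne_top (measure_ne_top _ _) (measure_ne_top _ _)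
  have hne : ∑' m, iidSumLaw (jumpLaw r) m {w} * poissonMeasure (∑' j, r j) {m} ≠ ∞ := by
    rw [← h1]
    have := isProbabilityMeasure_compoundPoisson hr
    exact measure_ne_top _ _
  have h2 := (ENNReal.hasSum_toReal hne)
  rw [measureReal_def, h1, ENNReal.tsum_toReal_eq hfin]
  convert h2 using 2 with m
  rw [ENNReal.toReal_mul, ← measureReal_def, ← measureReal_def, iidSumLaw_real_singleton hr h0,
    poissonMeasure_real_singleton]
  push_cast
  ring

lemma compoundPoisson_real_zero {r : ℕ → ℝ≥0} (hr : Summable r) (hr0 : r 0 = 0) :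
    (compoundPoisson r).real {0} = Real.exp (-∑' j, (r j : ℝ)) := by
  by_cases h0 : ∑' j, r j = 0
  · have : ∑' j, (r j : ℝ) = 0 := by rw [← NNReal.coe_tsum, h0]; rfl
    rw [compoundPoisson_eq_dirac h0, this]; simp [measureReal_def]
  refine (compoundPoisson_real_singleton hr h0 0).unique ?_
  convert hasSum_single 0 ?_ using 1
  · simp
  · intro m hm
    simp [hr0, hm]

/-- The recursion for the weights of a compound Poisson law. -/
lemma compoundPoisson_recursion {r : ℕ → ℝ≥0} (hr : Summable r) (w : ℕ) :
    (w : ℝ) * (compoundPoisson r).real {w}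
      = ∑ x ∈ Finset.HasAntidiagonal.antidiagonal w,
        (x.1 * (r x.1 : ℝ)) * (compoundPoisson r).real {x.2} := by
  by_cases h0 : ∑' j, r j = 0
  · have hz : ∀ k, r k = 0 := by
      intro k
      have := hr.le_tsum k (fun _ _ => zero_le)
      rw [h0] at this
      exact le_antisymm this zero_le
    rw [compoundPoisson_eq_dirac h0]
    cases w <;> simp [hz, measureReal_def]
  set l : ℝ := ∑' j, (r j : ℝ) with hl
  have hl0 : l ≠ 0 := by
    rw [hl, ← NNReal.coe_tsum]; exact_mod_cast h0
  set R : PowerSeries ℝ := PowerSeries.mk fun k => (r k / ∑' j, r j : ℝ) with hR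
  set D : PowerSeries ℝ := PowerSeries.mk fun k : ℕ => (k * r k : ℝ) with hD
  have hS := compoundPoisson_real_singleton hr h0
  simp only [← hl, ← hR] at hS
  have hder (F : PowerSeries ℝ) (w : ℕ) : (w : ℝ) * PowerSeries.coeff w F
      = PowerSeries.coeff w (PowerSeries.X * PowerSeries.derivative ℝ F) := by
    cases w with
    | zero => simp
    | succ w =>
      rw [PowerSeries.coeff_succ_X_mul, PowerSeries.coeff_derivative]; push_cast; ring
  have hXR : PowerSeries.C l * (PowerSeries.X * PowerSeries.derivative ℝ R) = D := by
    ext k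
    rw [PowerSeries.coeff_C_mul, ← hder, hR, hD, PowerSeries.coeff_mk, PowerSeries.coeff_mk,
      NNReal.coe_tsum, ← hl]
    field_simp
  have hpow (m : ℕ) : (w : ℝ) * PowerSeries.coeff w (R ^ (m + 1)) * l
      = (m + 1) * PowerSeries.coeff w (D * R ^ m) := by
    rw [hder, Derivation.leibniz_pow, ← hXR]
    have : PowerSeries.C l * (PowerSeries.X * PowerSeries.derivative ℝ R) * R ^ m
      = PowerSeries.C l * (PowerSeries.X * PowerSeries.derivative ℝ R * R ^ m) := by ring
    rw [this, PowerSeries.coeff_C_mul]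
    have : PowerSeries.X * (m + 1) • R ^ (m + 1 - 1) • PowerSeries.derivative ℝ R
      = ((m + 1 : ℕ) : ℝ) • (PowerSeries.X * PowerSeries.derivative ℝ R * R ^ m) := by
      rw [Nat.cast_smul_eq_nsmul, smul_eq_mul, nsmul_eq_mul, nsmul_eq_mul, Nat.add_sub_cancel]
      ring
    rw [this, PowerSeries.coeff_smul]
    push_cast; simp only [smul_eq_mul]; ring
  have h1 : HasSum (fun m : ℕ => Real.exp (-l) * l ^ m / m.factorial *
      PowerSeries.coeff w (D * R ^ m)) ((w : ℝ) * (compoundPoisson r).real {w}) := by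
    have h2 := (hS w).mul_left (w : ℝ)
    rw [← hasSum_nat_add_iff' 1] at h2
    simp only [Finset.sum_range_one, pow_zero, PowerSeries.coeff_one] at h2
    have h3 : (w : ℝ) * (Real.exp (-l) * 1 / (Nat.factorial 0) * if w = 0 then 1 else 0) = 0 := by
      by_cases hw : w = 0 <;> simp [hw]
    rw [h3, sub_zero] at h2
    refine h2.congr_fun fun m => ?_
    have h4 := hpow m
    rw [Nat.factorial_succ, pow_succ]
    have h5 : ((m : ℝ) + 1) ≠ 0 := by positivity
    have h6 : (m.factorial : ℝ) ≠ 0 := by positivity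
    push_cast
    field_simp
    linarith
  refine h1.unique ?_
  have h2 := hasSum_sum (s := Finset.HasAntidiagonal.antidiagonal w) (fun x _ =>
    (hS x.2).mul_left (x.1 * (r x.1 : ℝ)))
  refine h2.congr_fun fun m => ?_
  rw [PowerSeries.coeff_mul, Finset.mul_sum]
  refine Finset.sum_congr rfl fun x _ => ?_
  rw [hD, PowerSeries.coeff_mk]; ring

/-! ### The `ℓ¹` distance -/

/-- The `ℓ¹` distance between two sequences of weights. -/
def l1Dist (a b : ℕ → ℝ≥0∞) : ℝ≥0∞ := ∑' w, ((a w - b w) + (b w - a w))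

lemma l1Dist_triangle (a b c : ℕ → ℝ≥0∞) : l1Dist a c ≤ l1Dist a b + l1Dist b c := by
  rw [l1Dist, l1Dist, l1Dist, ← ENNReal.tsum_add]
  refine ENNReal.tsum_le_tsum fun w => ?_
  calc a w - c w + (c w - a w)
      ≤ ((a w - b w) + (b w - c w)) + ((c w - b w) + (b w - a w)) :=
        add_le_add tsub_le_tsub_add_tsub tsub_le_tsub_add_tsub
    _ = _ := by ring

@[simp] lemma l1Dist_self (a : ℕ → ℝ≥0∞) : l1Dist a a = 0 := by simp [l1Dist]

lemma l1Dist_const_mul_le (c : ℝ≥0∞) (hc : c ≠ ∞) (a b : ℕ → ℝ≥0∞) :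
    l1Dist (fun w => c * a w) (fun w => c * b w) ≤ c * l1Dist a b := by
  rw [l1Dist, l1Dist, ← ENNReal.tsum_mul_left]
  refine ENNReal.tsum_le_tsum fun w => ?_
  rw [mul_add, ENNReal.mul_sub (fun _ _ => hc), ENNReal.mul_sub (fun _ _ => hc)]

lemma l1Dist_mul_const_le (c c' : ℝ≥0∞) (a : ℕ → ℝ≥0∞) (ha : ∀ w, a w ≠ ∞) :
    l1Dist (fun w => c * a w) (fun w => c' * a w) ≤ ((c - c') + (c' - c)) * ∑' w, a w := by
  rw [l1Dist, ← ENNReal.tsum_mul_left]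
  refine ENNReal.tsum_le_tsum fun w => ?_
  rw [add_mul, ENNReal.sub_mul (fun _ _ => ha w), ENNReal.sub_mul (fun _ _ => ha w)]

lemma l1Dist_lintegral_le {Θ : Type*} [MeasurableSpace Θ] (τ : Measure Θ) (a b : Θ → ℕ → ℝ≥0∞)
    (ha : ∀ w, Measurable fun θ => a θ w) (hb : ∀ w, Measurable fun θ => b θ w) :
    l1Dist (fun w => ∫⁻ θ, a θ w ∂τ) (fun w => ∫⁻ θ, b θ w ∂τ) ≤ ∫⁻ θ, l1Dist (a θ) (b θ) ∂τ := by
  simp only [l1Dist]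
  have hm (w : ℕ) : AEMeasurable (fun θ => (a θ w - b θ w) + (b θ w - a θ w)) τ :=
    (((ha w).sub (hb w)).add ((hb w).sub (ha w))).aemeasurable
  rw [lintegral_tsum hm]
  refine ENNReal.tsum_le_tsum fun w => ?_
  have hm' : Measurable fun θ => a θ w - b θ w := (ha w).sub (hb w)
  rw [lintegral_add_left hm']
  exact add_le_add (lintegral_sub_le _ _ (hb w)) (lintegral_sub_le _ _ (ha w))

lemma tsum_measure_inter_fiber {α : Type*} [MeasurableSpace α] (μ : Measure α) {S : Set α}
    (hS : MeasurableSet S) {F : α → ℕ} (hF : Measurable F) :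
    ∑' w, μ (S ∩ {x | F x = w}) = μ S := by
  rw [← measure_iUnion]
  · congr 1; ext x; simp
  · intro v w hvw
    rw [Function.onFun, Set.disjoint_left]
    rintro x ⟨_, h1⟩ ⟨_, h2⟩
    exact hvw (h1.symm.trans h2)
  · exact fun w => hS.inter (hF (measurableSet_singleton w))

lemma l1Dist_le_of_coupling {α : Type*} [MeasurableSpace α] (μ : Measure α) {S : Set α}
    (hS : MeasurableSet S) {F F' : α → ℕ} (hF : Measurable F) (hF' : Measurable F') :
    l1Dist (fun w => μ (S ∩ {x | F x = w})) (fun w => μ (S ∩ {x | F' x = w}))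
      ≤ 2 * μ (S ∩ {x | F x ≠ F' x}) := by
  have hD : MeasurableSet (S ∩ {x | F x ≠ F' x}) :=
    hS.inter (measurableSet_eq_fun hF hF').compl
  rw [l1Dist, ENNReal.tsum_add, two_mul]
  have key {F F' : α → ℕ} : ∀ w, μ (S ∩ {x | F x = w}) - μ (S ∩ {x | F' x = w})
      ≤ μ (S ∩ {x | F x ≠ F' x} ∩ {x | F x = w}) := by
    intro w
    refine (le_measure_sdiff).trans (measure_mono ?_)
    rintro x ⟨⟨h1, h2⟩, h3⟩
    refine ⟨⟨h1, fun h => h3 ⟨h1, ?_⟩⟩, h2⟩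
    exact h.symm.trans h2
  refine add_le_add ?_ ?_
  · exact (ENNReal.tsum_le_tsum key).trans (tsum_measure_inter_fiber μ hD hF).le
  · refine (ENNReal.tsum_le_tsum key).trans ?_
    simp only [ne_comm (a := F' _)]
    exact (tsum_measure_inter_fiber μ hD hF').le

lemma l1Dist_le_two_mul_of_forall {a b : ℕ → ℝ≥0∞} {M : ℝ≥0∞} (ha : ∑' w, a w ≠ ∞)
    (hb : ∑' w, b w ≠ ∞) (hab : ∀ B : Set ℕ, ∑' w : B, a w ≤ ∑' w : B, b w + M)
    (hba : ∀ B : Set ℕ, ∑' w : B, b w ≤ ∑' w : B, a w + M) : l1Dist a b ≤ 2 * M := by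
  rw [l1Dist, ENNReal.tsum_add, two_mul]
  have key {a b : ℕ → ℝ≥0∞} (hb : ∑' w, b w ≠ ∞)
      (hab : ∀ B : Set ℕ, ∑' w : B, a w ≤ ∑' w : B, b w + M) : ∑' w, (a w - b w) ≤ M := by
    set B : Set ℕ := {w | b w ≤ a w}
    have h1 : ∑' w, (a w - b w) = ∑' w, (B.indicator a w - B.indicator b w) := by
      refine tsum_congr fun w => ?_
      by_cases hw : w ∈ B
      · simp [hw]
      · have hw' : a w ≤ b w := (not_le.1 fun h => hw h).le
        simp [hw, tsub_eq_zero_of_le hw']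
    have h2 : ∑' w, B.indicator b w ≠ ∞ :=
      ne_top_of_le_ne_top hb (ENNReal.tsum_le_tsum fun w => Set.indicator_le_self _ _ _)
    have h3 : B.indicator b ≤ B.indicator a := by
      intro w
      by_cases hw : w ∈ B
      · rw [Set.indicator_of_mem hw, Set.indicator_of_mem hw]; exact hw
      · simp [hw]
    rw [h1, ENNReal.tsum_sub h2 h3]
    refine tsub_le_iff_left.2 ?_
    rw [← tsum_subtype, ← tsum_subtype]
    exact hab B
  exact add_le_add (key hb hab) (key ha hba)

lemma ofReal_abs_toReal_sub {x y : ℝ≥0∞} (hx : x ≠ ∞) (hy : y ≠ ∞) :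
    ENNReal.ofReal |x.toReal - y.toReal| = (x - y) + (y - x) := by
  rcases le_total x y with h | h
  · have h' := ENNReal.toReal_mono hy h
    rw [tsub_eq_zero_of_le h, zero_add, abs_of_nonpos (by linarith), neg_sub,
      ENNReal.ofReal_sub _ ENNReal.toReal_nonneg, ENNReal.ofReal_toReal hx, ENNReal.ofReal_toReal hy]
  · have h' := ENNReal.toReal_mono hx h
    rw [tsub_eq_zero_of_le h, add_zero, abs_of_nonneg (by linarith),
      ENNReal.ofReal_sub _ ENNReal.toReal_nonneg, ENNReal.ofReal_toReal hx, ENNReal.ofReal_toReal hy]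

lemma hasSum_measureReal_singleton (μ : Measure ℕ) [IsFiniteMeasure μ] (A : Set ℕ) :
    HasSum (fun w => A.indicator (fun w => μ.real {w}) w) (μ.real A) := by
  have h1 : μ A = ∑' w, A.indicator (fun w => μ {w}) w := by
    rw [← tsum_subtype A fun w => μ {w}]
    exact (Measure.tsum_indicator_apply_singleton μ A (MeasurableSet.of_discrete) ▸
      (tsum_subtype A fun w => μ {w}).symm)
  have h2 := ENNReal.hasSum_toReal (h1 ▸ measure_ne_top μ A)
  have h3 : (∑' w, (A.indicator (fun w => μ {w}) w).toReal) = μ.real A := by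
    rw [measureReal_def, h1, ENNReal.tsum_toReal_eq]
    intro w
    by_cases hw : w ∈ A <;> simp [hw]
  rw [h3] at h2
  refine h2.congr_fun fun w => ?_
  by_cases hw : w ∈ A <;> simp [hw, measureReal_def]

lemma tvDist_le_tsum (μ ν : Measure ℕ) [IsFiniteMeasure μ] [IsFiniteMeasure ν]
    (h : Summable fun w => |μ.real {w} - ν.real {w}|) :
    tvDist μ ν ≤ ∑' w, |μ.real {w} - ν.real {w}| := by
  refine ciSup_le fun A => ?_
  have h1 := (hasSum_measureReal_singleton μ A).sub (hasSum_measureReal_singleton ν A)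
  have h2 : ∀ w, |A.indicator (fun w => μ.real {w}) w - A.indicator (fun w => ν.real {w}) w|
      ≤ |μ.real {w} - ν.real {w}| := by
    intro w; by_cases hw : w ∈ A <;> simp [hw]
  have h3 := Summable.of_nonneg_of_le (fun _ => abs_nonneg _) h2 h
  rw [← h1.tsum_eq]
  have h4 : ‖∑' w, (A.indicator (fun w => μ.real {w}) w - A.indicator (fun w => ν.real {w}) w)‖
      ≤ ∑' w, ‖A.indicator (fun w => μ.real {w}) w - A.indicator (fun w => ν.real {w}) w‖ :=
    norm_tsum_le_tsum_norm h3
  exact h4.trans (h3.tsum_le_tsum h2 h)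

/-- Compound Poisson approximation: the total variation distance to a compound Poisson law is
controlled by the defect in the recursion of that law. -/
theorem ofReal_tvDist_compoundPoisson_le (p : Measure ℕ) [IsProbabilityMeasure p] {r : ℕ → ℝ≥0}
    (hr : Summable r) (hr0 : r 0 = 0) :
    ENNReal.ofReal (tvDist p (compoundPoisson r)) ≤
      2 * ENNReal.ofReal (Real.exp (∑' k, (r k : ℝ))) *
        l1Dist (fun w => w * p {w})
          (fun w => ∑ x ∈ Finset.HasAntidiagonal.antidiagonal w, (x.1 * r x.1) * p {x.2}) := by
  have := isProbabilityMeasure_compoundPoisson hr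
  set a' : ℕ → ℝ≥0∞ := fun w => w * p {w} with ha'
  set b' : ℕ → ℝ≥0∞ := fun w => ∑ x ∈ Finset.HasAntidiagonal.antidiagonal w,
    (x.1 * r x.1) * p {x.2} with hb'
  have ha'f (w) : a' w ≠ ∞ := ENNReal.mul_ne_top (by simp) (measure_ne_top _ _)
  have hb'f (w) : b' w ≠ ∞ := ENNReal.sum_ne_top.2 fun _ _ =>
    ENNReal.mul_ne_top (ENNReal.mul_ne_top (by simp) (by simp)) (measure_ne_top _ _)
  by_cases htop : l1Dist a' b' = ∞
  · rw [htop, ENNReal.mul_top]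
    · exact le_top
    · simp [Real.exp_pos]
  set e : ℕ → ℝ := fun w => |(a' w).toReal - (b' w).toReal| with he
  have hee (w) : ENNReal.ofReal (e w) = (a' w - b' w) + (b' w - a' w) :=
    ofReal_abs_toReal_sub (ha'f w) (hb'f w)
  have hes : ∑' w, ENNReal.ofReal (e w) ≠ ∞ := by simpa only [hee, l1Dist] using htop
  have hes' : Summable e := by
    have := ENNReal.summable_toReal hes
    refine this.congr fun w => ?_
    rw [ENNReal.toReal_ofReal (abs_nonneg _)]
  have hone (μ : Measure ℕ) [IsProbabilityMeasure μ] : HasSum (fun w => μ.real {w}) 1 := by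
    simpa using hasSum_measureReal_singleton μ Set.univ
  have hmain := tsum_abs_sub_le_of_recursion (a := fun k => k * (r k : ℝ))
    (p := fun w => p.real {w}) (q := fun w => (compoundPoisson r).real {w}) (e := e)
    (fun k => by positivity) (by simp) (fun k => measureReal_nonneg)
    (by rw [compoundPoisson_real_zero hr hr0]; exact Real.exp_pos _)
    (hone p) (hone _) (fun k => abs_nonneg _) hes' (fun w => compoundPoisson_recursion hr w)
    (fun w => le_of_eq (by
      simp only [he, ha', hb']
      rw [ENNReal.toReal_sum fun _ _ =>
        ENNReal.mul_ne_top (ENNReal.mul_ne_top (by simp) (by simp)) (measure_ne_top _ _)]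
      simp [ENNReal.toReal_mul, measureReal_def]))
  have h1 : tvDist p (compoundPoisson r) ≤ 2 * Real.exp (∑' k, (r k : ℝ)) * ∑' w, e w := by
    refine (tvDist_le_tsum p (compoundPoisson r) hmain.1).trans (hmain.2.trans (le_of_eq ?_))
    rw [compoundPoisson_real_zero hr hr0, ← Real.exp_neg, neg_neg]
  refine (ENNReal.ofReal_le_ofReal h1).trans (le_of_eq ?_)
  rw [ENNReal.ofReal_mul (by positivity), ENNReal.ofReal_mul (by norm_num),
    ENNReal.ofReal_tsum_of_nonneg (fun _ => abs_nonneg _) hes']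
  rw [tsum_congr hee, l1Dist]
  norm_num

/-! ### Sequences of independent samples -/

/-- Prepend a sample to a sequence. -/
def consSeq {β : Type*} (p : β) (φ : ℕ → β) : ℕ → β
  | 0 => p
  | i + 1 => φ i

@[simp] lemma consSeq_zero {β : Type*} (p : β) (φ : ℕ → β) : consSeq p φ 0 = p := rfl

@[simp] lemma consSeq_succ {β : Type*} (p : β) (φ : ℕ → β) (i : ℕ) : consSeq p φ (i + 1) = φ i := rfl

section InfiniteProducts

variable {α : Type*} [MeasurableSpace α] (ν : Measure α) [IsProbabilityMeasure ν]

/-- The law of an independent and identically distributed sequence. -/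
abbrev seqLaw : Measure (ℕ → α) := Measure.infinitePi fun _ => ν

lemma seqLaw_map_injective {σ : ℕ → ℕ} (hσ : Function.Injective σ) :
    (seqLaw ν).map (fun φ i => φ (σ i)) = seqLaw ν :=
  Measure.map_infinitePi_infinitePi_of_inj (P := fun _ => ν) hσ

lemma seqLaw_map_comp {β : Type*} [MeasurableSpace β] {g : α → β} (hg : Measurable g)
    (ν' : Measure β) [IsProbabilityMeasure ν'] (h : ν.map g = ν') :
    (seqLaw ν).map (fun φ i => g (φ i)) = seqLaw ν' := by
  subst h
  exact Measure.infinitePi_map_pi (fun _ => ν) (fun _ => hg)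

lemma measurable_consSeq : Measurable fun x : α × (ℕ → α) => consSeq x.1 x.2 := by
  refine measurable_pi_lambda _ fun i => ?_
  cases i with
  | zero => exact measurable_fst
  | succ i => exact (measurable_pi_apply i).comp measurable_snd

lemma prod_map_consSeq :
    (ν.prod (seqLaw ν)).map (fun x => consSeq x.1 x.2) = seqLaw ν := by
  classical
  refine Measure.eq_infinitePi _ fun s t ht => ?_
  obtain ⟨n, hn⟩ : ∃ n, s ⊆ Finset.range (n + 1) := by
    obtain ⟨n, hn⟩ := s.exists_nat_subset_range
    exact ⟨n, hn.trans (Finset.range_subset_range.2 (Nat.le_succ n))⟩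
  set t' : ℕ → Set α := fun i => if i ∈ s then t i else Set.univ with ht'
  have hm (i) : MeasurableSet (t' i) := by
    by_cases h : i ∈ s <;> simp [ht', h, ht i]
  have hset : (fun x : α × (ℕ → α) => consSeq x.1 x.2) ⁻¹' ((s : Set ℕ).pi t)
      = t' 0 ×ˢ ((Finset.range n : Finset ℕ) : Set ℕ).pi (fun i => t' (i + 1)) := by
    ext x
    simp only [Set.mem_preimage, Set.mem_pi, Finset.mem_coe, Set.mem_prod, Finset.mem_range]
    constructor
    · intro h
      constructor
      · by_cases h0 : 0 ∈ s
        · simpa [ht', h0] using h 0 h0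
        · simp [ht', h0]
      · intro i _
        by_cases h0 : i + 1 ∈ s
        · simpa [ht', h0] using h (i + 1) h0
        · simp [ht', h0]
    · rintro ⟨h1, h2⟩ i hi
      cases i with
      | zero => simpa [ht', hi] using h1
      | succ i =>
        have := h2 i (by have := Finset.mem_range.1 (hn hi); omega)
        simpa [ht', hi] using this
  rw [Measure.map_apply measurable_consSeq (.pi s.countable_toSet fun _ _ => ht _), hset,
    Measure.prod_prod, Measure.infinitePi_pi _ fun i _ => hm (i + 1), mul_comm,
    ← Finset.prod_range_succ' (fun i => ν (t' i))]
  rw [← Finset.prod_subset hn]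
  · exact Finset.prod_congr rfl fun i hi => by simp [ht', hi]
  · intro i _ hi; simp [ht', hi]

lemma seqLaw_prod_map_unzip :
    (seqLaw (ν.prod ν)).map (fun z => (fun i => (z i).1, fun i => (z i).2))
      = (seqLaw ν).prod (seqLaw ν) := by
  classical
  have hpi : IsPiSystem (squareCylinders fun _ : ℕ => {s : Set α | MeasurableSet s}) :=
    isPiSystem_squareCylinders (fun _ => MeasurableSpace.isPiSystem_measurableSet) (by simp)
  have hgen := generateFrom_squareCylinders (α := fun _ : ℕ => α)
  have hspan : (seqLaw ν).FiniteSpanningSetsIn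
      (squareCylinders fun _ : ℕ => {s : Set α | MeasurableSet s}) :=
    { set := fun _ => Set.univ
      set_mem := fun _ => ⟨∅, fun _ => Set.univ, by simp, by simp⟩
      finite := fun _ => by simp
      spanning := Set.iUnion_const _ }
  refine (Measure.prod_eq_generateFrom hgen hgen hpi hpi hspan hspan ?_).symm
  rintro _ ⟨s, t, ht, rfl⟩ _ ⟨s', u, hu, rfl⟩
  simp only [Set.mem_pi, Set.mem_univ, true_implies, Set.mem_ofPred_eq] at ht hu
  set t' : ℕ → Set α := fun i => if i ∈ s then t i else Set.univ with ht'
  set u' : ℕ → Set α := fun i => if i ∈ s' then u i else Set.univ with hu'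
  have hmt (i) : MeasurableSet (t' i) := by
    by_cases h : i ∈ s <;> simp [ht', h, ht i]
  have hmu (i) : MeasurableSet (u' i) := by
    by_cases h : i ∈ s' <;> simp [hu', h, hu i]
  have hset : (fun z : ℕ → α × α => ((fun i => (z i).1 : ℕ → α), (fun i => (z i).2 : ℕ → α))) ⁻¹'
      ((s : Set ℕ).pi t ×ˢ (s' : Set ℕ).pi u)
      = ((s ∪ s' : Finset ℕ) : Set ℕ).pi (fun i => t' i ×ˢ u' i) := by
    ext z
    simp only [Set.mem_preimage, Set.mem_pi, Finset.mem_coe, Set.mem_prod, Finset.mem_union]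
    constructor
    · rintro ⟨h1, h2⟩ i _
      constructor
      · by_cases h : i ∈ s
        · simpa [ht', h] using h1 i h
        · simp [ht', h]
      · by_cases h : i ∈ s'
        · simpa [hu', h] using h2 i h
        · simp [hu', h]
    · intro h
      exact ⟨fun i hi => by simpa [ht', hi] using (h i (Or.inl hi)).1,
        fun i hi => by simpa [hu', hi] using (h i (Or.inr hi)).2⟩
  rw [Measure.map_apply (by fun_prop) ((MeasurableSet.pi s.countable_toSet fun _ _ => ht _).prod
    (MeasurableSet.pi s'.countable_toSet fun _ _ => hu _)), hset,
    Measure.infinitePi_pi _ fun i _ => (hmt i).prod (hmu i),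
    Measure.infinitePi_pi _ fun i _ => ht i, Measure.infinitePi_pi _ fun i _ => hu i]
  simp only [Measure.prod_prod, Finset.prod_mul_distrib]
  congr 1
  · rw [← Finset.prod_subset Finset.subset_union_left]
    · exact Finset.prod_congr rfl fun i hi => by simp [ht', hi]
    · intro i _ hi; simp [ht', hi]
  · rw [← Finset.prod_subset Finset.subset_union_right]
    · exact Finset.prod_congr rfl fun i hi => by simp [hu', hi]
    · intro i _ hi; simp [hu', hi]

/-- Swap the entries of a pair when both lie in `C`. -/
def swapOn (C : Set α) [DecidablePred (· ∈ C)] (y : α × α) : α × α :=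
  if y.1 ∈ C ∧ y.2 ∈ C then y.swap else y

lemma measurable_swapOn {C : Set α} [DecidablePred (· ∈ C)] (hC : MeasurableSet C) :
    Measurable (swapOn C) :=
  Measurable.ite ((measurable_fst hC).inter (measurable_snd hC)) measurable_swap measurable_id

lemma prod_map_swapOn {C : Set α} [DecidablePred (· ∈ C)] (hC : MeasurableSet C) :
    (ν.prod ν).map (swapOn C) = ν.prod ν := by
  have hm := measurable_swapOn hC
  ext s hs
  have hCC : MeasurableSet (C ×ˢ C) := hC.prod hC
  rw [Measure.map_apply hm hs, ← measure_inter_add_sdiff (swapOn C ⁻¹' s) hCC,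
    ← measure_inter_add_sdiff s hCC]
  have h1 : swapOn C ⁻¹' s ∩ C ×ˢ C = Prod.swap ⁻¹' (s ∩ C ×ˢ C) := by
    ext ⟨x, y⟩
    simp only [Set.mem_inter_iff, Set.mem_preimage, Set.mem_prod, swapOn, Prod.swap_prod_mk]
    by_cases h : x ∈ C ∧ y ∈ C
    · simp [h]
    · simp only [h, and_false, false_iff, not_and]; tauto
  have h2 : swapOn C ⁻¹' s \ C ×ˢ C = s \ C ×ˢ C := by
    ext ⟨x, y⟩
    simp only [Set.mem_sdiff, Set.mem_preimage, Set.mem_prod, swapOn]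
    by_cases h : x ∈ C ∧ y ∈ C <;> simp [h]
  rw [h1, h2, ← Measure.map_apply measurable_swap (hs.inter hCC), Measure.prod_swap]

end InfiniteProducts

set_option linter.unusedSectionVars false

/-! ### Counting hits of a sample -/

section Counting

variable {G 𝒳 : Type*} [MetricSpace G]

/-- Number of hits among the first `l` points of `φ`. -/
def hitCount (h : G → 𝒳 → ℕ) (l : ℕ) (φ : ℕ → G) (x : 𝒳) : ℕ :=
  ∑ i ∈ Finset.range l, h (φ i) x

/-- Number of hits at `p` and at those of the first `l` points of `φ` that lie within `r` of `p`. -/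
def nearCount (h : G → 𝒳 → ℕ) (r : ℝ) (l : ℕ) (p : G) (φ : ℕ → G) (x : 𝒳) : ℕ :=
  h p x + ∑ i ∈ Finset.range l with dist p (φ i) ≤ r, h (φ i) x

/-- Number of hits at those of the first `l` points of `φ` that lie further than `r` from `p`. -/
def farCount (h : G → 𝒳 → ℕ) (r : ℝ) (l : ℕ) (p : G) (φ : ℕ → G) (x : 𝒳) : ℕ :=
  ∑ i ∈ Finset.range l with r < dist p (φ i), h (φ i) x

open Classical in
/-- Swap two points when both are further than `r` from `p`. -/
def farSwap (r : ℝ) (p : G) (y : G × G) : G × G := swapOn {q | r < dist p q} y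

variable {h : G → 𝒳 → ℕ}

lemma nearCount_farSwap {b r : ℝ} (hbr : b ≤ r) (l : ℕ) (p : G) (z : ℕ → G × G) (x : 𝒳) :
    nearCount h b l p (fun i => (farSwap r p (z i)).1) x
      = nearCount h b l p (fun i => (z i).1) x := by
  unfold nearCount
  congr 1
  rw [Finset.sum_filter, Finset.sum_filter]
  refine Finset.sum_congr rfl fun i _ => ?_
  unfold farSwap swapOn
  beta_reduce
  by_cases hc : (z i).1 ∈ {q | r < dist p q} ∧ (z i).2 ∈ {q | r < dist p q}
  · rw [if_pos hc]
    have h1 : r < dist p (z i).1 := hc.1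
    have h2 : r < dist p (z i).2 := hc.2
    rw [if_neg (not_le.2 (hbr.trans_lt h1)), if_neg (not_le.2 _)]
    exact hbr.trans_lt h2
  · rw [if_neg hc]

/-- If no hit lies in the annulus, then the total is the sum of the near and the far hits. -/
lemma exists_of_add_hitCount_ne {b r : ℝ} (hbr : b ≤ r) {l : ℕ} {p : G} {φ : ℕ → G} {x : 𝒳}
    (hne : h p x + hitCount h l φ x ≠ nearCount h b l p φ x + farCount h r l p φ x) :
    ∃ i ∈ Finset.range l, (b < dist p (φ i) ∧ dist p (φ i) ≤ r) ∧ h (φ i) x ≠ 0 := by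
  by_contra hcon
  push Not at hcon
  refine hne ?_
  unfold hitCount nearCount farCount
  rw [add_assoc, Finset.sum_filter, Finset.sum_filter, ← Finset.sum_add_distrib]
  congr 1
  refine Finset.sum_congr rfl fun i hi => ?_
  by_cases h1 : dist p (φ i) ≤ b
  · rw [if_pos h1, if_neg (not_lt.2 (h1.trans hbr)), add_zero]
  · rw [if_neg h1, zero_add]
    by_cases h2 : r < dist p (φ i)
    · rw [if_pos h2]
    · rw [if_neg h2]
      exact hcon i hi ⟨not_le.1 h1, not_lt.1 h2⟩

lemma exists_of_farCount_ne {r : ℝ} {l : ℕ} {p : G} {z : ℕ → G × G} {x : 𝒳}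
    (hne : farCount h r l p (fun i => (z i).1) x
      ≠ hitCount h l (fun i => (farSwap r p (z i)).2) x) :
    ∃ i ∈ Finset.range l, (dist p (z i).1 ≤ r ∨ dist p (z i).2 ≤ r) ∧
      (h (z i).1 x ≠ 0 ∨ h (z i).2 x ≠ 0) := by
  by_contra hcon
  push Not at hcon
  refine hne ?_
  unfold hitCount farCount
  rw [Finset.sum_filter]
  refine Finset.sum_congr rfl fun i hi => ?_
  unfold farSwap swapOn
  beta_reduce
  by_cases hc : (z i).1 ∈ {q | r < dist p q} ∧ (z i).2 ∈ {q | r < dist p q}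
  · rw [if_pos hc, if_pos (show r < dist p (z i).1 from hc.1)]; rfl
  · rw [if_neg hc]
    have h1 : dist p (z i).1 ≤ r ∨ dist p (z i).2 ≤ r := by
      simp only [Set.mem_ofPred_eq, not_and_or, not_lt] at hc; exact hc
    obtain ⟨h2, h3⟩ := hcon i hi h1
    rw [h2, h3]; simp

lemma exists_of_nearCount_ne {b : ℝ} {l l' : ℕ} {p : G} {φ : ℕ → G} {x : 𝒳}
    (hne : nearCount h b l p φ x ≠ nearCount h b l' p φ x) :
    ∃ i ∈ Finset.Ico (min l l') (max l l'), dist p (φ i) ≤ b := by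
  wlog hl : l ≤ l' generalizing l l'
  · have := this hne.symm (le_of_not_ge hl)
    rwa [min_comm, max_comm] at this
  rw [min_eq_left hl, max_eq_right hl]
  by_contra hcon
  push Not at hcon
  refine hne ?_
  unfold nearCount
  congr 1
  rw [Finset.sum_filter, Finset.sum_filter, ← Finset.sum_range_add_sum_Ico _ hl,
    Finset.sum_eq_zero (s := Finset.Ico l l'), add_zero]
  intro i hi
  rw [if_neg (not_le.2 (hcon i hi))]

lemma exists_of_hitCount_ne {l e : ℕ} {φ : ℕ → G} {x : 𝒳}
    (hne : hitCount h l φ x ≠ hitCount h (l + e) φ x) :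
    ∃ i ∈ Finset.Ico l (l + e), h (φ i) x ≠ 0 := by
  by_contra hcon
  push Not at hcon
  refine hne ?_
  unfold hitCount
  rw [← Finset.sum_range_add_sum_Ico _ (Nat.le_add_right l e),
    Finset.sum_eq_zero hcon, add_zero]

end Counting

section CountingMeasurability

variable {G 𝒳 β : Type*} [MetricSpace G] [MeasurableSpace G] [MeasurableSpace 𝒳]
  [MeasurableSpace β]

lemma measurable_sum_range {M : Type*} [MeasurableSpace M] [AddCommMonoid M] [MeasurableAdd₂ M]
    {g : ℕ → β → M} (hg : ∀ i, Measurable (g i)) {k : β → ℕ} (hk : Measurable k) :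
    Measurable fun x => ∑ i ∈ Finset.range (k x), g i x := by
  have : Measurable fun q : ℕ × β => ∑ i ∈ Finset.range q.1, g i q.2 :=
    measurable_from_prod_countable_right fun l =>
      Finset.measurable_fun_sum (Finset.range l) fun i _ => hg i
  exact this.comp (hk.prodMk measurable_id)

lemma measurable_hit {h : G → 𝒳 → ℕ} (hh : Measurable (Function.uncurry h)) {p : β → G}
    {x : β → 𝒳} (hp : Measurable p) (hx : Measurable x) : Measurable fun y => h (p y) (x y) :=
  hh.comp (hp.prodMk hx)

lemma measurable_hitCount {h : G → 𝒳 → ℕ} (hh : Measurable (Function.uncurry h)) {k : β → ℕ}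
    {φ : β → ℕ → G} {x : β → 𝒳} (hk : Measurable k) (hφ : Measurable φ) (hx : Measurable x) :
    Measurable fun y => hitCount h (k y) (φ y) (x y) :=
  measurable_sum_range (fun i => measurable_hit hh ((measurable_pi_apply i).comp hφ) hx) hk

variable [SecondCountableTopology G] [OpensMeasurableSpace G]

lemma measurable_nearCount {h : G → 𝒳 → ℕ} (hh : Measurable (Function.uncurry h)) (r : ℝ)
    {k : β → ℕ} {p : β → G} {φ : β → ℕ → G} {x : β → 𝒳} (hk : Measurable k) (hp : Measurable p)
    (hφ : Measurable φ) (hx : Measurable x) :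
    Measurable fun y => nearCount h r (k y) (p y) (φ y) (x y) := by
  refine (measurable_hit hh hp hx).add ?_
  simp only [Finset.sum_filter]
  have hφi (i : ℕ) : Measurable fun y => φ y i := (measurable_pi_apply i).comp hφ
  refine measurable_sum_range (fun i => ?_) hk
  exact Measurable.ite (measurableSet_le (hp.dist (hφi i)) measurable_const)
    (measurable_hit hh (hφi i) hx) measurable_const

lemma measurable_farCount {h : G → 𝒳 → ℕ} (hh : Measurable (Function.uncurry h)) (r : ℝ)
    {k : β → ℕ} {p : β → G} {φ : β → ℕ → G} {x : β → 𝒳} (hk : Measurable k) (hp : Measurable p)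
    (hφ : Measurable φ) (hx : Measurable x) :
    Measurable fun y => farCount h r (k y) (p y) (φ y) (x y) := by
  simp only [farCount, Finset.sum_filter]
  have hφi (i : ℕ) : Measurable fun y => φ y i := (measurable_pi_apply i).comp hφ
  refine measurable_sum_range (fun i => ?_) hk
  exact Measurable.ite (measurableSet_lt measurable_const (hp.dist (hφi i)))
    (measurable_hit hh (hφi i) hx) measurable_const

lemma measurable_farSwap (r : ℝ) {p : β → G} {y : β → G × G} (hp : Measurable p)
    (hy : Measurable y) : Measurable fun t => farSwap r (p t) (y t) := by
  classical
  have h1 : Measurable fun t => (y t).1 := measurable_fst.comp hy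
  have h2 : Measurable fun t => (y t).2 := measurable_snd.comp hy
  unfold farSwap swapOn
  refine Measurable.ite ?_ (measurable_swap.comp hy) hy
  exact (measurableSet_lt measurable_const (hp.dist h1)).inter
    (measurableSet_lt measurable_const (hp.dist h2))

lemma prod_map_farSwap (r : ℝ) (p : G) (ν : Measure G) [IsProbabilityMeasure ν] :
    (ν.prod ν).map (farSwap r p) = ν.prod ν := by
  classical
  exact prod_map_swapOn ν (measurableSet_lt measurable_const (measurable_const.dist measurable_id))

end CountingMeasurability

/-! ### Couplings for a fixed law of the configuration -/

section Couplings

variable {G 𝒳 : Type*} [MetricSpace G] [MeasurableSpace G] [MeasurableSpace 𝒳]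

/-- A base point, a sequence of pairs of sample points, and a sample size. -/
abbrev Sample (G : Type*) := G × (ℕ → G × G) × ℕ

/-- All hits of the sample, for one configuration. -/
def fullCount (h : G → 𝒳 → ℕ) (θ : Sample G) (y : 𝒳 × 𝒳) : ℕ :=
  h θ.1 y.1 + hitCount h θ.2.2 (fun i => (θ.2.1 i).1) y.1

/-- Near hits and far hits, for one configuration. -/
def splitCount (h : G → 𝒳 → ℕ) (b r : ℝ) (θ : Sample G) (y : 𝒳 × 𝒳) : ℕ :=
  nearCount h b θ.2.2 θ.1 (fun i => (θ.2.1 i).1) y.1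
    + farCount h r θ.2.2 θ.1 (fun i => (θ.2.1 i).1) y.1

/-- Near hits for one configuration, far hits for another one. -/
def decoupledCount (h : G → 𝒳 → ℕ) (b r : ℝ) (θ : Sample G) (y : 𝒳 × 𝒳) : ℕ :=
  nearCount h b θ.2.2 θ.1 (fun i => (θ.2.1 i).1) y.1
    + farCount h r θ.2.2 θ.1 (fun i => (θ.2.1 i).1) y.2

/-- Near hits of the first sample for one configuration, hits of the second sample for another
configuration, after an exchange of far points between the two samples. -/
def swappedCount (h : G → 𝒳 → ℕ) (b r : ℝ) (θ : Sample G) (y : 𝒳 × 𝒳) : ℕ :=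
  nearCount h b θ.2.2 θ.1 (fun i => (θ.2.1 i).1) y.1
    + hitCount h θ.2.2 (fun i => (farSwap r θ.1 (θ.2.1 i)).2) y.2

/-- Near hits of the first sample for one configuration, hits of the second sample for another
configuration. -/
def resampledCount (h : G → 𝒳 → ℕ) (b : ℝ) (θ : Sample G) (y : 𝒳 × 𝒳) : ℕ :=
  nearCount h b θ.2.2 θ.1 (fun i => (θ.2.1 i).1) y.1
    + hitCount h θ.2.2 (fun i => (θ.2.1 i).2) y.2

/-- As `resampledCount`, with a deterministic size of the first sample. -/
def productCount (h : G → 𝒳 → ℕ) (b : ℝ) (l e : ℕ) (θ : Sample G) (y : 𝒳 × 𝒳) : ℕ :=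
  nearCount h b l θ.1 (fun i => (θ.2.1 i).1) y.1
    + hitCount h (θ.2.2 + e) (fun i => (θ.2.1 i).2) y.2

/-- The probability of a hit at `p`. -/
def hitProb (κ : Measure 𝒳) (h : G → 𝒳 → ℕ) (p : G) : ℝ≥0∞ := κ {x | h p x = 1}

/-- The probability of hits at `p` and `q`. -/
def pairProb (κ : Measure 𝒳) (h : G → 𝒳 → ℕ) (p q : G) : ℝ≥0∞ :=
  κ {x | h p x = 1 ∧ h q x = 1}

/-- The law of a count on the event of a hit at the base point. -/
def countLaw (κ : Measure 𝒳) (h : G → 𝒳 → ℕ) (F : Sample G → 𝒳 × 𝒳 → ℕ) (θ : Sample G)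
    (w : ℕ) : ℝ≥0∞ :=
  (κ.prod κ) ({y | h θ.1 y.1 = 1} ∩ {y | F θ y = w})

variable {h : G → 𝒳 → ℕ} (hh : Measurable (Function.uncurry h)) (hb : ∀ p x, h p x = 0 ∨ h p x = 1)
  [SecondCountableTopology G] [OpensMeasurableSpace G]
  (κ : Measure 𝒳) [IsProbabilityMeasure κ]

lemma measurable_sample_fst : Measurable fun t : Sample G × (𝒳 × 𝒳) => fun i => (t.1.2.1 i).1 := by
  fun_prop

lemma measurable_sample_snd : Measurable fun t : Sample G × (𝒳 × 𝒳) => fun i => (t.1.2.1 i).2 := by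
  fun_prop

include hh

lemma measurable_fullCount : Measurable fun t : Sample G × (𝒳 × 𝒳) => fullCount h t.1 t.2 :=
  (measurable_hit hh (by fun_prop) (by fun_prop)).add
    (measurable_hitCount hh (by fun_prop) measurable_sample_fst (by fun_prop))

lemma measurable_splitCount (b r : ℝ) :
    Measurable fun t : Sample G × (𝒳 × 𝒳) => splitCount h b r t.1 t.2 :=
  (measurable_nearCount hh b (by fun_prop) (by fun_prop) measurable_sample_fst (by fun_prop)).add
    (measurable_farCount hh r (by fun_prop) (by fun_prop) measurable_sample_fst (by fun_prop))

lemma measurable_decoupledCount (b r : ℝ) :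
    Measurable fun t : Sample G × (𝒳 × 𝒳) => decoupledCount h b r t.1 t.2 :=
  (measurable_nearCount hh b (by fun_prop) (by fun_prop) measurable_sample_fst (by fun_prop)).add
    (measurable_farCount hh r (by fun_prop) (by fun_prop) measurable_sample_fst (by fun_prop))

lemma measurable_swappedCount (b r : ℝ) :
    Measurable fun t : Sample G × (𝒳 × 𝒳) => swappedCount h b r t.1 t.2 :=
  (measurable_nearCount hh b (by fun_prop) (by fun_prop) measurable_sample_fst (by fun_prop)).add
    (measurable_hitCount hh (by fun_prop) (measurable_pi_lambda _ fun i =>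
      measurable_snd.comp (measurable_farSwap r (by fun_prop) (by fun_prop))) (by fun_prop))

lemma measurable_resampledCount (b : ℝ) :
    Measurable fun t : Sample G × (𝒳 × 𝒳) => resampledCount h b t.1 t.2 :=
  (measurable_nearCount hh b (by fun_prop) (by fun_prop) measurable_sample_fst (by fun_prop)).add
    (measurable_hitCount hh (by fun_prop) measurable_sample_snd (by fun_prop))

lemma measurable_productCount (b : ℝ) (l e : ℕ) :
    Measurable fun t : Sample G × (𝒳 × 𝒳) => productCount h b l e t.1 t.2 :=
  (measurable_nearCount hh b measurable_const (by fun_prop) measurable_sample_fst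
    (by fun_prop)).add
    (measurable_hitCount hh (by fun_prop) measurable_sample_snd (by fun_prop))

lemma measurableSet_hit (p : G) : MeasurableSet {x | h p x = 1} :=
  measurable_hit hh measurable_const measurable_id (measurableSet_singleton 1)

lemma measurableSet_hit_fst (p : G) : MeasurableSet {y : 𝒳 × 𝒳 | h p y.1 = 1} :=
  measurable_fst (measurableSet_hit hh p)

lemma l1Dist_countLaw_le {F F' : Sample G → 𝒳 × 𝒳 → ℕ}
    (hF : Measurable fun t : Sample G × (𝒳 × 𝒳) => F t.1 t.2)
    (hF' : Measurable fun t : Sample G × (𝒳 × 𝒳) => F' t.1 t.2) (θ : Sample G) :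
    l1Dist (countLaw κ h F θ) (countLaw κ h F' θ)
      ≤ 2 * (κ.prod κ) ({y | h θ.1 y.1 = 1} ∩ {y | F θ y ≠ F' θ y}) :=
  l1Dist_le_of_coupling (κ.prod κ) (measurableSet_hit_fst hh θ.1)
    (hF.comp measurable_prodMk_left) (hF'.comp measurable_prodMk_left)

omit hh
include hb

lemma hit_eq_one {p : G} {x : 𝒳} (hne : h p x ≠ 0) : h p x = 1 := (hb p x).resolve_left hne

lemma prod_hit_inter_le (p : G) (T : Set (𝒳 × 𝒳)) (s : Finset ℕ) (P : ℕ → Prop)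
    [DecidablePred P] (q : ℕ → G)
    (hT : ∀ y ∈ T, ∃ i ∈ s, P i ∧ h (q i) y.2 ≠ 0) :
    (κ.prod κ) ({y | h p y.1 = 1} ∩ T)
      ≤ hitProb κ h p * ∑ i ∈ s, if P i then hitProb κ h (q i) else 0 := by
  classical
  rw [Finset.mul_sum, ← Finset.sum_filter_add_sum_filter_not s P]
  refine le_trans ?_ le_self_add
  have hsub : ({y | h p y.1 = 1} ∩ T)
      ⊆ ⋃ i ∈ s.filter P, {x | h p x = 1} ×ˢ {x | h (q i) x = 1} := by
    rintro y ⟨h1, h2⟩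
    obtain ⟨i, hi, hP, hne⟩ := hT y h2
    simp only [Set.mem_iUnion]
    exact ⟨i, Finset.mem_filter.2 ⟨hi, hP⟩, h1, hit_eq_one hb hne⟩
  refine (measure_mono hsub).trans ((measure_biUnion_finset_le _ _).trans ?_)
  refine Finset.sum_le_sum fun i hi => ?_
  rw [Measure.prod_prod, if_pos (Finset.mem_filter.1 hi).2]
  exact le_rfl

include hh

lemma l1Dist_full_split_le {b r : ℝ} (hbr : b ≤ r) (θ : Sample G) :
    l1Dist (countLaw κ h (fullCount h) θ) (countLaw κ h (splitCount h b r) θ)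
      ≤ 2 * ∑ i ∈ Finset.range θ.2.2,
        if b < dist θ.1 (θ.2.1 i).1 ∧ dist θ.1 (θ.2.1 i).1 ≤ r
          then pairProb κ h θ.1 (θ.2.1 i).1 else 0 := by
  refine (l1Dist_countLaw_le hh κ (measurable_fullCount hh) (measurable_splitCount hh b r) θ).trans ?_
  gcongr
  set s := (Finset.range θ.2.2).filter fun i =>
    b < dist θ.1 (θ.2.1 i).1 ∧ dist θ.1 (θ.2.1 i).1 ≤ r
  have hsub : ({y : 𝒳 × 𝒳 | h θ.1 y.1 = 1} ∩ {y | fullCount h θ y ≠ splitCount h b r θ y})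
      ⊆ ⋃ i ∈ s, {x | h θ.1 x = 1 ∧ h (θ.2.1 i).1 x = 1} ×ˢ Set.univ := by
    rintro y ⟨h1, h2⟩
    obtain ⟨i, hi, hP, hne⟩ := exists_of_add_hitCount_ne hbr h2
    simp only [Set.mem_iUnion]
    exact ⟨i, Finset.mem_filter.2 ⟨hi, hP⟩, ⟨h1, hit_eq_one hb hne⟩, trivial⟩
  refine (measure_mono hsub).trans ((measure_biUnion_finset_le _ _).trans ?_)
  rw [← Finset.sum_filter]
  refine Finset.sum_le_sum fun i _ => ?_
  rw [Measure.prod_prod, measure_univ, mul_one, pairProb]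

lemma l1Dist_decoupled_swapped_le (b r : ℝ) (θ : Sample G) :
    l1Dist (countLaw κ h (decoupledCount h b r) θ) (countLaw κ h (swappedCount h b r) θ)
      ≤ 2 * (hitProb κ h θ.1 * ∑ i ∈ Finset.range θ.2.2,
          if dist θ.1 (θ.2.1 i).1 ≤ r ∨ dist θ.1 (θ.2.1 i).2 ≤ r
            then hitProb κ h (θ.2.1 i).1 else 0)
        + 2 * (hitProb κ h θ.1 * ∑ i ∈ Finset.range θ.2.2,
          if dist θ.1 (θ.2.1 i).1 ≤ r ∨ dist θ.1 (θ.2.1 i).2 ≤ r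
            then hitProb κ h (θ.2.1 i).2 else 0) := by
  refine (l1Dist_countLaw_le hh κ (measurable_decoupledCount hh b r)
    (measurable_swappedCount hh b r) θ).trans ?_
  rw [← mul_add]
  gcongr
  set T1 : Set (𝒳 × 𝒳) := {y | ∃ i ∈ Finset.range θ.2.2,
    (dist θ.1 (θ.2.1 i).1 ≤ r ∨ dist θ.1 (θ.2.1 i).2 ≤ r) ∧ h (θ.2.1 i).1 y.2 ≠ 0} with hT1
  set T2 : Set (𝒳 × 𝒳) := {y | ∃ i ∈ Finset.range θ.2.2,
    (dist θ.1 (θ.2.1 i).1 ≤ r ∨ dist θ.1 (θ.2.1 i).2 ≤ r) ∧ h (θ.2.1 i).2 y.2 ≠ 0} with hT2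
  have hsub : ({y : 𝒳 × 𝒳 | h θ.1 y.1 = 1} ∩ {y | decoupledCount h b r θ y ≠ swappedCount h b r θ y})
      ⊆ ({y | h θ.1 y.1 = 1} ∩ T1) ∪ ({y | h θ.1 y.1 = 1} ∩ T2) := by
    rintro y ⟨h1, h2⟩
    have h3 : farCount h r θ.2.2 θ.1 (fun i => (θ.2.1 i).1) y.2
        ≠ hitCount h θ.2.2 (fun i => (farSwap r θ.1 (θ.2.1 i)).2) y.2 :=
      fun h => h2 (congrArg _ h)
    obtain ⟨i, hi, hP, hne | hne⟩ := exists_of_farCount_ne h3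
    · exact Or.inl ⟨h1, i, hi, hP, hne⟩
    · exact Or.inr ⟨h1, i, hi, hP, hne⟩
  refine (measure_mono hsub).trans ((measure_union_le _ _).trans (add_le_add ?_ ?_))
  · exact prod_hit_inter_le hb κ θ.1 T1 _ _ (fun i => (θ.2.1 i).1) fun y hy => hy
  · exact prod_hit_inter_le hb κ θ.1 T2 _ _ (fun i => (θ.2.1 i).2) fun y hy => hy

lemma l1Dist_resampled_product_le (b : ℝ) (l e : ℕ) (θ : Sample G) :
    l1Dist (countLaw κ h (resampledCount h b) θ) (countLaw κ h (productCount h b l e) θ)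
      ≤ 2 * (hitProb κ h θ.1 * ∑ i ∈ Finset.Ico (min θ.2.2 l) (max θ.2.2 l),
          if dist θ.1 (θ.2.1 i).1 ≤ b then 1 else 0)
        + 2 * (hitProb κ h θ.1 * ∑ i ∈ Finset.Ico θ.2.2 (θ.2.2 + e),
          hitProb κ h (θ.2.1 i).2) := by
  refine (l1Dist_countLaw_le hh κ (measurable_resampledCount hh b)
    (measurable_productCount hh b l e) θ).trans ?_
  rw [← mul_add]
  gcongr
  set T1 : Set (𝒳 × 𝒳) := {y | ∃ i ∈ Finset.Ico (min θ.2.2 l) (max θ.2.2 l),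
    dist θ.1 (θ.2.1 i).1 ≤ b} with hT1
  set T2 : Set (𝒳 × 𝒳) := {y | ∃ i ∈ Finset.Ico θ.2.2 (θ.2.2 + e),
    True ∧ h (θ.2.1 i).2 y.2 ≠ 0} with hT2
  have hsub : ({y : 𝒳 × 𝒳 | h θ.1 y.1 = 1}
      ∩ {y | resampledCount h b θ y ≠ productCount h b l e θ y})
      ⊆ ({y | h θ.1 y.1 = 1} ∩ T1) ∪ ({y | h θ.1 y.1 = 1} ∩ T2) := by
    rintro y ⟨h1, h2⟩
    by_cases h3 : nearCount h b θ.2.2 θ.1 (fun i => (θ.2.1 i).1) y.1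
        = nearCount h b l θ.1 (fun i => (θ.2.1 i).1) y.1
    · have h4 : hitCount h θ.2.2 (fun i => (θ.2.1 i).2) y.2
          ≠ hitCount h (θ.2.2 + e) (fun i => (θ.2.1 i).2) y.2 :=
        fun h => h2 (congrArg₂ _ h3 h)
      obtain ⟨i, hi, hne⟩ := exists_of_hitCount_ne h4
      exact Or.inr ⟨h1, i, hi, trivial, hne⟩
    · exact Or.inl ⟨h1, exists_of_nearCount_ne h3⟩
  refine (measure_mono hsub).trans ((measure_union_le _ _).trans (add_le_add ?_ ?_))
  · by_cases hex : ∃ i ∈ Finset.Ico (min θ.2.2 l) (max θ.2.2 l), dist θ.1 (θ.2.1 i).1 ≤ b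
    · obtain ⟨i, hi, hd⟩ := hex
      have h1 : (1 : ℝ≥0∞) ≤ ∑ i ∈ Finset.Ico (min θ.2.2 l) (max θ.2.2 l),
          if dist θ.1 (θ.2.1 i).1 ≤ b then 1 else 0 := by
        refine le_trans ?_ (Finset.single_le_sum (fun _ _ => zero_le) hi)
        rw [if_pos hd]
      calc (κ.prod κ) ({y | h θ.1 y.1 = 1} ∩ T1)
          ≤ (κ.prod κ) ({x | h θ.1 x = 1} ×ˢ Set.univ) := measure_mono fun y hy => ⟨hy.1, trivial⟩
        _ = hitProb κ h θ.1 * 1 := by rw [Measure.prod_prod, measure_univ, hitProb]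
        _ ≤ _ := by gcongr
    · have : T1 = ∅ := Set.eq_empty_iff_forall_notMem.2 fun y hy => hex hy
      simp [this]
  · have := prod_hit_inter_le hb κ θ.1 T2 (Finset.Ico θ.2.2 (θ.2.2 + e)) (fun _ => True)
      (fun i => (θ.2.1 i).2) fun y hy => hy
    simpa using this

end Couplings

lemma measurable_kernel_section {Ω Θ Y : Type*} [MeasurableSpace Ω] [MeasurableSpace Θ]
    [MeasurableSpace Y] (κ : Kernel Ω Y) [IsSFiniteKernel κ] {S : Set (Θ × Y)}
    (hS : MeasurableSet S) : Measurable fun q : Ω × Θ => κ q.1 {y | (q.2, y) ∈ S} := by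
  have hT : MeasurableSet {u : (Ω × Θ) × Y | (u.1.2, u.2) ∈ S} := by
    have : Measurable fun u : (Ω × Θ) × Y => (u.1.2, u.2) := by fun_prop
    exact this hS
  exact Kernel.measurable_kernel_prodMk_left (κ := κ.comap Prod.fst measurable_fst) hT

/-! ### Averages over the sample -/

section Averages

variable {G 𝒳 : Type*} [MetricSpace G] [MeasurableSpace G] [MeasurableSpace 𝒳]

/-- The law of a base point, a sequence of pairs of sample points and a sample size. -/
def sampleLaw (ν : Measure G) [IsProbabilityMeasure ν] (ρ : Measure ℕ) : Measure (Sample G) :=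
  ν.prod ((seqLaw (ν.prod ν)).prod ρ)

instance (ν : Measure G) [IsProbabilityMeasure ν] (ρ : Measure ℕ) [IsProbabilityMeasure ρ] :
    IsProbabilityMeasure (sampleLaw ν ρ) := by unfold sampleLaw; infer_instance

lemma lintegral_sampleLaw (ν : Measure G) [IsProbabilityMeasure ν] (ρ : Measure ℕ)
    [IsProbabilityMeasure ρ] {F : Sample G → ℝ≥0∞} (hF : Measurable F) :
    ∫⁻ θ, F θ ∂(sampleLaw ν ρ)
      = ∫⁻ p, ∫⁻ k, ∫⁻ z, F (p, z, k) ∂(seqLaw (ν.prod ν)) ∂ρ ∂ν := by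
  rw [sampleLaw, lintegral_prod _ hF.aemeasurable]
  refine lintegral_congr fun p => ?_
  have hFp : Measurable fun y : (ℕ → G × G) × ℕ => F (p, y) := hF.comp measurable_prodMk_left
  rw [lintegral_prod_symm _ hFp.aemeasurable]

variable {h : G → 𝒳 → ℕ} (hh : Measurable (Function.uncurry h)) (hb : ∀ p x, h p x = 0 ∨ h p x = 1)
  [SecondCountableTopology G] [OpensMeasurableSpace G]

include hh

lemma measurable_countLaw_kernel {Ω : Type*} [MeasurableSpace Ω] (κ : Kernel Ω 𝒳)
    [IsMarkovKernel κ] {F : Sample G → 𝒳 × 𝒳 → ℕ}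
    (hF : Measurable fun t : Sample G × (𝒳 × 𝒳) => F t.1 t.2) (w : ℕ) :
    Measurable fun q : Ω × Sample G => countLaw (κ q.1) h F q.2 w := by
  have hS : MeasurableSet {t : Sample G × (𝒳 × 𝒳) | h t.1.1 t.2.1 = 1 ∧ F t.1 t.2 = w} :=
    (measurable_hit hh (by fun_prop) (by fun_prop) (measurableSet_singleton 1)).inter
      (hF (measurableSet_singleton w))
  have := measurable_kernel_section (κ ×ₖ κ) hS
  simpa only [Kernel.prod_apply] using! this

lemma measurable_hitProb_kernel {Ω : Type*} [MeasurableSpace Ω] (κ : Kernel Ω 𝒳)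
    [IsMarkovKernel κ] : Measurable fun q : Ω × G => hitProb (κ q.1) h q.2 :=
  measurable_kernel_section κ (S := {t : G × 𝒳 | h t.1 t.2 = 1})
    (measurable_hit hh (by fun_prop) (by fun_prop) (measurableSet_singleton 1))

lemma measurable_pairProb_kernel {Ω : Type*} [MeasurableSpace Ω] (κ : Kernel Ω 𝒳)
    [IsMarkovKernel κ] : Measurable fun q : Ω × (G × G) => pairProb (κ q.1) h q.2.1 q.2.2 :=
  measurable_kernel_section κ (S := {t : (G × G) × 𝒳 | h t.1.1 t.2 = 1 ∧ h t.1.2 t.2 = 1})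
    ((measurable_hit hh (by fun_prop) (by fun_prop) (measurableSet_singleton 1)).inter
      (measurable_hit hh (by fun_prop) (by fun_prop) (measurableSet_singleton 1)))

variable (κ : Measure 𝒳) [IsProbabilityMeasure κ] (ν : Measure G) [IsProbabilityMeasure ν]
  (ρ : Measure ℕ) [IsProbabilityMeasure ρ]

lemma measurable_countLaw {F : Sample G → 𝒳 × 𝒳 → ℕ}
    (hF : Measurable fun t : Sample G × (𝒳 × 𝒳) => F t.1 t.2) (w : ℕ) :
    Measurable fun θ => countLaw κ h F θ w :=
  (measurable_countLaw_kernel hh (Kernel.const Unit κ) hF w).comp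
    (measurable_prodMk_left (x := ()))

lemma measurable_hitProb : Measurable fun p => hitProb κ h p :=
  (measurable_hitProb_kernel hh (Kernel.const Unit κ)).comp (measurable_prodMk_left (x := ()))

lemma lintegral_swapped_eq {b r : ℝ} (hbr : b ≤ r) (w : ℕ) :
    ∫⁻ θ, countLaw κ h (swappedCount h b r) θ w ∂(sampleLaw ν ρ)
      = ∫⁻ θ, countLaw κ h (resampledCount h b) θ w ∂(sampleLaw ν ρ) := by
  have hm := measurable_countLaw hh κ (measurable_resampledCount hh b) w
  rw [lintegral_sampleLaw ν ρ (measurable_countLaw hh κ (measurable_swappedCount hh b r) w),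
    lintegral_sampleLaw ν ρ hm]
  refine lintegral_congr fun p => lintegral_congr fun k => ?_
  have hsw : Measurable (farSwap r p) := measurable_farSwap r measurable_const measurable_id
  conv_rhs => rw [← seqLaw_map_comp (ν.prod ν) hsw (ν.prod ν) (prod_map_farSwap r p ν)]
  have hmz : Measurable fun z : ℕ → G × G => countLaw κ h (resampledCount h b) (p, z, k) w :=
    hm.comp (by fun_prop)
  rw [lintegral_map hmz (by fun_prop)]
  refine lintegral_congr fun z => ?_
  simp only [countLaw, swappedCount, resampledCount, nearCount_farSwap hbr]

omit hh in
lemma prod_fst_preimage (P : 𝒳 → Prop) :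
    (κ.prod κ) {y | P y.1} = κ {x | P x} := by
  have : {y : 𝒳 × 𝒳 | P y.1} = {x | P x} ×ˢ Set.univ := by ext; simp
  rw [this, Measure.prod_prod, measure_univ, mul_one]

/-- The law of the number of hits of a sample of random size. -/
def hitLaw (κ : Measure 𝒳) (h : G → 𝒳 → ℕ) (ν : Measure G) [IsProbabilityMeasure ν]
    (ρ : Measure ℕ) : Measure ℕ :=
  (κ.prod (ρ.prod (seqLaw ν))).map fun y => hitCount h y.2.1 y.2.2 y.1

lemma measurable_hitCount_triple :
    Measurable fun y : 𝒳 × ℕ × (ℕ → G) => hitCount h y.2.1 y.2.2 y.1 :=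
  measurable_hitCount hh (by fun_prop) (by fun_prop) (by fun_prop)

lemma isProbabilityMeasure_hitLaw : IsProbabilityMeasure (hitLaw κ h ν ρ) :=
  Measure.isProbabilityMeasure_map (measurable_hitCount_triple hh).aemeasurable

lemma measurable_measure_hitCount (j w : ℕ) :
    Measurable fun φ : ℕ → G => κ {x | hitCount h j φ x = w} :=
  measurable_measure_prodMk_left (ν := κ)
    (s := {t : (ℕ → G) × 𝒳 | hitCount h j t.1 t.2 = w})
    (measurable_hitCount hh measurable_const (by fun_prop) (by fun_prop)
      (measurableSet_singleton w))

lemma hitLaw_singleton (w : ℕ) :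
    hitLaw κ h ν ρ {w} = ∫⁻ j, ∫⁻ φ, κ {x | hitCount h j φ x = w} ∂(seqLaw ν) ∂ρ := by
  have hm := measurable_hitCount_triple (h := h) hh
  have hS := hm (measurableSet_singleton w)
  rw [hitLaw, Measure.map_apply hm (measurableSet_singleton w), Measure.prod_apply_symm hS,
    lintegral_prod _ (measurable_measure_prodMk_right hS).aemeasurable]
  rfl

include hb

/-- Exchangeability: size-biasing amounts to marking the first sample point. -/
lemma mul_lintegral_hitCount (j w : ℕ) :
    (w : ℝ≥0∞) * ∫⁻ φ, κ {x | hitCount h j φ x = w} ∂(seqLaw ν)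
      = j * ∫⁻ φ, κ {x | h (φ 0) x = 1 ∧ hitCount h j φ x = w} ∂(seqLaw ν) := by
  have hmi (i : ℕ) : Measurable fun φ : ℕ → G => κ {x | h (φ i) x = 1 ∧ hitCount h j φ x = w} :=
    measurable_measure_prodMk_left (ν := κ)
      (s := {t : (ℕ → G) × 𝒳 | h (t.1 i) t.2 = 1 ∧ hitCount h j t.1 t.2 = w})
      ((measurable_hit hh (by fun_prop) (by fun_prop) (measurableSet_singleton 1)).inter
        (measurable_hitCount hh measurable_const (by fun_prop) (by fun_prop)
          (measurableSet_singleton w)))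
  have h1 (φ : ℕ → G) : (w : ℝ≥0∞) * κ {x | hitCount h j φ x = w}
      = ∑ i ∈ Finset.range j, κ {x | h (φ i) x = 1 ∧ hitCount h j φ x = w} := by
    have hT : MeasurableSet {x | hitCount h j φ x = w} :=
      measurable_hitCount hh measurable_const measurable_const measurable_id
        (measurableSet_singleton w)
    have hS (i : ℕ) : MeasurableSet {x | h (φ i) x = 1} := measurableSet_hit hh (φ i)
    calc (w : ℝ≥0∞) * κ {x | hitCount h j φ x = w}
        = ∫⁻ x in {x | hitCount h j φ x = w}, (w : ℝ≥0∞) ∂κ := (setLIntegral_const _ _).symm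
      _ = ∫⁻ x in {x | hitCount h j φ x = w},
            ∑ i ∈ Finset.range j, {x | h (φ i) x = 1}.indicator 1 x ∂κ := by
          refine setLIntegral_congr_fun hT fun x hx => ?_
          have hx' : hitCount h j φ x = w := hx
          rw [← hx', hitCount]
          push_cast
          refine Finset.sum_congr rfl fun i _ => ?_
          rcases hb (φ i) x with h0 | h0 <;> simp [h0]
      _ = _ := by
          rw [lintegral_finsetSum _ fun i _ => measurable_one.indicator (hS i)]
          refine Finset.sum_congr rfl fun i _ => ?_
          rw [lintegral_indicator_one (hS i), Measure.restrict_apply (hS i)]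
          rfl
  rw [← lintegral_const_mul _ (measurable_measure_hitCount hh κ j w), lintegral_congr h1,
    lintegral_finsetSum _ fun i _ => hmi i]
  have h2 : ∀ i ∈ Finset.range j, ∫⁻ φ, κ {x | h (φ i) x = 1 ∧ hitCount h j φ x = w} ∂(seqLaw ν)
      = ∫⁻ φ, κ {x | h (φ 0) x = 1 ∧ hitCount h j φ x = w} ∂(seqLaw ν) := by
    intro i hi
    have hinj : Function.Injective (Equiv.swap 0 i) := (Equiv.swap 0 i).injective
    conv_rhs => rw [← seqLaw_map_injective ν hinj]
    rw [lintegral_map (hmi 0) (by fun_prop)]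
    refine lintegral_congr fun φ => ?_
    have h3 (x : 𝒳) : hitCount h j (fun n => φ (Equiv.swap 0 i n)) x = hitCount h j φ x := by
      unfold hitCount
      refine Finset.sum_equiv (Equiv.swap 0 i) (fun n => ?_) fun n _ => rfl
      have hij := Finset.mem_range.1 hi
      simp only [Finset.mem_range, Equiv.swap_apply_def]
      split_ifs <;> omega
    simp only [h3, Equiv.swap_apply_left]
  rw [Finset.sum_congr rfl h2]
  simp

lemma lintegral_full_eq (w k : ℕ) :
    ∫⁻ φ, κ {x | h (φ 0) x = 1 ∧ hitCount h (k + 1) φ x = w} ∂(seqLaw ν)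
      = ∫⁻ p, ∫⁻ z, countLaw κ h (fullCount h) (p, z, k) w ∂(seqLaw (ν.prod ν)) ∂ν := by
  have hm : Measurable fun φ : ℕ → G => κ {x | h (φ 0) x = 1 ∧ hitCount h (k + 1) φ x = w} :=
    measurable_measure_prodMk_left (ν := κ)
      (s := {t : (ℕ → G) × 𝒳 | h (t.1 0) t.2 = 1 ∧ hitCount h (k + 1) t.1 t.2 = w})
      ((measurable_hit hh (by fun_prop) (by fun_prop) (measurableSet_singleton 1)).inter
        (measurable_hitCount hh measurable_const (by fun_prop) (by fun_prop)
          (measurableSet_singleton w)))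
  conv_lhs => rw [← prod_map_consSeq ν]
  have hmc : Measurable fun a : G × (ℕ → G) => κ {x | h (consSeq a.1 a.2 0) x = 1 ∧
      hitCount h (k + 1) (consSeq a.1 a.2) x = w} := hm.comp measurable_consSeq
  rw [lintegral_map hm measurable_consSeq, lintegral_prod _ hmc.aemeasurable]
  refine lintegral_congr fun p => ?_
  have hmp : Measurable fun φ : ℕ → G => κ {x | h (consSeq p φ 0) x = 1 ∧
      hitCount h (k + 1) (consSeq p φ) x = w} := hmc.comp measurable_prodMk_left
  rw [← seqLaw_map_comp (ν.prod ν) measurable_fst ν Measure.fst_prod,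
    lintegral_map hmp (by fun_prop)]
  refine lintegral_congr fun z => ?_
  have h2 : ({y : 𝒳 × 𝒳 | h p y.1 = 1} ∩ {y | fullCount h (p, z, k) y = w})
      = {y | h p y.1 = 1 ∧ h p y.1 + hitCount h k (fun i => (z i).1) y.1 = w} := rfl
  rw [countLaw, h2,
    prod_fst_preimage κ (fun x => h p x = 1 ∧ h p x + hitCount h k (fun i => (z i).1) x = w)]
  simp only [consSeq_zero, hitCount, Finset.sum_range_succ', consSeq_succ,
    add_comm (h p _)]

/-- The size-biased law of the number of hits. -/
lemma mul_hitLaw_singleton {ρJ : Measure ℕ} [IsProbabilityMeasure ρJ] {c : ℝ≥0∞}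
    (hρ : ∀ k : ℕ, ((k + 1 : ℕ) : ℝ≥0∞) * ρJ {k + 1} = c * ρ {k}) (w : ℕ) :
    (w : ℝ≥0∞) * hitLaw κ h ν ρJ {w}
      = c * ∫⁻ θ, countLaw κ h (fullCount h) θ w ∂(sampleLaw ν ρ) := by
  set D : ℕ → ℝ≥0∞ := fun j => ∫⁻ φ, κ {x | h (φ 0) x = 1 ∧ hitCount h j φ x = w} ∂(seqLaw ν)
  have hm := measurable_countLaw hh κ (measurable_fullCount hh) w
  have h1 : ∫⁻ θ, countLaw κ h (fullCount h) θ w ∂(sampleLaw ν ρ) = ∑' k, D (k + 1) * ρ {k} := by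
    rw [lintegral_sampleLaw ν ρ hm, lintegral_lintegral_swap, lintegral_countable']
    · refine tsum_congr fun k => ?_
      rw [← lintegral_full_eq hh hb κ ν w k]
    · have : Measurable fun q : (G × ℕ) × (ℕ → G × G) =>
          countLaw κ h (fullCount h) (q.1.1, q.2, q.1.2) w := hm.comp (by fun_prop)
      exact this.lintegral_prod_right.aemeasurable
  rw [hitLaw_singleton hh κ ν ρJ, ← lintegral_const_mul _ (measurable_of_countable _), h1]
  simp only [mul_lintegral_hitCount hh hb κ ν]
  rw [lintegral_countable', tsum_eq_zero_add' ENNReal.summable, ← ENNReal.tsum_mul_left]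
  simp only [Nat.cast_zero, zero_mul, zero_add]
  refine tsum_congr fun k => ?_
  calc ((k + 1 : ℕ) : ℝ≥0∞) * D (k + 1) * ρJ {k + 1}
      = D (k + 1) * (((k + 1 : ℕ) : ℝ≥0∞) * ρJ {k + 1}) := by ring
    _ = c * (D (k + 1) * ρ {k}) := by rw [hρ]; ring

omit hb

/-- The joint probability, averaged over the sample, of a hit at the base point and of a given
number of near hits. -/
def clusterProb (κ : Measure 𝒳) (h : G → 𝒳 → ℕ) (ν : Measure G) [IsProbabilityMeasure ν]
    (b : ℝ) (l k : ℕ) : ℝ≥0∞ :=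
  ∫⁻ p, ∫⁻ φ, κ {x | h p x = 1 ∧ nearCount h b l p φ x = k} ∂(seqLaw ν) ∂ν

lemma hitLaw_add_singleton (e w : ℕ) :
    hitLaw κ h ν (ρ.map (· + e)) {w}
      = ∫⁻ k, ∫⁻ φ, κ {x | hitCount h (k + e) φ x = w} ∂(seqLaw ν) ∂ρ := by
  have : IsProbabilityMeasure (ρ.map (· + e)) :=
    Measure.isProbabilityMeasure_map (measurable_of_countable _).aemeasurable
  rw [hitLaw_singleton hh, lintegral_map (measurable_of_countable _) (measurable_of_countable _)]

lemma lintegral_product_eq (b : ℝ) (l e w : ℕ) :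
    ∫⁻ θ, countLaw κ h (productCount h b l e) θ w ∂(sampleLaw ν ρ)
      = ∑ x ∈ Finset.HasAntidiagonal.antidiagonal w,
        clusterProb κ h ν b l x.1 * hitLaw κ h ν (ρ.map (· + e)) {x.2} := by
  set u : ℕ → G → (ℕ → G) → ℝ≥0∞ := fun s p φ => κ {x | h p x = 1 ∧ nearCount h b l p φ x = s}
    with hu
  set v : ℕ → ℕ → (ℕ → G) → ℝ≥0∞ := fun t k φ => κ {x | hitCount h (k + e) φ x = t} with hv
  have hum (s) : Measurable fun q : G × (ℕ → G) => u s q.1 q.2 :=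
    measurable_measure_prodMk_left (ν := κ)
      (s := {t : (G × (ℕ → G)) × 𝒳 | h t.1.1 t.2 = 1 ∧ nearCount h b l t.1.1 t.1.2 t.2 = s})
      ((measurable_hit hh (by fun_prop) (by fun_prop) (measurableSet_singleton 1)).inter
        (measurable_nearCount hh b measurable_const (by fun_prop) (by fun_prop) (by fun_prop)
          (measurableSet_singleton s)))
  have hvm (t k) : Measurable (v t k) := measurable_measure_hitCount hh κ (k + e) t
  have hpt (p : G) (z : ℕ → G × G) (k : ℕ) : countLaw κ h (productCount h b l e) (p, z, k) w
      = ∑ x ∈ Finset.HasAntidiagonal.antidiagonal w,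
        u x.1 p (fun i => (z i).1) * v x.2 k (fun i => (z i).2) := by
    have hset : ({y : 𝒳 × 𝒳 | h p y.1 = 1} ∩ {y | productCount h b l e (p, z, k) y = w})
        = ⋃ x ∈ Finset.HasAntidiagonal.antidiagonal w,
          {a | h p a = 1 ∧ nearCount h b l p (fun i => (z i).1) a = x.1} ×ˢ
            {a | hitCount h (k + e) (fun i => (z i).2) a = x.2} := by
      ext y
      simp only [Set.mem_inter_iff, Set.mem_ofPred_eq, Set.mem_iUnion, Set.mem_prod,
        Finset.HasAntidiagonal.mem_antidiagonal, productCount, exists_prop, Prod.exists]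
      constructor
      · rintro ⟨h1, h2⟩
        exact ⟨_, _, h2, ⟨h1, rfl⟩, rfl⟩
      · rintro ⟨s, t, hst, ⟨h1, h2⟩, h3⟩
        exact ⟨h1, by rw [h2, h3, hst]⟩
    rw [countLaw, hset, measure_biUnion_finset]
    · simp only [Measure.prod_prod]; rfl
    · intro x _ x' _ hne
      rw [Function.onFun, Set.disjoint_left]
      rintro y ⟨⟨_, h1⟩, h2⟩ ⟨⟨_, h3⟩, h4⟩
      exact hne (Prod.ext (h1.symm.trans h3) (h2.symm.trans h4))
    · intro x _
      refine MeasurableSet.prod ((measurableSet_hit hh p).inter ?_) ?_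
      · exact measurable_nearCount hh b measurable_const measurable_const measurable_const
          measurable_id (measurableSet_singleton x.1)
      · exact measurable_hitCount hh measurable_const measurable_const measurable_id
          (measurableSet_singleton x.2)
  rw [lintegral_sampleLaw ν ρ (measurable_countLaw hh κ (measurable_productCount hh b l e) w)]
  simp only [hpt]
  have hz (s t p k) : ∫⁻ z, u s p (fun i => (z i).1) * v t k (fun i => (z i).2)
      ∂(seqLaw (ν.prod ν)) = (∫⁻ φ, u s p φ ∂(seqLaw ν)) * ∫⁻ φ, v t k φ ∂(seqLaw ν) := by
    have hup : Measurable (u s p) := (hum s).comp measurable_prodMk_left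
    have huv : Measurable fun q : (ℕ → G) × (ℕ → G) => u s p q.1 * v t k q.2 :=
      (hup.comp measurable_fst).mul ((hvm t k).comp measurable_snd)
    rw [← lintegral_prod_mul hup.aemeasurable (hvm t k).aemeasurable, ← seqLaw_prod_map_unzip ν,
      lintegral_map huv (by fun_prop)]
  have hzm (s t p k) : Measurable fun z : ℕ → G × G =>
      u s p (fun i => (z i).1) * v t k (fun i => (z i).2) := by
    have hup : Measurable (u s p) := (hum s).comp measurable_prodMk_left
    exact (hup.comp (by fun_prop)).mul ((hvm t k).comp (by fun_prop))
  have hUm (s) : Measurable fun p => ∫⁻ φ, u s p φ ∂(seqLaw ν) := (hum s).lintegral_prod_right'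
  calc ∫⁻ p, ∫⁻ k, ∫⁻ z, ∑ x ∈ Finset.HasAntidiagonal.antidiagonal w,
        u x.1 p (fun i => (z i).1) * v x.2 k (fun i => (z i).2) ∂(seqLaw (ν.prod ν)) ∂ρ ∂ν
      = ∫⁻ p, ∑ x ∈ Finset.HasAntidiagonal.antidiagonal w, (∫⁻ φ, u x.1 p φ ∂(seqLaw ν)) *
          ∫⁻ k, ∫⁻ φ, v x.2 k φ ∂(seqLaw ν) ∂ρ ∂ν := by
        refine lintegral_congr fun p => ?_
        rw [← Finset.sum_congr rfl fun x _ =>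
          lintegral_const_mul (∫⁻ φ, u x.1 p φ ∂(seqLaw ν)) (μ := ρ)
            (measurable_of_countable fun k => ∫⁻ φ, v x.2 k φ ∂(seqLaw ν)),
          ← lintegral_finsetSum _ fun _ _ => measurable_of_countable _]
        refine lintegral_congr fun k => ?_
        rw [lintegral_finsetSum _ fun x _ => hzm x.1 x.2 p k]
        exact Finset.sum_congr rfl fun x _ => hz _ _ _ _
    _ = _ := by
        rw [lintegral_finsetSum _ fun x _ => (hUm x.1).mul_const _]
        refine Finset.sum_congr rfl fun x _ => ?_
        rw [lintegral_mul_const _ (hUm x.1), hitLaw_add_singleton hh]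
        rfl

end Averages

lemma measurable_sum_finset {β : Type*} [MeasurableSpace β] (I : ℕ → Finset ℕ)
    {g : ℕ → β → ℝ≥0∞} (hg : ∀ i, Measurable (g i)) {k : β → ℕ} (hk : Measurable k) :
    Measurable fun x => ∑ i ∈ I (k x), g i x := by
  have : Measurable fun q : ℕ × β => ∑ i ∈ I q.1, g i q.2 :=
    measurable_from_prod_countable_right fun l =>
      Finset.measurable_fun_sum (I l) fun i _ => hg i
  exact this.comp (hk.prodMk measurable_id)

section FixedLaw

variable {G 𝒳 : Type*} [MetricSpace G] [MeasurableSpace G] [MeasurableSpace 𝒳]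
  {h : G → 𝒳 → ℕ} (hh : Measurable (Function.uncurry h)) (hb : ∀ p x, h p x = 0 ∨ h p x = 1)
  [SecondCountableTopology G] [OpensMeasurableSpace G]

/-- The probability of two hits, one at the base point and one in an annulus around it. -/
def annulusCost (κ : Measure 𝒳) (h : G → 𝒳 → ℕ) (b r : ℝ) (θ : Sample G) : ℝ≥0∞ :=
  ∑ i ∈ Finset.range θ.2.2, if b < dist θ.1 (θ.2.1 i).1 ∧ dist θ.1 (θ.2.1 i).1 ≤ r
    then pairProb κ h θ.1 (θ.2.1 i).1 else 0

/-- The cost of replacing the configuration far from the base point by an independent copy. -/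
def mixCost (κ : Measure 𝒳) (h : G → 𝒳 → ℕ) (b r : ℝ) (θ : Sample G) : ℝ≥0∞ :=
  l1Dist (countLaw κ h (splitCount h b r) θ) (countLaw κ h (decoupledCount h b r) θ)

/-- The probability of a hit at the base point for one configuration, and of a hit at a given
coordinate of a pair with an entry near the base point, for another configuration. -/
def nearCost (κ : Measure 𝒳) (h : G → 𝒳 → ℕ) (π : G × G → G) (r : ℝ) (θ : Sample G) : ℝ≥0∞ :=
  hitProb κ h θ.1 * ∑ i ∈ Finset.range θ.2.2,
    if dist θ.1 (θ.2.1 i).1 ≤ r ∨ dist θ.1 (θ.2.1 i).2 ≤ r then hitProb κ h (π (θ.2.1 i)) else 0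

/-- The cost of changing the size of the first sample to `l`. -/
def sizeCost (κ : Measure 𝒳) (h : G → 𝒳 → ℕ) (b : ℝ) (l : ℕ) (θ : Sample G) : ℝ≥0∞ :=
  hitProb κ h θ.1 * ∑ i ∈ Finset.Ico (min θ.2.2 l) (max θ.2.2 l),
    if dist θ.1 (θ.2.1 i).1 ≤ b then 1 else 0

/-- The cost of adding `e` points to the second sample. -/
def extraCost (κ : Measure 𝒳) (h : G → 𝒳 → ℕ) (e : ℕ) (θ : Sample G) : ℝ≥0∞ :=
  hitProb κ h θ.1 * ∑ i ∈ Finset.Ico θ.2.2 (θ.2.2 + e), hitProb κ h (θ.2.1 i).2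

section CostMeasurability

variable {Ω : Type*} [MeasurableSpace Ω] (κ : Kernel Ω 𝒳) [IsMarkovKernel κ]

lemma measurableSet_dist_le {β : Type*} [MeasurableSpace β] {p q : β → G} (hp : Measurable p)
    (hq : Measurable q) (r : ℝ) : MeasurableSet {x | dist (p x) (q x) ≤ r} :=
  measurableSet_le (hp.dist hq) measurable_const

lemma measurableSet_lt_dist {β : Type*} [MeasurableSpace β] {p q : β → G} (hp : Measurable p)
    (hq : Measurable q) (r : ℝ) : MeasurableSet {x | r < dist (p x) (q x)} :=
  measurableSet_lt measurable_const (hp.dist hq)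

include hh

lemma measurable_hitProb_comp {β : Type*} [MeasurableSpace β] {u : β → Ω} {p : β → G}
    (hu : Measurable u) (hp : Measurable p) : Measurable fun x => hitProb (κ (u x)) h (p x) :=
  (measurable_hitProb_kernel hh κ).comp (hu.prodMk hp)

lemma measurable_pairProb_comp {β : Type*} [MeasurableSpace β] {u : β → Ω} {p q : β → G}
    (hu : Measurable u) (hp : Measurable p) (hq : Measurable q) :
    Measurable fun x => pairProb (κ (u x)) h (p x) (q x) :=
  (measurable_pairProb_kernel hh κ).comp (hu.prodMk (hp.prodMk hq))

lemma measurable_annulusCost (b r : ℝ) :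
    Measurable fun q : Ω × Sample G => annulusCost (κ q.1) h b r q.2 := by
  refine measurable_sum_finset Finset.range (fun i => ?_) (by fun_prop)
  refine Measurable.ite ?_ (measurable_pairProb_comp hh κ (by fun_prop) (by fun_prop)
    (by fun_prop)) measurable_const
  exact (measurableSet_lt_dist (by fun_prop) (by fun_prop) b).inter
    (measurableSet_dist_le (by fun_prop) (by fun_prop) r)

lemma measurable_mixCost (b r : ℝ) :
    Measurable fun q : Ω × Sample G => mixCost (κ q.1) h b r q.2 := by
  have m1 (w) := measurable_countLaw_kernel hh κ (measurable_splitCount hh b r) w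
  have m2 (w) := measurable_countLaw_kernel hh κ (measurable_decoupledCount hh b r) w
  exact Measurable.tsum fun w => ((m1 w).sub (m2 w)).add ((m2 w).sub (m1 w))

lemma measurable_nearCost {π : G × G → G} (hπ : Measurable π) (r : ℝ) :
    Measurable fun q : Ω × Sample G => nearCost (κ q.1) h π r q.2 := by
  refine (measurable_hitProb_comp hh κ (by fun_prop) (by fun_prop)).mul
    (measurable_sum_finset Finset.range (fun i => ?_) (by fun_prop))
  refine Measurable.ite ?_ (measurable_hitProb_comp hh κ (by fun_prop) (by fun_prop))
    measurable_const
  exact (measurableSet_dist_le (by fun_prop) (by fun_prop) r).union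
    (measurableSet_dist_le (by fun_prop) (by fun_prop) r)

lemma measurable_sizeCost (b : ℝ) (l : ℕ) :
    Measurable fun q : Ω × Sample G => sizeCost (κ q.1) h b l q.2 := by
  refine (measurable_hitProb_comp hh κ (by fun_prop) (by fun_prop)).mul
    (measurable_sum_finset (fun k => Finset.Ico (min k l) (max k l)) (fun i => ?_) (by fun_prop))
  exact Measurable.ite (measurableSet_dist_le (by fun_prop) (by fun_prop) b)
    measurable_const measurable_const

lemma measurable_extraCost (e : ℕ) :
    Measurable fun q : Ω × Sample G => extraCost (κ q.1) h e q.2 :=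
  (measurable_hitProb_comp hh κ (by fun_prop) (by fun_prop)).mul
    (measurable_sum_finset (fun k => Finset.Ico k (k + e))
      (fun i => measurable_hitProb_comp hh κ (by fun_prop) (by fun_prop)) (by fun_prop))

end CostMeasurability

variable (κ : Measure 𝒳) [IsProbabilityMeasure κ] (ν : Measure G) [IsProbabilityMeasure ν]
  (ρ : Measure ℕ) [IsProbabilityMeasure ρ]

include hh hb

lemma tsum_countLaw {F : Sample G → 𝒳 × 𝒳 → ℕ}
    (hF : Measurable fun t : Sample G × (𝒳 × 𝒳) => F t.1 t.2) (θ : Sample G) :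
    ∑' w, countLaw κ h F θ w = hitProb κ h θ.1 := by
  have h1 := tsum_measure_inter_fiber (κ.prod κ) (measurableSet_hit_fst hh θ.1)
    (hF.comp (measurable_prodMk_left (x := θ)))
  exact h1.trans (prod_fst_preimage κ fun x => h θ.1 x = 1)

/-- Compound Poisson approximation of the number of hits, for a fixed law of the configuration. -/
theorem tvDist_hitLaw_le {b r : ℝ} (hbr : b ≤ r) (l e m : ℕ) {c : ℝ≥0∞} (hc : c ≠ ∞)
    (hρ : ∀ k : ℕ, ((k + 1 : ℕ) : ℝ≥0∞) * ρ.map (· + e) {k + 1} = c * ρ {k})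
    {R : ℕ → ℝ≥0} (hR : Summable R) (hR0 : R 0 = 0)
    (hRk : ∀ k : ℕ, (k : ℝ≥0∞) * R k = m * clusterProb κ h ν b l k) :
    ENNReal.ofReal (tvDist (hitLaw κ h ν (ρ.map (· + e))) (compoundPoisson R)) ≤
      2 * ENNReal.ofReal (Real.exp (∑' k, (R k : ℝ))) *
        (c * ((2 * ∫⁻ θ, annulusCost κ h b r θ ∂(sampleLaw ν ρ)
          + ∫⁻ θ, mixCost κ h b r θ ∂(sampleLaw ν ρ))
          + (2 * ∫⁻ θ, nearCost κ h Prod.fst r θ ∂(sampleLaw ν ρ)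
          + 2 * ∫⁻ θ, nearCost κ h Prod.snd r θ ∂(sampleLaw ν ρ))
          + (2 * ∫⁻ θ, sizeCost κ h b l θ ∂(sampleLaw ν ρ)
          + 2 * ∫⁻ θ, extraCost κ h e θ ∂(sampleLaw ν ρ)))
        + ((c - m) + (m - c)) * ∫⁻ θ, hitProb κ h θ.1 ∂(sampleLaw ν ρ)) := by
  have : IsProbabilityMeasure (ρ.map (· + e)) :=
    Measure.isProbabilityMeasure_map (measurable_of_countable _).aemeasurable
  have := isProbabilityMeasure_hitLaw hh κ ν (ρ.map (· + e))
  set τ := sampleLaw ν ρ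
  have mF := fun w => measurable_countLaw hh κ (measurable_fullCount hh) w
  have mS := fun w => measurable_countLaw hh κ (measurable_splitCount hh b r) w
  have mD := fun w => measurable_countLaw hh κ (measurable_decoupledCount hh b r) w
  have mW := fun w => measurable_countLaw hh κ (measurable_swappedCount hh b r) w
  have mR := fun w => measurable_countLaw hh κ (measurable_resampledCount hh b) w
  have mP := fun w => measurable_countLaw hh κ (measurable_productCount hh b l e) w
  set Pr : ℕ → ℝ≥0∞ := fun w => ∫⁻ θ, countLaw κ h (productCount h b l e) θ w ∂τ with hPr
  set Fu : ℕ → ℝ≥0∞ := fun w => ∫⁻ θ, countLaw κ h (fullCount h) θ w ∂τ with hFu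
  have hsum : ∑' w, Pr w = ∫⁻ θ, hitProb κ h θ.1 ∂τ := by
    rw [← lintegral_tsum fun w => (mP w).aemeasurable]
    exact lintegral_congr fun θ => tsum_countLaw hh hb κ (measurable_productCount hh b l e) θ
  have hfin : ∑' w, Pr w ≠ ∞ := by
    rw [hsum]
    refine ne_top_of_le_ne_top ENNReal.one_ne_top ?_
    calc ∫⁻ θ, hitProb κ h θ.1 ∂τ ≤ ∫⁻ _, 1 ∂τ := lintegral_mono fun θ => prob_le_one
      _ = 1 := by simp
  refine (ofReal_tvDist_compoundPoisson_le _ hR hR0).trans ?_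
  gcongr
  have e1 : (fun w : ℕ => (w : ℝ≥0∞) * hitLaw κ h ν (ρ.map (· + e)) {w}) = fun w => c * Fu w :=
    funext fun w => mul_hitLaw_singleton hh hb κ ν ρ hρ w
  have e2 : (fun w : ℕ => ∑ x ∈ Finset.HasAntidiagonal.antidiagonal w,
      (x.1 * R x.1 : ℝ≥0∞) * hitLaw κ h ν (ρ.map (· + e)) {x.2}) = fun w => m * Pr w := by
    funext w
    rw [hPr]
    simp only
    rw [lintegral_product_eq hh κ ν ρ b l e w, Finset.mul_sum]
    exact Finset.sum_congr rfl fun x _ => by rw [hRk, mul_assoc]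
  rw [e1, e2]
  refine (l1Dist_triangle _ (fun w => c * Pr w) _).trans (add_le_add ?_ ?_)
  · refine (l1Dist_const_mul_le c hc _ _).trans ?_
    gcongr
    refine (l1Dist_triangle _
      (fun w => ∫⁻ θ, countLaw κ h (splitCount h b r) θ w ∂τ) _).trans ?_
    rw [add_assoc, add_assoc]
    refine add_le_add ?_ ?_
    · refine (l1Dist_lintegral_le τ _ _ mF mS).trans ?_
      rw [← lintegral_const_mul' _ _ (by norm_num)]
      exact lintegral_mono fun θ => l1Dist_full_split_le hh hb κ hbr θ
    refine (l1Dist_triangle _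
      (fun w => ∫⁻ θ, countLaw κ h (decoupledCount h b r) θ w ∂τ) _).trans (add_le_add ?_ ?_)
    · exact l1Dist_lintegral_le τ _ _ mS mD
    refine (l1Dist_triangle _
      (fun w => ∫⁻ θ, countLaw κ h (swappedCount h b r) θ w ∂τ) _).trans (add_le_add ?_ ?_)
    · refine (l1Dist_lintegral_le τ _ _ mD mW).trans ?_
      have hm : Measurable fun θ : Sample G => nearCost κ h Prod.fst r θ :=
        (measurable_nearCost hh (Kernel.const Unit κ) measurable_fst r).comp
          (measurable_prodMk_left (x := ()))
      rw [← lintegral_const_mul' _ _ (by norm_num), ← lintegral_const_mul' _ _ (by norm_num),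
        ← lintegral_add_left (hm.const_mul 2)]
      exact lintegral_mono fun θ => l1Dist_decoupled_swapped_le hh hb κ b r θ
    · have e3 : (fun w => ∫⁻ θ, countLaw κ h (swappedCount h b r) θ w ∂τ)
          = fun w => ∫⁻ θ, countLaw κ h (resampledCount h b) θ w ∂τ :=
        funext fun w => lintegral_swapped_eq hh κ ν ρ hbr w
      rw [e3]
      refine (l1Dist_lintegral_le τ _ _ mR mP).trans ?_
      have hm : Measurable fun θ : Sample G => sizeCost κ h b l θ :=
        (measurable_sizeCost hh (Kernel.const Unit κ) b l).comp
          (measurable_prodMk_left (x := ()))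
      rw [← lintegral_const_mul' _ _ (by norm_num), ← lintegral_const_mul' _ _ (by norm_num),
        ← lintegral_add_left (hm.const_mul 2)]
      exact lintegral_mono fun θ => l1Dist_resampled_product_le hh hb κ b l e θ
  · refine (l1Dist_mul_const_le c m Pr fun w => ENNReal.ne_top_of_tsum_ne_top hfin w).trans ?_
    rw [hsum]

end FixedLaw

section AveragedCosts

variable {G Ω : Type*} [MeasurableSpace G] [MeasurableSpace Ω]

lemma ae_sampleLaw_mem [MetricSpace G] (ν : Measure G) [IsProbabilityMeasure ν] (ρ : Measure ℕ)
    [IsProbabilityMeasure ρ] {A : Set G} (hA : ν Aᶜ = 0) :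
    ∀ᵐ θ ∂(sampleLaw ν ρ), θ.1 ∈ A ∧ ∀ i, (θ.2.1 i).1 ∈ A ∧ (θ.2.1 i).2 ∈ A := by
  have hAae : ∀ᵐ p ∂ν, p ∈ A := hA
  have h1 : (sampleLaw ν ρ).map (fun θ => θ.1) = ν := by
    rw [sampleLaw]; exact Measure.fst_prod
  have h2 (i : ℕ) : (sampleLaw ν ρ).map (fun θ => θ.2.1 i) = ν.prod ν := by
    have e1 : (fun θ : Sample G => θ.2.1 i)
        = (fun z : ℕ → G × G => z i) ∘ Prod.fst ∘ Prod.snd := rfl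
    rw [e1, ← Measure.map_map (by fun_prop) (by fun_prop), ← Measure.map_map (by fun_prop)
      (by fun_prop), sampleLaw]
    have e2 : Measure.map Prod.snd (ν.prod ((seqLaw (ν.prod ν)).prod ρ))
      = (seqLaw (ν.prod ν)).prod ρ := Measure.snd_prod
    have e3 : Measure.map Prod.fst ((seqLaw (ν.prod ν)).prod ρ) = seqLaw (ν.prod ν) :=
      Measure.fst_prod
    rw [e2, e3, Measure.infinitePi_map_eval]
  have h3 : ∀ᵐ y ∂(ν.prod ν), y.1 ∈ A ∧ y.2 ∈ A := by
    have f1 : ∀ᵐ y ∂(ν.prod ν), y.1 ∈ A := Measure.quasiMeasurePreserving_fst.ae hAae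
    have f2 : ∀ᵐ y ∂(ν.prod ν), y.2 ∈ A := Measure.quasiMeasurePreserving_snd.ae hAae
    filter_upwards [f1, f2] with y k1 k2 using ⟨k1, k2⟩
  have h4 : ∀ᵐ θ ∂(sampleLaw ν ρ), θ.1 ∈ A :=
    ae_of_ae_map measurable_fst.aemeasurable (h1.symm ▸ hAae)
  have h5 : ∀ᵐ θ ∂(sampleLaw ν ρ), ∀ i, (θ.2.1 i).1 ∈ A ∧ (θ.2.1 i).2 ∈ A := by
    rw [ae_all_iff]
    intro i
    have hm : Measurable fun θ : Sample G => θ.2.1 i := by fun_prop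
    exact ae_of_ae_map hm.aemeasurable ((h2 i).symm ▸ h3)
  filter_upwards [h4, h5] with θ k1 k2 using ⟨k1, k2⟩

/-- The average of a sum, over those sample points that are in a prescribed position relative to
the base point, of quantities with bounded mean. -/
theorem lintegral_lintegral_sum_indicator_le [MetricSpace G] (P : Measure Ω) [SFinite P]
    (ν : Measure G) [IsProbabilityMeasure ν] (ρ : Measure ℕ) [IsProbabilityMeasure ρ] {A : Set G}
    (hA : ν Aᶜ = 0) (I : ℕ → Finset ℕ) {C : Set (G × (G × G))} (hC : MeasurableSet C)
    {f : ℕ → Ω → Sample G → ℝ≥0∞} (hf : ∀ i, Measurable (Function.uncurry (f i))) {B s : ℝ≥0∞}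
    (hB : ∀ i (θ : Sample G), θ.1 ∈ A → (∀ j, (θ.2.1 j).1 ∈ A ∧ (θ.2.1 j).2 ∈ A) →
      (θ.1, θ.2.1 i) ∈ C → ∫⁻ ω, f i ω θ ∂P ≤ B)
    (hs : ∀ p ∈ A, (ν.prod ν) {y | (p, y) ∈ C} ≤ s) :
    ∫⁻ ω, ∫⁻ θ, ∑ i ∈ I θ.2.2, {θ : Sample G | (θ.1, θ.2.1 i) ∈ C}.indicator (f i ω) θ
      ∂(sampleLaw ν ρ) ∂P ≤ (∫⁻ k, ((I k).card : ℝ≥0∞) ∂ρ) * (s * B) := by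
  have hCi (i : ℕ) : MeasurableSet {θ : Sample G | (θ.1, θ.2.1 i) ∈ C} := by
    have : Measurable fun θ : Sample G => (θ.1, θ.2.1 i) := by fun_prop
    exact this hC
  have hmi (i : ℕ) : Measurable fun q : Ω × Sample G =>
      {θ : Sample G | (θ.1, θ.2.1 i) ∈ C}.indicator (f i q.1) q.2 := by
    have h1 : (fun q : Ω × Sample G =>
        {θ : Sample G | (θ.1, θ.2.1 i) ∈ C}.indicator (f i q.1) q.2)
        = (Prod.snd ⁻¹' {θ : Sample G | (θ.1, θ.2.1 i) ∈ C}).indicator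
          (Function.uncurry (f i)) := by
      rfl
    rw [h1]
    exact (hf i).indicator (measurable_snd (hCi i))
  have hm : Measurable fun q : Ω × Sample G => ∑ i ∈ I q.2.2.2,
      {θ : Sample G | (θ.1, θ.2.1 i) ∈ C}.indicator (f i q.1) q.2 :=
    measurable_sum_finset I hmi (by fun_prop)
  rw [lintegral_lintegral_swap hm.aemeasurable]
  have hgi (i : ℕ) : Measurable fun θ : Sample G =>
      {θ : Sample G | (θ.1, θ.2.1 i) ∈ C}.indicator (fun _ => B) θ :=
    measurable_const.indicator (hCi i)
  calc ∫⁻ θ, ∫⁻ ω, ∑ i ∈ I θ.2.2,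
        {θ : Sample G | (θ.1, θ.2.1 i) ∈ C}.indicator (f i ω) θ ∂P ∂(sampleLaw ν ρ)
      ≤ ∫⁻ θ, ∑ i ∈ I θ.2.2,
        {θ : Sample G | (θ.1, θ.2.1 i) ∈ C}.indicator (fun _ => B) θ ∂(sampleLaw ν ρ) := by
        refine lintegral_mono_ae ?_
        filter_upwards [ae_sampleLaw_mem ν ρ hA] with θ hθ
        have hmω (i : ℕ) : Measurable fun ω =>
            {θ : Sample G | (θ.1, θ.2.1 i) ∈ C}.indicator (f i ω) θ :=
          (hmi i).comp measurable_prodMk_right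
        rw [lintegral_finsetSum _ fun i _ => hmω i]
        refine Finset.sum_le_sum fun i _ => ?_
        by_cases hi : (θ.1, θ.2.1 i) ∈ C
        · simp only [Set.indicator_of_mem (show θ ∈ {θ : Sample G | (θ.1, θ.2.1 i) ∈ C} from hi)]
          exact hB i θ hθ.1 hθ.2 hi
        · simp only [Set.indicator_of_notMem
            (show θ ∉ {θ : Sample G | (θ.1, θ.2.1 i) ∈ C} from hi)]
          simp
    _ = ∫⁻ p, ∫⁻ k, ∑ i ∈ I k, (ν.prod ν) {y | (p, y) ∈ C} * B ∂ρ ∂ν := by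
        rw [lintegral_sampleLaw ν ρ (measurable_sum_finset I hgi (by fun_prop))]
        refine lintegral_congr fun p => lintegral_congr fun k => ?_
        have hCp : MeasurableSet {y | (p, y) ∈ C} := measurable_prodMk_left hC
        have hmz (i : ℕ) : Measurable fun z : ℕ → G × G =>
            {θ : Sample G | (θ.1, θ.2.1 i) ∈ C}.indicator (fun _ => B) (p, z, k) :=
          (hgi i).comp (by fun_prop)
        simp only
        rw [lintegral_finsetSum _ fun i _ => hmz i]
        refine Finset.sum_congr rfl fun i _ => ?_
        have h1 : (fun z : ℕ → G × G =>
            {θ : Sample G | (θ.1, θ.2.1 i) ∈ C}.indicator (fun _ => B) (p, z, k))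
            = fun z => {y | (p, y) ∈ C}.indicator (fun _ => B) (z i) := by
          funext z; simp only [Set.indicator, Set.mem_ofPred_eq]
        rw [h1, ← lintegral_map (f := {y | (p, y) ∈ C}.indicator fun _ => B)
          (measurable_const.indicator hCp) (measurable_pi_apply i),
          Measure.infinitePi_map_eval, lintegral_indicator hCp, setLIntegral_const, mul_comm]
    _ ≤ ∫⁻ _, ∫⁻ k, ((I k).card : ℝ≥0∞) * (s * B) ∂ρ ∂ν := by
        refine lintegral_mono_ae ?_
        have hAae : ∀ᵐ p ∂ν, p ∈ A := hA
        filter_upwards [hAae] with p hp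
        refine lintegral_mono fun k => ?_
        rw [Finset.sum_const, nsmul_eq_mul]
        gcongr
        exact hs p hp
    _ = _ := by
        rw [lintegral_const, measure_univ, mul_one, lintegral_mul_const _ (measurable_of_countable _)]

end AveragedCosts

/-! ### Mixing coefficients -/

lemma eLpNorm_two_ennreal {Ω : Type*} [MeasurableSpace Ω] (P : Measure Ω) (T : Ω → ℝ≥0∞) :
    eLpNorm T 2 P = (∫⁻ ω, T ω ^ (2 : ℝ) ∂P) ^ (1 / 2 : ℝ) := by
  rw [eLpNorm_eq_lintegral_rpow_enorm_toReal (by norm_num) (by norm_num)]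
  simp

lemma lintegral_mul_le_eLpNorm_two {Ω : Type*} [MeasurableSpace Ω] (P : Measure Ω)
    {Q R : Ω → ℝ≥0∞} (hQ : Measurable Q) (hR : Measurable R) :
    ∫⁻ ω, Q ω * R ω ∂P ≤ eLpNorm Q 2 P * eLpNorm R 2 P := by
  rw [eLpNorm_two_ennreal, eLpNorm_two_ennreal]
  exact ENNReal.lintegral_mul_le_Lp_mul_Lq P Real.HolderConjugate.two_two hQ.aemeasurable
    hR.aemeasurable

lemma lintegral_le_eLpNorm_two {Ω : Type*} [MeasurableSpace Ω] (P : Measure Ω)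
    [IsProbabilityMeasure P] {Q : Ω → ℝ≥0∞} (hQ : Measurable Q) :
    ∫⁻ ω, Q ω ∂P ≤ eLpNorm Q 2 P := by
  have h1 := lintegral_mul_le_eLpNorm_two P hQ (measurable_const (a := (1 : ℝ≥0∞)))
  have h2 : eLpNorm (fun _ : Ω => (1 : ℝ≥0∞)) 2 P = 1 := by
    rw [eLpNorm_two_ennreal]; simp
  simpa [h2] using h1

/-- A form of the Cauchy-Schwarz inequality for a factor that need not be measurable. -/
lemma lintegral_le_of_le_mul {Ω : Type*} [MeasurableSpace Ω] (P : Measure Ω)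
    {T Q S : Ω → ℝ≥0∞} (hT : Measurable T) (hQ : Measurable Q) (hQf : ∀ ω, Q ω ≠ ∞)
    (h : ∀ ω, T ω ≤ Q ω * S ω) : ∫⁻ ω, T ω ∂P ≤ eLpNorm Q 2 P * eLpNorm S 2 P := by
  have h1 (ω) : T ω = Q ω * (T ω / Q ω) := by
    rcases eq_or_ne (Q ω) 0 with h0 | h0
    · have := h ω
      rw [h0, zero_mul] at this
      rw [le_antisymm this zero_le, h0, zero_mul]
    · rw [ENNReal.mul_div_cancel h0 (hQf ω)]
  have h2 (ω) : T ω / Q ω ≤ S ω := ENNReal.div_le_of_le_mul' (h ω)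
  calc ∫⁻ ω, T ω ∂P = ∫⁻ ω, Q ω * (T ω / Q ω) ∂P := lintegral_congr h1
    _ ≤ eLpNorm Q 2 P * eLpNorm (fun ω => T ω / Q ω) 2 P :=
        lintegral_mul_le_eLpNorm_two P hQ (hT.div hQ)
    _ ≤ _ := by
        gcongr
        rw [eLpNorm_two_ennreal, eLpNorm_two_ennreal]
        gcongr with ω
        exact h2 ω

section Mixing

variable {G 𝒳 : Type*} [Group G] [MetricSpace G] [MeasurableSpace 𝒳] [MulAction G 𝒳]

/-- The supremum in the definition of `psiMix`, for a given law of the configuration. -/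
def psiSup (G : Type*) [Group G] [MetricSpace G] [MulAction G 𝒳] (μ : Measure 𝒳) (f : 𝒳 → ℕ)
    (t : ℝ) : ℝ≥0∞ :=
  ⨆ E ∈ psiPairs G f t, ⨆ _ : μ E.1 ≠ 0, ENNReal.ofReal |(μ[|E.1]).real E.2 - μ.real E.2|

/-- The supremum in the definition of `xiMix`, for a given law of the configuration. -/
def xiSup (G : Type*) [Group G] [MetricSpace G] [MulAction G 𝒳] (μ : Measure 𝒳) (f : 𝒳 → ℕ)
    (b t : ℝ) : ℝ≥0∞ :=
  ⨆ (E : ℕ → Set 𝒳 × Set 𝒳) (_ : ∀ k, E k ∈ xiPairs G f b t)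
      (_ : Pairwise fun k l => Disjoint (E k).1 (E l).1),
    ENNReal.ofReal |∑' k, μ.real (E k).1 * ((μ[|(E k).1]).real (E k).2 - μ.real (E k).2)
      / μ.real (⋃ k, (E k).1)|

lemma mul_cond_real_sub (μ : Measure 𝒳) [IsFiniteMeasure μ] {A : Set 𝒳} (hA : MeasurableSet A)
    (B : Set 𝒳) : μ.real A * ((μ[|A]).real B - μ.real B)
      = (μ (A ∩ B)).toReal - (μ A * μ B).toReal := by
  rw [mul_sub, ENNReal.toReal_mul, measureReal_def, measureReal_def, measureReal_def]
  congr 1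
  rcases eq_or_ne (μ A) 0 with h0 | h0
  · have : μ (A ∩ B) = 0 := measure_mono_null Set.inter_subset_left h0
    simp [h0, this]
  · rw [cond_apply hA, ← ENNReal.toReal_mul, ← mul_assoc,
      ENNReal.mul_inv_cancel h0 (measure_ne_top _ _), one_mul]

lemma measurable_sigmaProcess (f : 𝒳 → ℕ) {H : Set G} {φ : G} (hφ : φ ∈ H) :
    Measurable[sigmaProcess f H] fun x : 𝒳 => f (φ • x) := by
  have h1 : MeasurableSpace.comap (fun x : 𝒳 => f (φ • x)) ⊤ ≤ sigmaProcess f H := by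
    unfold sigmaProcess
    exact le_iSup₂_of_le (f := fun φ (_ : φ ∈ H) =>
      MeasurableSpace.comap (fun x : 𝒳 => f (φ • x)) ⊤) φ hφ le_rfl
  exact Measurable.mono (comap_measurable _) h1 le_rfl

lemma pairProb_sub_le_psi (μ : Measure 𝒳) [IsFiniteMeasure μ] {f : 𝒳 → ℕ}
    {t : ℝ} {p q : G} (hpq : t ≤ dist p q) (hm : MeasurableSet {x | f (p • x) = 1}) :
    pairProb μ (fun (φ : G) x => f (φ • x)) p q
        - hitProb μ (fun (φ : G) x => f (φ • x)) p * hitProb μ (fun (φ : G) x => f (φ • x)) q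
      ≤ hitProb μ (fun (φ : G) x => f (φ • x)) p * psiSup G μ f t := by
  unfold hitProb pairProb
  set A := {x | f (p • x) = 1}
  set B := {x | f (q • x) = 1}
  have hAB : {x | f (p • x) = 1 ∧ f (q • x) = 1} = A ∩ B := rfl
  rw [hAB]
  rcases eq_or_ne (μ A) 0 with h0 | h0
  · have : μ (A ∩ B) = 0 := measure_mono_null Set.inter_subset_left h0
    simp [this]
  have hmem : ((A, B) : Set 𝒳 × Set 𝒳) ∈ psiPairs G f t := by
    refine ⟨p, {q}, by simpa using hpq, ?_, ?_⟩
    · exact measurable_sigmaProcess f (Set.mem_singleton p) (measurableSet_singleton 1)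
    · exact measurable_sigmaProcess f (Set.mem_singleton q) (measurableSet_singleton 1)
  have h1 : ENNReal.ofReal |(μ[|A]).real B - μ.real B| ≤ psiSup G μ f t :=
    le_iSup₂_of_le (f := fun (E : Set 𝒳 × Set 𝒳) (_ : E ∈ psiPairs G f t) =>
      ⨆ _ : μ E.1 ≠ 0, ENNReal.ofReal |(μ[|E.1]).real E.2 - μ.real E.2|) (A, B) hmem
      (le_iSup_of_le h0 le_rfl)
  calc μ (A ∩ B) - μ A * μ B
      ≤ (μ (A ∩ B) - μ A * μ B) + (μ A * μ B - μ (A ∩ B)) := le_self_add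
    _ = ENNReal.ofReal |(μ (A ∩ B)).toReal - (μ A * μ B).toReal| :=
        (ofReal_abs_toReal_sub (measure_ne_top _ _)
          (ENNReal.mul_ne_top (measure_ne_top _ _) (measure_ne_top _ _))).symm
    _ = μ A * ENNReal.ofReal |(μ[|A]).real B - μ.real B| := by
        rw [← mul_cond_real_sub μ hm B, abs_mul, ENNReal.ofReal_mul (abs_nonneg _),
          abs_of_nonneg measureReal_nonneg, ofReal_measureReal]
    _ ≤ _ := by gcongr

end Mixing

section MixCost

variable {G 𝒳 : Type*} [MetricSpace G] [MeasurableSpace G] [MeasurableSpace 𝒳]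

lemma countLaw_congr (κ : Measure 𝒳) (h : G → 𝒳 → ℕ) {F F' : Sample G → 𝒳 × 𝒳 → ℕ}
    {θ : Sample G} (hF : F θ = F' θ) : countLaw κ h F θ = countLaw κ h F' θ := by
  funext w; rw [countLaw, countLaw, hF]

/-- The cost of decoupling is governed by the distance of the closest far point. -/
lemma mixCost_le_tsum (κ : Measure 𝒳) [IsProbabilityMeasure κ] (h : G → 𝒳 → ℕ) (b : ℝ) (n : ℕ)
    (θ : Sample G) :
    mixCost κ h b n θ ≤ ∑' t : {t : ℕ // n ≤ t}, ∑ i ∈ Finset.range θ.2.2,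
      if ((t : ℕ) : ℝ) < dist θ.1 (θ.2.1 i).1 ∧ dist θ.1 (θ.2.1 i).1 ≤ ((t : ℕ) + 1 : ℕ)
        then mixCost κ h b (t : ℕ) θ else 0 := by
  by_cases hex : ∃ t : ℕ, n ≤ t ∧ ∃ i ∈ Finset.range θ.2.2,
      (t : ℝ) < dist θ.1 (θ.2.1 i).1 ∧ dist θ.1 (θ.2.1 i).1 ≤ (t + 1 : ℕ)
  · classical
    obtain ⟨hn, i, hi, hd⟩ := Nat.find_spec hex
    set t := Nat.find hex with ht
    have hfar (x : 𝒳) : farCount h n θ.2.2 θ.1 (fun i => (θ.2.1 i).1) x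
        = farCount h t θ.2.2 θ.1 (fun i => (θ.2.1 i).1) x := by
      unfold farCount
      congr 1
      refine Finset.filter_congr fun j hj => ?_
      constructor
      · intro h1
        by_contra h2
        have hpos : 0 < dist θ.1 (θ.2.1 j).1 := lt_of_le_of_lt (Nat.cast_nonneg n) h1
        obtain ⟨s, hs⟩ : ∃ s, ⌈dist θ.1 (θ.2.1 j).1⌉₊ = s + 1 :=
          Nat.exists_eq_succ_of_ne_zero (Nat.ceil_pos.2 hpos).ne'
        have hs1 : (s : ℝ) < dist θ.1 (θ.2.1 j).1 := Nat.lt_ceil.1 (by omega)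
        have hs2 : dist θ.1 (θ.2.1 j).1 ≤ (s + 1 : ℕ) := hs ▸ Nat.le_ceil _
        have hns : n ≤ s := by
          have : (n : ℝ) < (s + 1 : ℕ) := h1.trans_le hs2
          have : n < s + 1 := by exact_mod_cast this
          omega
        have hst : s < t := by
          have : (s : ℝ) < t := hs1.trans_le (not_lt.1 h2)
          exact_mod_cast this
        exact Nat.find_min hex hst ⟨hns, j, hj, hs1, hs2⟩
      · intro h1
        exact lt_of_le_of_lt (by exact_mod_cast hn) h1
    have hmix : mixCost κ h b n θ = mixCost κ h b t θ := by
      rw [mixCost, mixCost, countLaw_congr κ h (F := splitCount h b n) (F' := splitCount h b t)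
        (by funext y; simp only [splitCount, hfar]),
        countLaw_congr κ h (F := decoupledCount h b n) (F' := decoupledCount h b t)
        (by funext y; simp only [decoupledCount, hfar])]
    rw [hmix]
    refine le_trans ?_ (ENNReal.le_tsum (⟨t, hn⟩ : {t : ℕ // n ≤ t}))
    refine le_trans ?_ (Finset.single_le_sum (fun _ _ => zero_le) hi)
    rw [if_pos hd]
  · have hfar (x : 𝒳) : farCount h n θ.2.2 θ.1 (fun i => (θ.2.1 i).1) x = 0 := by
      unfold farCount
      rw [Finset.filter_false_of_mem, Finset.sum_empty]
      intro j hj h1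
      have hpos : 0 < dist θ.1 (θ.2.1 j).1 := lt_of_le_of_lt (Nat.cast_nonneg n) h1
      obtain ⟨s, hs⟩ : ∃ s, ⌈dist θ.1 (θ.2.1 j).1⌉₊ = s + 1 :=
        Nat.exists_eq_succ_of_ne_zero (Nat.ceil_pos.2 hpos).ne'
      have hs1 : (s : ℝ) < dist θ.1 (θ.2.1 j).1 := Nat.lt_ceil.1 (by omega)
      have hs2 : dist θ.1 (θ.2.1 j).1 ≤ (s + 1 : ℕ) := hs ▸ Nat.le_ceil _
      have hns : n ≤ s := by
        have : (n : ℝ) < (s + 1 : ℕ) := h1.trans_le hs2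
        have : n < s + 1 := by exact_mod_cast this
        omega
      exact hex ⟨s, hns, j, hj, hs1, hs2⟩
    have hmix : mixCost κ h b n θ = 0 := by
      have : splitCount h b n θ = decoupledCount h b n θ := by
        funext y; simp only [splitCount, decoupledCount, hfar]
      rw [mixCost, countLaw_congr κ h this, l1Dist_self]
    rw [hmix]; exact zero_le

lemma tsum_subtype_measure_inter_fiber {α : Type*} [MeasurableSpace α] (μ : Measure α) {S : Set α}
    (hS : MeasurableSet S) {F : α → ℕ} (hF : Measurable F) (B : Set ℕ) :
    ∑' w : B, μ (S ∩ {x | F x = w}) = μ (S ∩ {x | F x ∈ B}) := by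
  rw [← measure_iUnion]
  · congr 1; ext x; simp
  · intro v w hvw
    rw [Function.onFun, Set.disjoint_left]
    rintro x ⟨_, h1⟩ ⟨_, h2⟩
    exact hvw (Subtype.ext (h1.symm.trans h2))
  · exact fun w => hS.inter (hF (measurableSet_singleton _))

end MixCost

section XiBound

variable {G 𝒳 : Type*} [Group G] [MetricSpace G] [MeasurableSpace G] [MeasurableSpace 𝒳]
  [MulAction G 𝒳] [SecondCountableTopology G] [OpensMeasurableSpace G]

lemma mixCost_le_xi (μ : Measure 𝒳) [IsProbabilityMeasure μ] {f : 𝒳 → ℕ}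
    (hh : Measurable (Function.uncurry fun (φ : G) (x : 𝒳) => f (φ • x))) (b t : ℝ)
    (θ : Sample G) :
    mixCost μ (fun (φ : G) x => f (φ • x)) b t θ
      ≤ hitProb μ (fun (φ : G) x => f (φ • x)) θ.1 * (2 * xiSup G μ f b t) := by
  set h : G → 𝒳 → ℕ := fun φ x => f (φ • x) with hdef
  obtain ⟨p, z, k⟩ := θ
  set N : 𝒳 → ℕ := nearCount h b k p (fun i => (z i).1) with hN
  set U : 𝒳 → ℕ := farCount h t k p (fun i => (z i).1) with hU
  have hNm : Measurable N := measurable_nearCount hh b measurable_const measurable_const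
    measurable_const measurable_id
  have hUm : Measurable U := measurable_farCount hh t measurable_const measurable_const
    measurable_const measurable_id
  set S : Set 𝒳 := {x | h p x = 1} with hS
  have hSm : MeasurableSet S := measurableSet_hit hh p
  set Aj : ℕ → Set 𝒳 := fun j => S ∩ {x | N x = j} with hAj
  have hAm (j) : MeasurableSet (Aj j) := hSm.inter (hNm (measurableSet_singleton j))
  have hsm := measurable_splitCount hh b t
  have hdm := measurable_decoupledCount hh b t
  have hdisj : Pairwise fun j l => Disjoint (Aj j) (Aj l) := by
    intro j l hjl
    rw [Set.disjoint_left]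
    rintro x ⟨_, h1⟩ ⟨_, h2⟩
    exact hjl (h1.symm.trans h2)
  have hUn : ⋃ j, Aj j = S := by ext x; simp [hAj]
  have key (B : Set ℕ) :
      (∑' w : B, countLaw μ h (splitCount h b t) (p, z, k) w
        - ∑' w : B, countLaw μ h (decoupledCount h b t) (p, z, k) w)
      + (∑' w : B, countLaw μ h (decoupledCount h b t) (p, z, k) w
        - ∑' w : B, countLaw μ h (splitCount h b t) (p, z, k) w)
      ≤ hitProb μ h p * xiSup G μ f b t := by
    set Bj : ℕ → Set 𝒳 := fun j => {x | j + U x ∈ B} with hBj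
    have hBm (j) : MeasurableSet (Bj j) := by
      have : Measurable fun x => j + U x := measurable_const.add hUm
      exact this (MeasurableSet.of_discrete (s := B))
    have e1 : ∑' w : B, countLaw μ h (splitCount h b t) (p, z, k) w = ∑' j, μ (Aj j ∩ Bj j) := by
      have h1 := tsum_subtype_measure_inter_fiber (μ.prod μ) (measurableSet_hit_fst hh p)
        (hsm.comp (measurable_prodMk_left (x := (p, z, k)))) B
      refine h1.trans ?_
      have h2 := prod_fst_preimage μ fun x => h p x = 1 ∧ N x + U x ∈ B
      refine Eq.trans h2 ?_
      rw [← measure_iUnion]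
      · congr 1
        ext x
        simp [hAj, hBj, hS]
      · intro j l hjl
        exact (hdisj hjl).mono Set.inter_subset_left Set.inter_subset_left
      · exact fun j => (hAm j).inter (hBm j)
    have e2 : ∑' w : B, countLaw μ h (decoupledCount h b t) (p, z, k) w
        = ∑' j, μ (Aj j) * μ (Bj j) := by
      have h1 := tsum_subtype_measure_inter_fiber (μ.prod μ) (measurableSet_hit_fst hh p)
        (hdm.comp (measurable_prodMk_left (x := (p, z, k)))) B
      refine h1.trans ?_
      simp only [← Measure.prod_prod]
      rw [← measure_iUnion]
      · congr 1
        ext y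
        simp only [Set.mem_inter_iff, Set.mem_ofPred_eq, Set.mem_iUnion, Set.mem_prod, hAj, hBj, hS,
          Function.comp_def]
        constructor
        · rintro ⟨k1, k2⟩
          exact ⟨_, ⟨k1, rfl⟩, k2⟩
        · rintro ⟨j, ⟨k1, rfl⟩, k3⟩
          exact ⟨k1, k3⟩
      · intro j l hjl
        exact Set.disjoint_prod.2 (Or.inl (hdisj hjl))
      · exact fun j => (hAm j).prod (hBm j)
    have f1 : ∑' j, μ (Aj j) = μ S := by
      rw [← hUn, measure_iUnion hdisj hAm]
    have f2 : ∑' j, μ (Aj j ∩ Bj j) ≠ ∞ :=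
      ne_top_of_le_ne_top (f1 ▸ measure_ne_top μ S)
        (ENNReal.tsum_le_tsum fun j => measure_mono Set.inter_subset_left)
    have f3 : ∑' j, μ (Aj j) * μ (Bj j) ≠ ∞ :=
      ne_top_of_le_ne_top (f1 ▸ measure_ne_top μ S)
        (ENNReal.tsum_le_tsum fun j => mul_le_of_le_one_right zero_le prob_le_one)
    rw [e1, e2, ← ofReal_abs_toReal_sub f2 f3]
    rcases eq_or_ne (μ S) 0 with h0 | h0
    · have h1 (j) : μ (Aj j) = 0 := measure_mono_null Set.inter_subset_left h0
      have h2 (j) : μ (Aj j ∩ Bj j) = 0 := measure_mono_null Set.inter_subset_left (h1 j)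
      simp [h1, h2]
    have hmem (j) : (Aj j, Bj j) ∈ xiPairs G f b t := by
      set s := (Finset.range k).filter fun i => dist p (z i).1 ≤ b with hs
      refine ⟨p, s.card, fun i => (z (s.equivFin.symm i)).1, {q | t < dist p q}, ?_, ?_, ?_, ?_⟩
      · intro i
        exact (Finset.mem_filter.1 (s.equivFin.symm i).2).2
      · exact fun η hη => le_of_lt hη
      · refine ⟨{y | y.1 = 1 ∧ y.1 + y.2 = j}, trivial, ?_⟩
        ext x
        have hsum : ∑ i, f ((z (s.equivFin.symm i)).1 • x) = ∑ i ∈ s, f ((z i).1 • x) := by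
          rw [← Finset.sum_coe_sort s]
          exact Equiv.sum_comp s.equivFin.symm fun i : s => f ((z i).1 • x)
        simp only [Set.mem_preimage, Set.mem_ofPred_eq, hsum]
        rfl
      · have hUmeas : Measurable[sigmaProcess f {q | t < dist p q}] U := by
          have : U = fun x => ∑ i ∈ (Finset.range k).filter fun i => t < dist p (z i).1,
            f ((z i).1 • x) := rfl
          rw [this]
          refine Finset.measurable_fun_sum (m := sigmaProcess f {q | t < dist p q}) _ fun i hi => ?_
          exact measurable_sigmaProcess f (Finset.mem_filter.1 hi).2
        have : Measurable[sigmaProcess f {q | t < dist p q}] fun x => j + U x :=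
          Measurable.comp (measurable_of_countable fun u => j + u) hUmeas
        exact this (MeasurableSet.of_discrete (s := B))
    have hxi : ENNReal.ofReal |∑' j, μ.real (Aj j) *
        ((μ[|Aj j]).real (Bj j) - μ.real (Bj j)) / μ.real (⋃ j, Aj j)| ≤ xiSup G μ f b t :=
      le_iSup_of_le (fun j => (Aj j, Bj j)) (le_iSup_of_le hmem (le_iSup_of_le hdisj le_rfl))
    have hsumeq : ∑' j, μ.real (Aj j) * ((μ[|Aj j]).real (Bj j) - μ.real (Bj j))
          / μ.real (⋃ j, Aj j)
        = ((∑' j, μ (Aj j ∩ Bj j)).toReal - (∑' j, μ (Aj j) * μ (Bj j)).toReal) / μ.real S := by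
      rw [tsum_div_const, hUn]
      congr 1
      simp only [mul_cond_real_sub μ (hAm _)]
      rw [(ENNReal.summable_toReal f2).tsum_sub (ENNReal.summable_toReal f3),
        ENNReal.tsum_toReal_eq fun j => measure_ne_top _ _,
        ENNReal.tsum_toReal_eq fun j => ENNReal.mul_ne_top (measure_ne_top _ _) (measure_ne_top _ _)]
    rw [hsumeq, abs_div, abs_of_nonneg (measureReal_nonneg (μ := μ) (s := S))] at hxi
    have hSpos : 0 < μ.real S := ENNReal.toReal_pos h0 (measure_ne_top _ _)
    calc _ = ENNReal.ofReal (μ.real S * (|(∑' j, μ (Aj j ∩ Bj j)).toReal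
          - (∑' j, μ (Aj j) * μ (Bj j)).toReal| / μ.real S)) := by
          rw [mul_div_cancel₀ _ hSpos.ne']
      _ ≤ _ := by
          rw [ENNReal.ofReal_mul hSpos.le, ofReal_measureReal]
          exact mul_le_mul_right hxi _
  have hfinS : ∑' w, countLaw μ h (splitCount h b t) (p, z, k) w ≠ ∞ := by
    have := tsum_measure_inter_fiber (μ.prod μ) (measurableSet_hit_fst hh p)
      (hsm.comp (measurable_prodMk_left (x := (p, z, k))))
    exact ne_of_eq_of_ne this (measure_ne_top _ _)
  have hfinD : ∑' w, countLaw μ h (decoupledCount h b t) (p, z, k) w ≠ ∞ := by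
    have := tsum_measure_inter_fiber (μ.prod μ) (measurableSet_hit_fst hh p)
      (hdm.comp (measurable_prodMk_left (x := (p, z, k))))
    exact ne_of_eq_of_ne this (measure_ne_top _ _)
  refine (l1Dist_le_two_mul_of_forall (M := hitProb μ h p * xiSup G μ f b t) hfinS hfinD
    (fun B => ?_) fun B => ?_).trans (le_of_eq (by ring))
  · exact tsub_le_iff_left.1 (le_self_add.trans (key B))
  · exact tsub_le_iff_left.1 (le_add_self.trans (key B))

end XiBound

/-! ### Averages of the costs -/

lemma eLpNorm_two_const_mul {Ω : Type*} [MeasurableSpace Ω] (P : Measure Ω) {c : ℝ≥0∞}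
    (hc : c ≠ ∞) (S : Ω → ℝ≥0∞) : eLpNorm (fun ω => c * S ω) 2 P = c * eLpNorm S 2 P := by
  rw [eLpNorm_two_ennreal, eLpNorm_two_ennreal]
  simp_rw [ENNReal.mul_rpow_of_nonneg _ _ zero_le_two]
  rw [lintegral_const_mul' _ _ (ENNReal.rpow_ne_top_of_nonneg zero_le_two hc),
    ENNReal.mul_rpow_of_nonneg _ _ (by norm_num), ← ENNReal.rpow_mul]
  norm_num

section AverageCost

variable {G 𝒳 Ω : Type*} [MetricSpace G] [MeasurableSpace G] [MeasurableSpace 𝒳]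
  [MeasurableSpace Ω] [SecondCountableTopology G] [OpensMeasurableSpace G]
  {h : G → 𝒳 → ℕ} (hh : Measurable (Function.uncurry h))
  (P : Measure Ω) [IsProbabilityMeasure P] (κ : Kernel Ω 𝒳) [IsMarkovKernel κ]
  (ν : Measure G) [IsProbabilityMeasure ν] (ρ : Measure ℕ) [IsProbabilityMeasure ρ]
  {A : Set G} (hA : ν Aᶜ = 0) {q : ℝ≥0∞}
  (hq : ∀ p ∈ A, eLpNorm (fun ω => hitProb (κ ω) h p) 2 P ≤ q)

include hh hq

lemma lintegral_hitProb_le {p : G} (hp : p ∈ A) : ∫⁻ ω, hitProb (κ ω) h p ∂P ≤ q :=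
  (lintegral_le_eLpNorm_two P (measurable_hitProb_comp hh κ measurable_id measurable_const)).trans
    (hq p hp)

lemma lintegral_hitProb_mul_le {p p' : G} (hp : p ∈ A) (hp' : p' ∈ A) :
    ∫⁻ ω, hitProb (κ ω) h p * hitProb (κ ω) h p' ∂P ≤ q * q :=
  (lintegral_mul_le_eLpNorm_two P (measurable_hitProb_comp hh κ measurable_id measurable_const)
    (measurable_hitProb_comp hh κ measurable_id measurable_const)).trans
    (mul_le_mul' (hq p hp) (hq p' hp'))

include hA

lemma lintegral_base_hitProb_le :
    ∫⁻ ω, ∫⁻ θ, hitProb (κ ω) h θ.1 ∂(sampleLaw ν ρ) ∂P ≤ q := by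
  have hm : Measurable fun y : Ω × Sample G => hitProb (κ y.1) h y.2.1 :=
    measurable_hitProb_comp hh κ (by fun_prop) (by fun_prop)
  rw [lintegral_lintegral_swap hm.aemeasurable]
  calc ∫⁻ θ, ∫⁻ ω, hitProb (κ ω) h θ.1 ∂P ∂(sampleLaw ν ρ) ≤ ∫⁻ _, q ∂(sampleLaw ν ρ) := by
        refine lintegral_mono_ae ?_
        filter_upwards [ae_sampleLaw_mem ν ρ hA] with θ hθ
        exact lintegral_hitProb_le hh P κ hq hθ.1
    _ = q := by simp

lemma lintegral_nearCost_le {π : G × G → G} (hπ : Measurable π)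
    (hπA : ∀ y : G × G, y.1 ∈ A → y.2 ∈ A → π y ∈ A) {r : ℝ} {s : ℝ≥0∞}
    (hs : ∀ p ∈ A, ν (Metric.closedBall p r) ≤ s) :
    ∫⁻ ω, ∫⁻ θ, nearCost (κ ω) h π r θ ∂(sampleLaw ν ρ) ∂P
      ≤ (∫⁻ k, (k : ℝ≥0∞) ∂ρ) * (2 * s * (q * q)) := by
  set C : Set (G × (G × G)) := {y | dist y.1 y.2.1 ≤ r} ∪ {y | dist y.1 y.2.2 ≤ r} with hCdef
  have hC : MeasurableSet C := (measurableSet_dist_le (by fun_prop) (by fun_prop) r).union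
    (measurableSet_dist_le (by fun_prop) (by fun_prop) r)
  have key := lintegral_lintegral_sum_indicator_le P ν ρ hA Finset.range hC
    (f := fun i ω θ => hitProb (κ ω) h θ.1 * hitProb (κ ω) h (π (θ.2.1 i)))
    (fun i => (measurable_hitProb_comp hh κ (by fun_prop) (by fun_prop)).mul
      (measurable_hitProb_comp hh κ (by fun_prop) (by fun_prop)))
    (B := q * q) (s := 2 * s)
    (fun i θ h1 h2 _ => lintegral_hitProb_mul_le hh P κ hq h1 (hπA _ (h2 i).1 (h2 i).2))
    (fun p hp => by
      have h1 : {y : G × G | (p, y) ∈ C}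
          = (Metric.closedBall p r ×ˢ Set.univ) ∪ (Set.univ ×ˢ Metric.closedBall p r) := by
        ext y; simp [hCdef, Metric.mem_closedBall, dist_comm]
      rw [h1, two_mul]
      refine (measure_union_le _ _).trans ?_
      rw [Measure.prod_prod, Measure.prod_prod, measure_univ, mul_one, one_mul]
      exact add_le_add (hs p hp) (hs p hp))
  simp only [Finset.card_range] at key
  refine le_trans (le_of_eq ?_) key
  refine lintegral_congr fun ω => lintegral_congr fun θ => ?_
  rw [nearCost, Finset.mul_sum]
  refine Finset.sum_congr rfl fun i _ => ?_
  rw [mul_ite, mul_zero, Set.indicator_apply]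
  exact if_congr Iff.rfl rfl rfl

lemma lintegral_sizeCost_le {b : ℝ} {l : ℕ} {s : ℝ≥0∞}
    (hs : ∀ p ∈ A, ν (Metric.closedBall p b) ≤ s) :
    ∫⁻ ω, ∫⁻ θ, sizeCost (κ ω) h b l θ ∂(sampleLaw ν ρ) ∂P
      ≤ (∫⁻ k, ((max k l - min k l : ℕ) : ℝ≥0∞) ∂ρ) * (s * q) := by
  set C : Set (G × (G × G)) := {y | dist y.1 y.2.1 ≤ b} with hCdef
  have hC : MeasurableSet C := measurableSet_dist_le (by fun_prop) (by fun_prop) b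
  have key := lintegral_lintegral_sum_indicator_le P ν ρ hA
    (fun k => Finset.Ico (min k l) (max k l)) hC
    (f := fun i ω θ => hitProb (κ ω) h θ.1)
    (fun i => measurable_hitProb_comp hh κ (by fun_prop) (by fun_prop))
    (B := q) (s := s)
    (fun i θ h1 h2 _ => lintegral_hitProb_le hh P κ hq h1)
    (fun p hp => by
      have h1 : {y : G × G | (p, y) ∈ C} = Metric.closedBall p b ×ˢ Set.univ := by
        ext y; simp [hCdef, Metric.mem_closedBall, dist_comm]
      rw [h1, Measure.prod_prod, measure_univ, mul_one]
      exact hs p hp)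
  simp only [Nat.card_Ico] at key
  refine le_trans (le_of_eq ?_) key
  refine lintegral_congr fun ω => lintegral_congr fun θ => ?_
  rw [sizeCost, Finset.mul_sum]
  refine Finset.sum_congr rfl fun i _ => ?_
  rw [mul_ite, mul_zero, mul_one]
  rfl

lemma lintegral_extraCost_le (e : ℕ) :
    ∫⁻ ω, ∫⁻ θ, extraCost (κ ω) h e θ ∂(sampleLaw ν ρ) ∂P ≤ e * (q * q) := by
  have key := lintegral_lintegral_sum_indicator_le P ν ρ hA
    (fun k => Finset.Ico k (k + e)) (C := Set.univ) MeasurableSet.univ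
    (f := fun i ω θ => hitProb (κ ω) h θ.1 * hitProb (κ ω) h (θ.2.1 i).2)
    (fun i => (measurable_hitProb_comp hh κ (by fun_prop) (by fun_prop)).mul
      (measurable_hitProb_comp hh κ (by fun_prop) (by fun_prop)))
    (B := q * q) (s := 1)
    (fun i θ h1 h2 _ => lintegral_hitProb_mul_le hh P κ hq h1 (h2 i).2)
    (fun p hp => prob_le_one)
  simp only [Nat.card_Ico, add_tsub_cancel_left, lintegral_const, measure_univ, mul_one,
    one_mul] at key
  refine le_trans (le_of_eq ?_) key
  refine lintegral_congr fun ω => lintegral_congr fun θ => ?_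
  rw [extraCost, Finset.mul_sum]
  refine Finset.sum_congr rfl fun i _ => ?_
  simp

omit hh hq in
/-- The average of a sum over shells around the base point. -/
lemma lintegral_shell_le {f : ℕ → Ω → Sample G → ℝ≥0∞}
    (hf : ∀ i, Measurable fun y : Ω × Sample G => f i y.1 y.2) {B s : ℝ≥0∞} {t t' : ℝ}
    (hB : ∀ i (θ : Sample G), θ.1 ∈ A → (∀ j, (θ.2.1 j).1 ∈ A ∧ (θ.2.1 j).2 ∈ A) →
      t < dist θ.1 (θ.2.1 i).1 → ∫⁻ ω, f i ω θ ∂P ≤ B)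
    (hs : ∀ p ∈ A, ν (Metric.closedBall p t' \ Metric.closedBall p t) ≤ s) :
    ∫⁻ ω, ∫⁻ θ, ∑ i ∈ Finset.range θ.2.2,
      (if t < dist θ.1 (θ.2.1 i).1 ∧ dist θ.1 (θ.2.1 i).1 ≤ t' then f i ω θ else 0)
      ∂(sampleLaw ν ρ) ∂P ≤ (∫⁻ k, (k : ℝ≥0∞) ∂ρ) * (s * B) := by
  set C : Set (G × (G × G)) := {y | t < dist y.1 y.2.1} ∩ {y | dist y.1 y.2.1 ≤ t'} with hCdef
  have hC : MeasurableSet C := (measurableSet_lt_dist (by fun_prop) (by fun_prop) t).inter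
    (measurableSet_dist_le (by fun_prop) (by fun_prop) t')
  have key := lintegral_lintegral_sum_indicator_le P ν ρ hA Finset.range hC (f := f) hf
    (B := B) (s := s) (fun i θ h1 h2 h3 => hB i θ h1 h2 h3.1)
    (fun p hp => by
      have h1 : {y : G × G | (p, y) ∈ C}
          = (Metric.closedBall p t' \ Metric.closedBall p t) ×ˢ Set.univ := by
        ext y; simp [hCdef, Metric.mem_closedBall, dist_comm, and_comm]
      rw [h1, Measure.prod_prod, measure_univ, mul_one]
      exact hs p hp)
  simp only [Finset.card_range] at key
  refine le_trans (le_of_eq ?_) key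
  refine lintegral_congr fun ω => lintegral_congr fun θ => Finset.sum_congr rfl fun i _ => ?_
  rw [Set.indicator_apply]
  exact if_congr Iff.rfl rfl rfl

end AverageCost

section AverageMixing

variable {G 𝒳 Ω : Type*} [Group G] [MetricSpace G] [MeasurableSpace G] [MeasurableSpace 𝒳]
  [MulAction G 𝒳] [MeasurableSpace Ω] [SecondCountableTopology G] [OpensMeasurableSpace G]
  {f : 𝒳 → ℕ} (hh : Measurable (Function.uncurry fun (φ : G) (x : 𝒳) => f (φ • x)))
  (P : Measure Ω) [IsProbabilityMeasure P] (κ : Kernel Ω 𝒳) [IsMarkovKernel κ]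
  (ν : Measure G) [IsProbabilityMeasure ν] (ρ : Measure ℕ) [IsProbabilityMeasure ρ]
  {A : Set G} (hA : ν Aᶜ = 0) {q : ℝ≥0∞}
  (hq : ∀ p ∈ A, eLpNorm (fun ω => hitProb (κ ω) (fun (φ : G) x => f (φ • x)) p) 2 P ≤ q)
  {s' : ℝ≥0∞} {g : ℕ → ℝ≥0∞}
  (hg : ∀ p ∈ A, ∀ t : ℕ, 1 ≤ t →
    ν (Metric.closedBall p (t + 1 : ℕ) \ Metric.closedBall p t) ≤ s' * g t)

include hh hA hq hg

lemma lintegral_mixCost_le (b : ℝ) {n : ℕ} (hn : 1 ≤ n) :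
    ∫⁻ ω, ∫⁻ θ, mixCost (κ ω) (fun (φ : G) x => f (φ • x)) b n θ ∂(sampleLaw ν ρ) ∂P
      ≤ (∫⁻ k, (k : ℝ≥0∞) ∂ρ) * (2 * s' * q *
        ∑' t : {t : ℕ // n ≤ t}, g t * eLpNorm (fun ω => xiSup G (κ ω) f b (t : ℕ)) 2 P) := by
  set h : G → 𝒳 → ℕ := fun φ x => f (φ • x) with hdef
  set S : {t : ℕ // n ≤ t} → Ω → Sample G → ℝ≥0∞ := fun t ω θ => ∑ i ∈ Finset.range θ.2.2,
    if ((t : ℕ) : ℝ) < dist θ.1 (θ.2.1 i).1 ∧ dist θ.1 (θ.2.1 i).1 ≤ ((t : ℕ) + 1 : ℕ)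
      then mixCost (κ ω) h b (t : ℕ) θ else 0 with hS
  have hSm (t) : Measurable fun y : Ω × Sample G => S t y.1 y.2 := by
    refine measurable_sum_finset Finset.range (fun i => ?_) (by fun_prop)
    refine Measurable.ite ?_ (measurable_mixCost hh κ b _) measurable_const
    exact (measurableSet_lt_dist (by fun_prop) (by fun_prop) _).inter
      (measurableSet_dist_le (by fun_prop) (by fun_prop) _)
  have hShell (t : {t : ℕ // n ≤ t}) : ∫⁻ ω, ∫⁻ θ, S t ω θ ∂(sampleLaw ν ρ) ∂P
      ≤ (∫⁻ k, (k : ℝ≥0∞) ∂ρ) * (s' * g t *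
        (q * (2 * eLpNorm (fun ω => xiSup G (κ ω) f b (t : ℕ)) 2 P))) := by
    refine lintegral_shell_le P ν ρ hA (f := fun _ ω θ => mixCost (κ ω) h b (t : ℕ) θ)
      (fun i => measurable_mixCost hh κ b _)
      (fun i θ h1 _ _ => ?_) (fun p hp => hg p hp t (hn.trans t.2))
    have hm : Measurable fun ω => mixCost (κ ω) h b (t : ℕ) θ :=
      (measurable_mixCost hh κ b _).comp (measurable_prodMk_right (y := θ))
    refine (lintegral_le_of_le_mul P hm
      (measurable_hitProb_comp hh κ measurable_id measurable_const (p := fun _ => θ.1))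
      (fun ω => measure_ne_top _ _) fun ω => mixCost_le_xi (κ ω) hh b (t : ℕ) θ).trans ?_
    rw [eLpNorm_two_const_mul P ENNReal.ofNat_ne_top]
    gcongr
    exact hq _ h1
  calc ∫⁻ ω, ∫⁻ θ, mixCost (κ ω) h b n θ ∂(sampleLaw ν ρ) ∂P
      ≤ ∫⁻ ω, ∫⁻ θ, ∑' t, S t ω θ ∂(sampleLaw ν ρ) ∂P :=
        lintegral_mono fun ω => lintegral_mono fun θ => mixCost_le_tsum (κ ω) h b n θ
    _ = ∑' t, ∫⁻ ω, ∫⁻ θ, S t ω θ ∂(sampleLaw ν ρ) ∂P := by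
        rw [← lintegral_tsum fun t => ((hSm t).lintegral_prod_right').aemeasurable]
        refine lintegral_congr fun ω => ?_
        have hSω (t) : Measurable (S t ω) := (hSm t).comp measurable_prodMk_left
        rw [lintegral_tsum fun t => (hSω t).aemeasurable]
    _ ≤ ∑' t : {t : ℕ // n ≤ t}, (∫⁻ k, (k : ℝ≥0∞) ∂ρ) * (s' * g t *
        (q * (2 * eLpNorm (fun ω => xiSup G (κ ω) f b (t : ℕ)) 2 P))) :=
        ENNReal.tsum_le_tsum hShell
    _ = _ := by
        rw [← ENNReal.tsum_mul_left, ← ENNReal.tsum_mul_left]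
        exact tsum_congr fun t => by ring

lemma lintegral_annulusCost_le {b : ℕ} (hb : 1 ≤ b) {r : ℝ} {s : ℝ≥0∞}
    (hs : ∀ p ∈ A, ν (Metric.closedBall p r) ≤ s) :
    ∫⁻ ω, ∫⁻ θ, annulusCost (κ ω) (fun (φ : G) x => f (φ • x)) b r θ ∂(sampleLaw ν ρ) ∂P
      ≤ (∫⁻ k, (k : ℝ≥0∞) ∂ρ) * (s * (q * q) + s' * q *
        ∑' t : {t : ℕ // b ≤ t}, g t * eLpNorm (fun ω => psiSup G (κ ω) f (t : ℕ)) 2 P) := by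
  set h : G → 𝒳 → ℕ := fun φ x => f (φ • x) with hdef
  set T : ℕ → Ω → Sample G → ℝ≥0∞ := fun i ω θ =>
    hitProb (κ ω) h θ.1 * hitProb (κ ω) h (θ.2.1 i).1 with hT
  set V : ℕ → Ω → Sample G → ℝ≥0∞ := fun i ω θ =>
    pairProb (κ ω) h θ.1 (θ.2.1 i).1 - T i ω θ with hV
  have hTm (i) : Measurable fun y : Ω × Sample G => T i y.1 y.2 :=
    (measurable_hitProb_comp hh κ (by fun_prop) (by fun_prop)).mul
      (measurable_hitProb_comp hh κ (by fun_prop) (by fun_prop))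
  have hVm (i) : Measurable fun y : Ω × Sample G => V i y.1 y.2 :=
    (measurable_pairProb_comp hh κ (by fun_prop) (by fun_prop) (by fun_prop)).sub (hTm i)
  set U : Ω → Sample G → ℝ≥0∞ := fun ω θ => ∑ i ∈ Finset.range θ.2.2,
    if (b : ℝ) < dist θ.1 (θ.2.1 i).1 ∧ dist θ.1 (θ.2.1 i).1 ≤ r then T i ω θ else 0 with hU
  set S : {t : ℕ // b ≤ t} → Ω → Sample G → ℝ≥0∞ := fun t ω θ => ∑ i ∈ Finset.range θ.2.2,
    if ((t : ℕ) : ℝ) < dist θ.1 (θ.2.1 i).1 ∧ dist θ.1 (θ.2.1 i).1 ≤ ((t : ℕ) + 1 : ℕ)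
      then V i ω θ else 0 with hS
  have hUm : Measurable fun y : Ω × Sample G => U y.1 y.2 := by
    refine measurable_sum_finset Finset.range (fun i => ?_) (by fun_prop)
    refine Measurable.ite ?_ (hTm i) measurable_const
    exact (measurableSet_lt_dist (by fun_prop) (by fun_prop) _).inter
      (measurableSet_dist_le (by fun_prop) (by fun_prop) _)
  have hSm (t) : Measurable fun y : Ω × Sample G => S t y.1 y.2 := by
    refine measurable_sum_finset Finset.range (fun i => ?_) (by fun_prop)
    refine Measurable.ite ?_ (hVm i) measurable_const
    exact (measurableSet_lt_dist (by fun_prop) (by fun_prop) _).inter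
      (measurableSet_dist_le (by fun_prop) (by fun_prop) _)
  have hUle : ∫⁻ ω, ∫⁻ θ, U ω θ ∂(sampleLaw ν ρ) ∂P
      ≤ (∫⁻ k, (k : ℝ≥0∞) ∂ρ) * (s * (q * q)) :=
    lintegral_shell_le P ν ρ hA (f := T) hTm
      (fun i θ h1 h2 _ => lintegral_hitProb_mul_le hh P κ hq h1 (h2 i).1)
      fun p hp => (measure_mono Set.sdiff_subset).trans (hs p hp)
  have hShell (t : {t : ℕ // b ≤ t}) : ∫⁻ ω, ∫⁻ θ, S t ω θ ∂(sampleLaw ν ρ) ∂P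
      ≤ (∫⁻ k, (k : ℝ≥0∞) ∂ρ) * (s' * g t *
        (q * eLpNorm (fun ω => psiSup G (κ ω) f (t : ℕ)) 2 P)) := by
    refine lintegral_shell_le P ν ρ hA (f := V) hVm
      (fun i θ h1 _ h3 => ?_) (fun p hp => hg p hp t (hb.trans t.2))
    have hm : Measurable fun ω => V i ω θ := (hVm i).comp (measurable_prodMk_right (y := θ))
    refine (lintegral_le_of_le_mul P hm
      (measurable_hitProb_comp hh κ measurable_id measurable_const (p := fun _ => θ.1))
      (fun ω => measure_ne_top _ _)
      fun ω => pairProb_sub_le_psi (κ ω) h3.le (measurableSet_hit hh θ.1)).trans ?_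
    gcongr
    exact hq _ h1
  have hpt (ω) (θ : Sample G) : annulusCost (κ ω) h b r θ ≤ U ω θ + ∑' t, S t ω θ := by
    have h1 : annulusCost (κ ω) h b r θ ≤ U ω θ + ∑ i ∈ Finset.range θ.2.2,
        if (b : ℝ) < dist θ.1 (θ.2.1 i).1 then V i ω θ else 0 := by
      rw [annulusCost, hU, ← Finset.sum_add_distrib]
      refine Finset.sum_le_sum fun i _ => ?_
      by_cases hi : (b : ℝ) < dist θ.1 (θ.2.1 i).1 ∧ dist θ.1 (θ.2.1 i).1 ≤ r
      · rw [if_pos hi, if_pos hi, if_pos hi.1]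
        exact le_add_tsub
      · rw [if_neg hi]; exact zero_le
    refine h1.trans ?_
    gcongr
    rw [hS, Summable.tsum_finsetSum fun _ _ => ENNReal.summable]
    refine Finset.sum_le_sum fun i _ => ?_
    split_ifs with hi
    · have hpos : 0 < dist θ.1 (θ.2.1 i).1 := lt_of_le_of_lt (Nat.cast_nonneg b) hi
      obtain ⟨u, hu⟩ : ∃ u, ⌈dist θ.1 (θ.2.1 i).1⌉₊ = u + 1 :=
        Nat.exists_eq_succ_of_ne_zero (Nat.ceil_pos.2 hpos).ne'
      have hu1 : (u : ℝ) < dist θ.1 (θ.2.1 i).1 := Nat.lt_ceil.1 (by omega)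
      have hu2 : dist θ.1 (θ.2.1 i).1 ≤ (u + 1 : ℕ) := hu ▸ Nat.le_ceil _
      have hbu : b ≤ u := by
        have : (b : ℝ) < (u + 1 : ℕ) := hi.trans_le hu2
        have : b < u + 1 := by exact_mod_cast this
        omega
      refine le_trans (le_of_eq ?_) (ENNReal.le_tsum (⟨u, hbu⟩ : {t : ℕ // b ≤ t}))
      rw [if_pos ⟨hu1, hu2⟩]
    · exact zero_le
  calc ∫⁻ ω, ∫⁻ θ, annulusCost (κ ω) h b r θ ∂(sampleLaw ν ρ) ∂P
      ≤ ∫⁻ ω, ∫⁻ θ, (U ω θ + ∑' t, S t ω θ) ∂(sampleLaw ν ρ) ∂P :=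
        lintegral_mono fun ω => lintegral_mono fun θ => hpt ω θ
    _ = ∫⁻ ω, ∫⁻ θ, U ω θ ∂(sampleLaw ν ρ) ∂P
        + ∑' t, ∫⁻ ω, ∫⁻ θ, S t ω θ ∂(sampleLaw ν ρ) ∂P := by
        rw [← lintegral_tsum fun t => ((hSm t).lintegral_prod_right').aemeasurable,
          ← lintegral_add_left hUm.lintegral_prod_right']
        refine lintegral_congr fun ω => ?_
        have hSω (t) : Measurable (S t ω) := (hSm t).comp measurable_prodMk_left
        have hUω : Measurable (U ω) := hUm.comp measurable_prodMk_left
        rw [lintegral_add_left hUω, lintegral_tsum fun t => (hSω t).aemeasurable]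
    _ ≤ (∫⁻ k, (k : ℝ≥0∞) ∂ρ) * (s * (q * q))
        + ∑' t : {t : ℕ // b ≤ t}, (∫⁻ k, (k : ℝ≥0∞) ∂ρ) * (s' * g t *
        (q * eLpNorm (fun ω => psiSup G (κ ω) f (t : ℕ)) 2 P)) :=
        add_le_add hUle (ENNReal.tsum_le_tsum hShell)
    _ = _ := by
        rw [ENNReal.tsum_mul_left, ← mul_add, ← ENNReal.tsum_mul_left]
        congr 2
        exact tsum_congr fun t => by ring

/-- The mean distance between the law of the number of hits and its compound Poisson
approximation. -/
theorem lintegral_tvDist_hitLaw_le (hbin : ∀ x, f x = 0 ∨ f x = 1) {b : ℕ} (hb : 1 ≤ b)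
    {s₁ s₂ : ℝ≥0∞} (hs₁ : ∀ p ∈ A, ν (Metric.closedBall p b) ≤ s₁)
    (hs₂ : ∀ p ∈ A, ν (Metric.closedBall p (2 * b : ℕ)) ≤ s₂)
    (l e m : ℕ) {c : ℝ≥0∞} (hc : c ≠ ∞)
    (hρ : ∀ k : ℕ, ((k + 1 : ℕ) : ℝ≥0∞) * ρ.map (· + e) {k + 1} = c * ρ {k})
    {R : Ω → ℕ → ℝ≥0} {D : ℝ}
    (hR : ∀ᵐ ω ∂P, Summable (R ω) ∧ R ω 0 = 0 ∧ ∑' k, (R ω k : ℝ) ≤ D ∧ ∀ k : ℕ, (k : ℝ≥0∞) * R ω k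
      = m * clusterProb (κ ω) (fun (φ : G) x => f (φ • x)) ν b l k) :
    ∫⁻ ω, ENNReal.ofReal (tvDist (hitLaw (κ ω) (fun (φ : G) x => f (φ • x)) ν (ρ.map (· + e)))
        (compoundPoisson (R ω))) ∂P ≤
      2 * ENNReal.ofReal (Real.exp D) *
        (c * ((∫⁻ k, (k : ℝ≥0∞) ∂ρ) * (5 * 2 * s₂ * (q * q)
            + 2 * s' * q * ((∑' t : {t : ℕ // b ≤ t},
                g t * eLpNorm (fun ω => psiSup G (κ ω) f (t : ℕ)) 2 P)
              + ∑' t : {t : ℕ // 2 * b ≤ t},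
                g t * eLpNorm (fun ω => xiSup G (κ ω) f b (t : ℕ)) 2 P))
          + 2 * (∫⁻ k, ((max k l - min k l : ℕ) : ℝ≥0∞) ∂ρ) * (s₁ * q) + 2 * e * (q * q))
        + ((c - m) + (m - c)) * q) := by
  set h : G → 𝒳 → ℕ := fun φ x => f (φ • x) with hdef
  have hbr : (b : ℝ) ≤ (2 * b : ℕ) := by exact_mod_cast (by omega : b ≤ 2 * b)
  have m1 := (measurable_annulusCost hh κ b (2 * b : ℕ)).lintegral_prod_right' (ν := sampleLaw ν ρ)
  have m2 := (measurable_mixCost hh κ b (2 * b : ℕ)).lintegral_prod_right' (ν := sampleLaw ν ρ)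
  have m3 := (measurable_nearCost hh κ measurable_fst (2 * b : ℕ)).lintegral_prod_right'
    (ν := sampleLaw ν ρ)
  have m4 := (measurable_nearCost hh κ measurable_snd (2 * b : ℕ)).lintegral_prod_right'
    (ν := sampleLaw ν ρ)
  have m5 := (measurable_sizeCost hh κ b l).lintegral_prod_right' (ν := sampleLaw ν ρ)
  have m6 := (measurable_extraCost hh κ e).lintegral_prod_right' (ν := sampleLaw ν ρ)
  have m7' : Measurable fun y : Ω × Sample G => hitProb (κ y.1) h y.2.1 :=
    measurable_hitProb_comp hh κ (by fun_prop) (by fun_prop)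
  have m7 := m7'.lintegral_prod_right' (ν := sampleLaw ν ρ)
  have b1 := lintegral_annulusCost_le hh P κ ν ρ hA hq hg hb hs₂
  have b2 := lintegral_mixCost_le hh P κ ν ρ hA hq hg b (n := 2 * b) (by omega)
  have b3 := lintegral_nearCost_le hh P κ ν ρ hA hq measurable_fst (fun y h1 _ => h1) hs₂
  have b4 := lintegral_nearCost_le hh P κ ν ρ hA hq measurable_snd (fun y _ h1 => h1) hs₂
  have b5 := lintegral_sizeCost_le hh P κ ν ρ hA hq (l := l) hs₁
  have b6 := lintegral_extraCost_le hh P κ ν ρ hA hq e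
  have b7 := lintegral_base_hitProb_le hh P κ ν ρ hA hq
  have hm : (m : ℝ≥0∞) ≠ ∞ := ENNReal.natCast_ne_top m
  have hcm : (c - m) + (m - c) ≠ ∞ :=
    ENNReal.add_ne_top.2 ⟨ENNReal.sub_ne_top hc, ENNReal.sub_ne_top hm⟩
  have step : ∫⁻ ω, ENNReal.ofReal (tvDist (hitLaw (κ ω) h ν (ρ.map (· + e)))
        (compoundPoisson (R ω))) ∂P ≤ ∫⁻ ω, 2 * ENNReal.ofReal (Real.exp D) *
        (c * ((2 * ∫⁻ θ, annulusCost (κ ω) h b (2 * b : ℕ) θ ∂(sampleLaw ν ρ)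
          + ∫⁻ θ, mixCost (κ ω) h b (2 * b : ℕ) θ ∂(sampleLaw ν ρ))
          + (2 * ∫⁻ θ, nearCost (κ ω) h Prod.fst (2 * b : ℕ) θ ∂(sampleLaw ν ρ)
          + 2 * ∫⁻ θ, nearCost (κ ω) h Prod.snd (2 * b : ℕ) θ ∂(sampleLaw ν ρ))
          + (2 * ∫⁻ θ, sizeCost (κ ω) h b l θ ∂(sampleLaw ν ρ)
          + 2 * ∫⁻ θ, extraCost (κ ω) h e θ ∂(sampleLaw ν ρ)))
        + ((c - m) + (m - c)) * ∫⁻ θ, hitProb (κ ω) h θ.1 ∂(sampleLaw ν ρ)) ∂P := by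
    refine lintegral_mono_ae ?_
    filter_upwards [hR] with ω ⟨r1, r2, r3, r4⟩
    refine (tvDist_hitLaw_le hh (fun p x => hbin _) (κ ω) ν ρ hbr l e m hc hρ r1 r2 r4).trans ?_
    gcongr
  refine step.trans ?_
  have M1 := m1.const_mul 2
  have M3 := m3.const_mul 2
  have M4 := m4.const_mul 2
  have M5 := m5.const_mul 2
  have M6 := m6.const_mul 2
  have M12 := M1.add m2
  have M34 := M3.add M4
  have M56 := M5.add M6
  have M14 := M12.add M34
  have M16 := M14.add M56
  have N := M16.const_mul c
  have N' := N.add (m7.const_mul ((c - m) + (m - c)))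
  simp only [Pi.add_apply] at M12 M34 M56 M14 M16 N N'
  rw [lintegral_const_mul _ (by exact N'), lintegral_add_left (by exact N),
    lintegral_const_mul _ (by exact M16), lintegral_add_left (by exact M14),
    lintegral_add_left (by exact M12), lintegral_add_left (by exact M1),
    lintegral_add_left (by exact M3), lintegral_add_left (by exact M5),
    lintegral_const_mul _ (by exact m1), lintegral_const_mul _ (by exact m3),
    lintegral_const_mul _ (by exact m4), lintegral_const_mul _ (by exact m5),
    lintegral_const_mul _ (by exact m6), lintegral_const_mul _ (by exact m7)]
  refine mul_le_mul_right (add_le_add (mul_le_mul_right ((add_le_add (add_le_add (add_le_add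
    (mul_le_mul_right b1 2) b2) (add_le_add (mul_le_mul_right b3 2) (mul_le_mul_right b4 2)))
    (add_le_add (mul_le_mul_right b5 2) (mul_le_mul_right b6 2))).trans (le_of_eq ?_)) _)
    (mul_le_mul_right b7 _)) _
  ring

end AverageMixing

/-! ### Conditional laws of functions of the configuration and an independent variable -/

lemma condDistrib_comp_indep {Ω β 𝒳 Z S : Type*} {mΩ : MeasurableSpace Ω} {mβ : MeasurableSpace β}
    [MeasurableSpace 𝒳] [StandardBorelSpace 𝒳] [Nonempty 𝒳] [MeasurableSpace Z]
    [MeasurableSpace S] [StandardBorelSpace S] [Nonempty S]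
    {P : Measure Ω} [IsProbabilityMeasure P] {X : Ω → 𝒳} {ζ : Ω → Z} {g : 𝒳 → β} {F : 𝒳 × Z → S}
    (hX : Measurable X) (hζ : Measurable ζ) (hg : Measurable g) (hF : Measurable F)
    (hXζ : IndepFun X ζ P) :
    ∀ᵐ ω ∂P, condDistrib (fun ω => F (X ω, ζ ω)) (fun ω => g (X ω)) P (g (X ω))
      = ((condDistrib X (fun ω => g (X ω)) P (g (X ω))).prod (P.map ζ)).map F := by
  have hgX : Measurable fun ω => g (X ω) := hg.comp hX
  have : IsProbabilityMeasure (P.map ζ) := Measure.isProbabilityMeasure_map hζ.aemeasurable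
  set κ := condDistrib X (fun ω => g (X ω)) P with hκ
  have hY : Measurable fun ω => F (X ω, ζ ω) := hF.comp (hX.prodMk hζ)
  have : IsMarkovKernel ((κ ×ₖ Kernel.const β (P.map ζ)).map F) := Kernel.IsMarkovKernel.map _ hF
  have key : P.map (fun ω => (g (X ω), F (X ω, ζ ω)))
      = P.map (fun ω => g (X ω)) ⊗ₘ ((κ ×ₖ Kernel.const β (P.map ζ)).map F) := by
    refine Measure.ext_of_lintegral _ fun u hu => ?_
    have h1 (y : β) : ∫⁻ s, u (y, s) ∂((κ ×ₖ Kernel.const β (P.map ζ)).map F y)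
        = ∫⁻ x, ∫⁻ z, u (y, F (x, z)) ∂(P.map ζ) ∂(κ y) := by
      have huy : Measurable fun s => u (y, s) := hu.comp measurable_prodMk_left
      rw [Kernel.map_apply _ hF, lintegral_map huy hF,
        Kernel.lintegral_prod _ _ _ (by fun_prop)]
      rfl
    have hm : Measurable fun q : β × 𝒳 => ∫⁻ z, u (q.1, F (q.2, z)) ∂(P.map ζ) :=
      Measurable.lintegral_prod_right' (f := fun r : (β × 𝒳) × Z => u (r.1.1, F (r.1.2, r.2)))
        (by fun_prop)
    have hm' : Measurable fun q : 𝒳 × Z => u (g q.1, F q) := by fun_prop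
    calc ∫⁻ q, u q ∂(P.map fun ω => (g (X ω), F (X ω, ζ ω)))
        = ∫⁻ ω, u (g (X ω), F (X ω, ζ ω)) ∂P := lintegral_map hu (hgX.prodMk hY)
      _ = ∫⁻ q, u (g q.1, F q) ∂(P.map fun ω => (X ω, ζ ω)) :=
          (lintegral_map hm' (hX.prodMk hζ)).symm
      _ = ∫⁻ x, ∫⁻ z, u (g x, F (x, z)) ∂(P.map ζ) ∂(P.map X) := by
          rw [(indepFun_iff_map_prod_eq_prod_map_map hX.aemeasurable hζ.aemeasurable).1 hXζ,
            lintegral_prod _ hm'.aemeasurable]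
      _ = ∫⁻ ω, ∫⁻ z, u (g (X ω), F (X ω, z)) ∂(P.map ζ) ∂P :=
          lintegral_map (hm'.lintegral_prod_right') hX
      _ = ∫⁻ q, ∫⁻ z, u (q.1, F (q.2, z)) ∂(P.map ζ) ∂(P.map fun ω => (g (X ω), X ω)) :=
          (lintegral_map hm (hgX.prodMk hX)).symm
      _ = ∫⁻ y, ∫⁻ x, ∫⁻ z, u (y, F (x, z)) ∂(P.map ζ) ∂(κ y) ∂(P.map fun ω => g (X ω)) := by
          rw [← compProd_map_condDistrib hX.aemeasurable, Measure.lintegral_compProd hm]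
      _ = _ := by
          rw [Measure.lintegral_compProd hu]
          exact lintegral_congr fun y => (h1 y).symm
  have h2 := condDistrib_ae_eq_of_measure_eq_compProd_of_measurable hgX hY key
  filter_upwards [ae_of_ae_map hgX.aemeasurable h2] with ω hω
  rw [hω, Kernel.map_apply _ hF, Kernel.prod_apply, Kernel.const_apply]

section CondLaw

variable {G 𝒳 Ω : Type*} [Group G] [MeasurableSpace 𝒳] [StandardBorelSpace 𝒳] [Nonempty 𝒳]
  [MulAction G 𝒳] [MeasurableSpace Ω] (P : Measure Ω) [IsProbabilityMeasure P] {X : Ω → 𝒳}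

variable (G 𝒳) in
lemma invariantSigma_le : invariantSigma G 𝒳 ≤ ‹MeasurableSpace 𝒳› :=
  iInf_le_of_le 1 (MeasurableSpace.invariants_le _)

lemma condLaw_comp_indep {Z S : Type*} [MeasurableSpace Z] [MeasurableSpace S]
    [StandardBorelSpace S] [Nonempty S] {ζ : Ω → Z} {F : 𝒳 × Z → S} (hX : Measurable X)
    (hζ : Measurable ζ) (hF : Measurable F) (hXζ : IndepFun X ζ P) :
    ∀ᵐ ω ∂P, condLaw G P X (fun ω => F (X ω, ζ ω)) (X ω)
      = ((condLaw G P X X (X ω)).prod (P.map ζ)).map F :=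
  condDistrib_comp_indep (mβ := invariantSigma G 𝒳) (g := id) hX hζ
    (measurable_id'' (invariantSigma_le G 𝒳)) hF hXζ

/-- The conditional law of the configuration as a kernel on the underlying probability space. -/
def condKernel (G : Type*) [Group G] [MulAction G 𝒳] (hX : Measurable X) : Kernel Ω 𝒳 where
  toFun ω := condLaw G P X X (X ω)
  measurable' := by
    have h1 : @Measurable Ω 𝒳 _ (invariantSigma G 𝒳) X :=
      (measurable_id'' (invariantSigma_le G 𝒳)).comp hX
    exact Measurable.comp (@Kernel.measurable _ _ (invariantSigma G 𝒳) _
      (@condDistrib _ _ _ _ _ _ _ (invariantSigma G 𝒳) X X P _)) h1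

lemma condKernel_apply (hX : Measurable X) (ω : Ω) :
    condKernel P G hX ω = condLaw G P X X (X ω) := rfl

instance isMarkovKernel_condKernel (hX : Measurable X) : IsMarkovKernel (condKernel P G hX) where
  isProbabilityMeasure ω := by
    rw [condKernel_apply, condLaw]
    infer_instance

end CondLaw

section HitLawMean

variable {G 𝒳 : Type*} [MetricSpace G] [MeasurableSpace G] [MeasurableSpace 𝒳]
  {h : G → 𝒳 → ℕ} (hh : Measurable (Function.uncurry h)) (hb : ∀ p x, h p x = 0 ∨ h p x = 1)
  [SecondCountableTopology G] [OpensMeasurableSpace G]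
  (κ : Measure 𝒳) [IsProbabilityMeasure κ] (ν : Measure G) [IsProbabilityMeasure ν]
  (ρ : Measure ℕ) [IsProbabilityMeasure ρ]

include hh

lemma lintegral_sampleLaw_hitProb :
    ∫⁻ θ, hitProb κ h θ.1 ∂(sampleLaw ν ρ) = ∫⁻ p, hitProb κ h p ∂ν := by
  have hm : Measurable fun θ : Sample G => hitProb κ h θ.1 :=
    (measurable_hitProb hh κ).comp measurable_fst
  rw [lintegral_sampleLaw ν ρ hm]
  simp

lemma tsum_clusterProb (b : ℝ) (l : ℕ) :
    ∑' k, clusterProb κ h ν b l k = ∫⁻ p, hitProb κ h p ∂ν := by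
  have hS (k : ℕ) : MeasurableSet {t : (G × (ℕ → G)) × 𝒳 |
      h t.1.1 t.2 = 1 ∧ nearCount h b l t.1.1 t.1.2 t.2 = k} :=
    (measurable_hit hh (by fun_prop) (by fun_prop) (measurableSet_singleton 1)).inter
      (measurable_nearCount hh b measurable_const (by fun_prop) (by fun_prop) (by fun_prop)
        (measurableSet_singleton k))
  have hm (k : ℕ) : Measurable fun q : G × (ℕ → G) =>
      κ {x | h q.1 x = 1 ∧ nearCount h b l q.1 q.2 x = k} :=
    measurable_measure_prodMk_left (ν := κ) (hS k)
  have hmp (p : G) (k : ℕ) : Measurable fun φ : ℕ → G =>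
      κ {x | h p x = 1 ∧ nearCount h b l p φ x = k} := (hm k).comp measurable_prodMk_left
  unfold clusterProb
  rw [← lintegral_tsum fun k => (hm k).lintegral_prod_right'.aemeasurable]
  refine lintegral_congr fun p => ?_
  rw [← lintegral_tsum fun k => (hmp p k).aemeasurable]
  have h1 (φ : ℕ → G) : ∑' k, κ {x | h p x = 1 ∧ nearCount h b l p φ x = k} = hitProb κ h p :=
    tsum_measure_inter_fiber κ (measurableSet_hit hh p)
      (measurable_nearCount hh b measurable_const measurable_const measurable_const measurable_id)
  simp [h1]

lemma clusterProb_eq (b : ℝ) (l k : ℕ) (hb0 : 0 ≤ b) :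
    clusterProb κ h ν b l k = (κ.prod (seqLaw ν)) {y | h (y.2 0) y.1 = 1 ∧
      ∑ i ∈ Finset.range (l + 1) with dist (y.2 0) (y.2 i) ≤ b, h (y.2 i) y.1 = k} := by
  have hsum (p : G) (φ : ℕ → G) (x : 𝒳) :
      ∑ i ∈ Finset.range (l + 1) with dist (consSeq p φ 0) (consSeq p φ i) ≤ b,
        h (consSeq p φ i) x = nearCount h b l p φ x := by
    rw [Finset.sum_filter, Finset.sum_range_succ', nearCount, Finset.sum_filter, add_comm]
    simp only [consSeq_zero, consSeq_succ, dist_self, if_pos hb0]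
    exact congrArg (h p x + ·) (Finset.sum_congr rfl fun i _ => if_congr Iff.rfl rfl rfl)
  have hm : MeasurableSet {y : 𝒳 × (ℕ → G) | h (y.2 0) y.1 = 1 ∧
      ∑ i ∈ Finset.range (l + 1) with dist (y.2 0) (y.2 i) ≤ b, h (y.2 i) y.1 = k} := by
    have h1 : Measurable fun y : 𝒳 × (ℕ → G) => h (y.2 0) y.1 :=
      measurable_hit hh (by fun_prop) (by fun_prop)
    have h2 : Measurable fun y : 𝒳 × (ℕ → G) =>
        ∑ i ∈ Finset.range (l + 1) with dist (y.2 0) (y.2 i) ≤ b, h (y.2 i) y.1 := by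
      simp only [Finset.sum_filter]
      refine Finset.measurable_fun_sum _ fun i _ => ?_
      exact Measurable.ite (measurableSet_dist_le (by fun_prop) (by fun_prop) b)
        (measurable_hit hh (by fun_prop) (by fun_prop)) measurable_const
    exact (h1 (measurableSet_singleton 1)).inter (h2 (measurableSet_singleton k))
  rw [Measure.prod_apply_symm hm, clusterProb]
  have hm2 := measurable_measure_prodMk_right (μ := κ) hm
  conv_rhs => rw [← prod_map_consSeq ν]
  rw [lintegral_map hm2 (measurable_consSeq (α := G))]
  refine Eq.trans ?_ (lintegral_prod _ (hm2.comp (measurable_consSeq (α := G))).aemeasurable).symm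
  refine lintegral_congr fun p => lintegral_congr fun φ => ?_
  congr 1
  ext x
  simp only [Set.mem_ofPred_eq, Set.mem_preimage, ← hsum, consSeq_zero]

include hb

lemma lintegral_hitLaw {ρJ : Measure ℕ} [IsProbabilityMeasure ρJ] {c : ℝ≥0∞}
    (hρ : ∀ k : ℕ, ((k + 1 : ℕ) : ℝ≥0∞) * ρJ {k + 1} = c * ρ {k}) :
    ∫⁻ w, (w : ℝ≥0∞) ∂(hitLaw κ h ν ρJ) = c * ∫⁻ p, hitProb κ h p ∂ν := by
  rw [lintegral_countable']
  simp only [mul_hitLaw_singleton hh hb κ ν ρ hρ]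
  rw [ENNReal.tsum_mul_left, ← lintegral_tsum fun w =>
    (measurable_countLaw hh κ (measurable_fullCount hh) w).aemeasurable,
    ← lintegral_sampleLaw_hitProb hh κ ν ρ]
  congr 1
  exact lintegral_congr fun θ => tsum_countLaw hh hb κ (measurable_fullCount hh) θ

lemma clusterProb_zero (b : ℝ) (l : ℕ) : clusterProb κ h ν b l 0 = 0 := by
  have h1 (p : G) (φ : ℕ → G) : {x | h p x = 1 ∧ nearCount h b l p φ x = 0} = ∅ := by
    ext x
    simp only [nearCount, Set.mem_ofPred_eq, Set.mem_empty_iff_false, iff_false]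
    omega
  simp [clusterProb, h1]

end HitLawMean

section Identification

variable {G 𝒳 Ω : Type*} [Group G] [MetricSpace G] [MeasurableSpace G] [BorelSpace G]
  [SecondCountableTopology G] [MeasurableSpace 𝒳] [StandardBorelSpace 𝒳] [Nonempty 𝒳]
  [MulAction G 𝒳] [MeasurableSMul₂ G 𝒳] [MeasurableSpace Ω] {P : Measure Ω}
  [IsProbabilityMeasure P] {X : Ω → 𝒳} {f : 𝒳 → ℕ} {ν : Measure G} [IsProbabilityMeasure ν]
  {Φ : ℕ → Ω → G} {J : Ω → ℕ} (hX : Measurable X) (hf : Measurable f)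
  (hΦ : ∀ i, Measurable (Φ i)) (hlaw : ∀ i, P.map (Φ i) = ν) (hind : iIndepFun Φ P)

variable (G) in
lemma measurable_uncurry_comp_smul {f : 𝒳 → ℕ} (hf : Measurable f) :
    Measurable (Function.uncurry fun (φ : G) (x : 𝒳) => f (φ • x)) :=
  hf.comp measurable_smul

include hΦ hlaw hind in
lemma map_sample_eq_seqLaw : P.map (fun ω i => Φ i ω) = seqLaw ν := by
  rw [hind.map_fun_eq_infinitePi_map hΦ]
  simp only [hlaw]

include hf hΦ hlaw hind

lemma condLaw_randomSum (hJ : Measurable J) (hJΦ : IndepFun J (fun ω i => Φ i ω) P)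
    (hXζ : IndepFun X (fun ω => (J ω, fun i => Φ i ω)) P) :
    ∀ᵐ ω ∂P, condLaw G P X (randomSum X f Φ J) (X ω)
      = hitLaw (condKernel P G hX ω) (fun (φ : G) x => f (φ • x)) ν (P.map J) := by
  have hΦm : Measurable fun ω i => Φ i ω := measurable_pi_lambda _ hΦ
  have h1 := condLaw_comp_indep (G := G) P hX (hJ.prodMk hΦm)
    (measurable_hitCount_triple (measurable_uncurry_comp_smul G hf)) hXζ
  rw [(indepFun_iff_map_prod_eq_prod_map_map hJ.aemeasurable hΦm.aemeasurable).1 hJΦ,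
    map_sample_eq_seqLaw hΦ hlaw hind] at h1
  exact h1

lemma condLaw_cluster (hXΦ : IndepFun X (fun ω i => Φ i ω) P) (b l : ℕ) :
    ∀ᵐ ω ∂P, ∀ k, condLaw G P X (fun ω => (f (Φ 0 ω • X ω), nearbyHits X f Φ b (l + 1) ω)) (X ω)
      {(1, k)} = clusterProb (condKernel P G hX ω) (fun (φ : G) x => f (φ • x)) ν b l k := by
  have hΦm : Measurable fun ω i => Φ i ω := measurable_pi_lambda _ hΦ
  have hh := measurable_uncurry_comp_smul G hf
  set F : 𝒳 × (ℕ → G) → ℕ × ℕ := fun y => (f (y.2 0 • y.1),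
    ∑ i ∈ Finset.range (l + 1) with dist (y.2 0) (y.2 i) ≤ b, f (y.2 i • y.1)) with hF
  have hFm : Measurable F := by
    refine Measurable.prodMk (measurable_hit hh (by fun_prop) (by fun_prop)) ?_
    simp only [Finset.sum_filter]
    refine Finset.measurable_fun_sum _ fun i _ => ?_
    exact Measurable.ite (measurableSet_dist_le (by fun_prop) (by fun_prop) b)
      (measurable_hit hh (by fun_prop) (by fun_prop)) measurable_const
  have h1 := condLaw_comp_indep (G := G) P hX hΦm hFm hXΦ
  rw [map_sample_eq_seqLaw hΦ hlaw hind] at h1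
  filter_upwards [h1] with ω hω k
  rw [clusterProb_eq hh _ ν b l k (Nat.cast_nonneg b)]
  refine (congrArg (fun μ : Measure (ℕ × ℕ) => μ {(1, k)}) hω).trans ?_
  rw [Measure.map_apply hFm (measurableSet_singleton _), condKernel_apply]
  congr 1
  ext y
  simp [hF, Prod.ext_iff]

/-- The rates of the compound Poisson approximation, in terms of the conditional law of the
configuration. -/
lemma clusterRate_spec (hbin : ∀ x, f x = 0 ∨ f x = 1) (hXΦ : IndepFun X (fun ω i => Φ i ω) P)
    (b m : ℕ) {D : ℝ} (hD : 0 ≤ D)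
    (hbound : ∀ᵐ ω ∂P, m * ∫⁻ p, hitProb (condKernel P G hX ω) (fun (φ : G) x => f (φ • x)) p ∂ν
      ≤ ENNReal.ofReal D) :
    ∀ᵐ ω ∂P, Summable (fun k => (m : ℝ≥0) * clusterRate P X f Φ b m (X ω) k)
      ∧ (m : ℝ≥0) * clusterRate P X f Φ b m (X ω) 0 = 0
      ∧ ∑' k, (((m : ℝ≥0) * clusterRate P X f Φ b m (X ω) k : ℝ≥0) : ℝ) ≤ D
      ∧ ∀ k : ℕ, (k : ℝ≥0∞) * ((m : ℝ≥0) * clusterRate P X f Φ b m (X ω) k : ℝ≥0)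
        = m * clusterProb (condKernel P G hX ω) (fun (φ : G) x => f (φ • x)) ν b (m - 1) k := by
  have hh := measurable_uncurry_comp_smul G hf
  rcases m.eq_zero_or_pos with rfl | hm
  · refine ae_of_all _ fun ω => ⟨?_, ?_, ?_, ?_⟩
    · simp
    · simp
    · simpa using hD
    · simp
  obtain ⟨l, rfl⟩ := Nat.exists_eq_succ_of_ne_zero hm.ne'
  filter_upwards [condLaw_cluster hX hf hΦ hlaw hind hXΦ b l, hbound] with ω hω hωD
  set κ := condKernel P G hX ω
  set h : G → 𝒳 → ℕ := fun φ x => f (φ • x)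
  set R : ℕ → ℝ≥0 := fun k => ((l + 1 : ℕ) : ℝ≥0) * clusterRate P X f Φ b (l + 1) (X ω) k with hR
  have hR0 : R 0 = 0 := by simp [hR, clusterRate]
  have hsum := tsum_clusterProb hh κ ν b l
  have hfin (k : ℕ) : clusterProb κ h ν b l k ≠ ∞ := by
    rw [← hω k]
    have h1 : clusterProb κ h ν b l k ≤ 1 := by
      refine (ENNReal.le_tsum k).trans (hsum.le.trans ?_)
      calc ∫⁻ p, hitProb κ h p ∂ν ≤ ∫⁻ _, 1 ∂ν := lintegral_mono fun p => prob_le_one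
        _ = 1 := by simp
    rw [hω k]
    exact ne_top_of_le_ne_top ENNReal.one_ne_top h1
  have hRk (k : ℕ) : (k : ℝ≥0∞) * R k = (l + 1 : ℕ) * clusterProb κ h ν b l k := by
    rcases k.eq_zero_or_pos with rfl | hk
    · rw [hR0, clusterProb_zero hh fun p x => hbin _]
      simp
    · rw [hR]
      simp only [clusterRate, hω k, ENNReal.coe_mul, ENNReal.coe_natCast]
      rw [ENNReal.coe_toNNReal (hfin k), ENNReal.coe_inv (by positivity), ENNReal.coe_natCast]
      calc (k : ℝ≥0∞) * ((l + 1 : ℕ) * ((k : ℝ≥0∞)⁻¹ * clusterProb κ h ν b l k))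
          = (k * (k : ℝ≥0∞)⁻¹) * ((l + 1 : ℕ) * clusterProb κ h ν b l k) := by ring
        _ = _ := by
          rw [ENNReal.mul_inv_cancel (by positivity) (ENNReal.natCast_ne_top k), one_mul]
  have hle : ∑' k, (R k : ℝ≥0∞) ≤ ENNReal.ofReal D := by
    refine le_trans ?_ hωD
    rw [← hsum, ← ENNReal.tsum_mul_left]
    refine ENNReal.tsum_le_tsum fun k => ?_
    rw [← hRk k]
    rcases k.eq_zero_or_pos with rfl | hk
    · simp [hR0]
    · exact le_mul_of_one_le_left zero_le (by exact_mod_cast hk)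
  have hRs : Summable R := ENNReal.tsum_coe_ne_top_iff_summable.1
    (ne_top_of_le_ne_top ENNReal.ofReal_ne_top hle)
  refine ⟨hRs, hR0, ?_, hRk⟩
  rw [← ENNReal.coe_tsum hRs] at hle
  have := ENNReal.toReal_mono ENNReal.ofReal_ne_top hle
  rwa [ENNReal.toReal_ofReal hD, ENNReal.coe_toReal, NNReal.coe_tsum] at this

end Identification

/-! ### Moments of Poisson laws -/

lemma poissonMeasure_recursion (θ : ℝ≥0) (k : ℕ) :
    ((k + 1 : ℕ) : ℝ≥0∞) * poissonMeasure θ {k + 1} = θ * poissonMeasure θ {k} := by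
  rw [poissonMeasure_singleton, poissonMeasure_singleton, ← ENNReal.ofReal_natCast,
    ← ENNReal.ofReal_coe_nnreal, ← ENNReal.ofReal_mul (Nat.cast_nonneg _),
    ← ENNReal.ofReal_mul θ.coe_nonneg]
  congr 1
  rw [Nat.factorial_succ]
  push_cast
  have h1 : ((k : ℝ) + 1) ≠ 0 := by positivity
  have h2 : ((k.factorial : ℕ) : ℝ) ≠ 0 := by positivity
  field_simp
  ring

lemma lintegral_mul_of_recursion {ρ : Measure ℕ} {c : ℝ≥0∞}
    (hρ : ∀ k : ℕ, ((k + 1 : ℕ) : ℝ≥0∞) * ρ {k + 1} = c * ρ {k}) (u : ℕ → ℝ≥0∞) :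
    ∫⁻ k, (k : ℝ≥0∞) * u k ∂ρ = c * ∫⁻ k, u (k + 1) ∂ρ := by
  rw [lintegral_countable', lintegral_countable', tsum_eq_zero_add' ENNReal.summable,
    ← ENNReal.tsum_mul_left]
  simp only [Nat.cast_zero, zero_mul, zero_add]
  refine tsum_congr fun k => ?_
  calc ((k + 1 : ℕ) : ℝ≥0∞) * u (k + 1) * ρ {k + 1}
      = u (k + 1) * (((k + 1 : ℕ) : ℝ≥0∞) * ρ {k + 1}) := by ring
    _ = _ := by rw [hρ]; ring

section Poisson

variable (θ : ℝ≥0)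

lemma lintegral_poissonMeasure : ∫⁻ k, (k : ℝ≥0∞) ∂(poissonMeasure θ) = θ := by
  have := lintegral_mul_of_recursion (poissonMeasure_recursion θ) fun _ => 1
  simpa using this

lemma lintegral_sq_poissonMeasure :
    ∫⁻ k, (k : ℝ≥0∞) ^ 2 ∂(poissonMeasure θ) = (θ : ℝ≥0∞) ^ 2 + θ := by
  have h := lintegral_mul_of_recursion (poissonMeasure_recursion θ) fun k => (k : ℝ≥0∞)
  simp only [Nat.cast_add, Nat.cast_one] at h
  rw [lintegral_add_left (measurable_of_countable _), lintegral_poissonMeasure] at h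
  simp only [lintegral_const, measure_univ, mul_one] at h
  simp only [sq, h]
  ring

lemma lintegral_cube_poissonMeasure :
    ∫⁻ k, (k : ℝ≥0∞) ^ 3 ∂(poissonMeasure θ) = (θ : ℝ≥0∞) ^ 3 + 3 * (θ : ℝ≥0∞) ^ 2 + θ := by
  have h := lintegral_mul_of_recursion (poissonMeasure_recursion θ) fun k => (k : ℝ≥0∞) ^ 2
  have h1 (k : ℕ) : ((k + 1 : ℕ) : ℝ≥0∞) ^ 2 = (k : ℝ≥0∞) ^ 2 + 2 * k + 1 := by push_cast; ring
  simp only [h1] at h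
  rw [lintegral_add_left (measurable_of_countable _), lintegral_add_left (measurable_of_countable _),
    lintegral_const_mul _ (measurable_of_countable _), lintegral_poissonMeasure,
    lintegral_sq_poissonMeasure] at h
  simp only [lintegral_const, measure_univ, mul_one] at h
  calc ∫⁻ k, (k : ℝ≥0∞) ^ 3 ∂(poissonMeasure θ)
      = ∫⁻ k, (k : ℝ≥0∞) * (k : ℝ≥0∞) ^ 2 ∂(poissonMeasure θ) := by simp only [pow_succ']
    _ = _ := by rw [h]; ring

lemma lintegral_sq_dev_poissonMeasure :
    ∫⁻ k, ENNReal.ofReal (((k : ℝ) - θ) ^ 2) ∂(poissonMeasure θ) = θ := by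
  have hpt (k : ℕ) : ENNReal.ofReal (((k : ℝ) - θ) ^ 2) + 2 * θ * k
      = (k : ℝ≥0∞) ^ 2 + (θ : ℝ≥0∞) ^ 2 := by
    have h1 : (2 * θ * k : ℝ≥0∞) = ENNReal.ofReal (2 * θ * k) := by
      rw [ENNReal.ofReal_mul (by positivity), ENNReal.ofReal_mul (by positivity)]
      simp
    have h2 : (k : ℝ≥0∞) ^ 2 + (θ : ℝ≥0∞) ^ 2 = ENNReal.ofReal ((k : ℝ) ^ 2 + (θ : ℝ) ^ 2) := by
      rw [ENNReal.ofReal_add (by positivity) (by positivity), ENNReal.ofReal_pow (by positivity),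
        ENNReal.ofReal_pow (by positivity)]
      simp
    rw [h1, h2, ← ENNReal.ofReal_add (by positivity) (by positivity)]
    congr 1; ring
  have h := lintegral_congr (μ := poissonMeasure θ) hpt
  rw [lintegral_add_right _ (measurable_of_countable _),
    lintegral_const_mul _ (measurable_of_countable _),
    lintegral_add_right _ (measurable_of_countable _), lintegral_poissonMeasure,
    lintegral_sq_poissonMeasure] at h
  simp only [lintegral_const, measure_univ, mul_one] at h
  have hfin : (2 * θ * θ : ℝ≥0∞) ≠ ∞ := by finiteness
  refine (ENNReal.add_left_inj hfin).1 (h.trans ?_)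
  ring

lemma lintegral_dev_poissonMeasure_le (l : ℕ) (hl : l ≤ θ) (hl' : θ ≤ l + 2) :
    ∫⁻ k, ((max k l - min k l : ℕ) : ℝ≥0∞) ∂(poissonMeasure θ)
      ≤ (θ : ℝ≥0∞) ^ (1 / 2 : ℝ) + 2 := by
  have hl1 : (l : ℝ) ≤ θ := by exact_mod_cast hl
  have hl2 : (θ : ℝ) ≤ l + 2 := by exact_mod_cast hl'
  have hpt (k : ℕ) : ((max k l - min k l : ℕ) : ℝ≥0∞) ≤ ENNReal.ofReal |(k : ℝ) - θ| + 2 := by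
    rw [← ENNReal.ofReal_natCast, ← ENNReal.ofReal_ofNat 2, ← ENNReal.ofReal_add (abs_nonneg _)
      (by norm_num), Nat.cast_sub (by omega)]
    refine ENNReal.ofReal_le_ofReal ?_
    push_cast
    rw [max_sub_min_eq_abs]
    have h1 := abs_sub_le (l : ℝ) θ k
    have h2 : |(l : ℝ) - θ| ≤ 2 := by rw [abs_le]; constructor <;> linarith
    rw [abs_sub_comm (θ : ℝ)] at h1
    linarith
  calc ∫⁻ k, ((max k l - min k l : ℕ) : ℝ≥0∞) ∂(poissonMeasure θ)
      ≤ ∫⁻ k : ℕ, (ENNReal.ofReal |(k : ℝ) - θ| + 2) ∂(poissonMeasure θ) := lintegral_mono hpt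
    _ = ∫⁻ k : ℕ, ENNReal.ofReal |(k : ℝ) - θ| ∂(poissonMeasure θ) + 2 := by
        rw [lintegral_add_right _ measurable_const]; simp
    _ ≤ _ := by
        gcongr
        refine (lintegral_le_eLpNorm_two _ (measurable_of_countable _)).trans ?_
        rw [eLpNorm_two_ennreal]
        gcongr
        rw [← lintegral_sq_dev_poissonMeasure θ]
        refine lintegral_mono fun k => ?_
        rw [ENNReal.rpow_ofNat, ← ENNReal.ofReal_pow (abs_nonneg _), sq_abs]

variable {Ω : Type*} [MeasurableSpace Ω] {P : Measure Ω} {J : Ω → ℕ}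

lemma lintegral_comp_of_map_eq (hJ : Measurable J) {ρ : Measure ℕ} (hlaw : P.map J = ρ)
    (u : ℕ → ℝ≥0∞) : ∫⁻ ω, u (J ω) ∂P = ∫⁻ k, u k ∂ρ := by
  rw [← hlaw, lintegral_map (measurable_of_countable u) hJ]

lemma eLpNorm_three_poisson_le (hJ : Measurable J) (hlaw : P.map J = poissonMeasure θ) :
    eLpNorm (fun ω => (J ω : ℝ)) 3 P ≤ θ + 1 := by
  rw [eLpNorm_eq_lintegral_rpow_enorm_toReal (by norm_num) (by norm_num)]
  simp only [ENNReal.toReal_ofNat, Real.enorm_natCast, ENNReal.rpow_ofNat]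
  rw [lintegral_comp_of_map_eq hJ hlaw fun k => (k : ℝ≥0∞) ^ 3, lintegral_cube_poissonMeasure]
  calc ((θ : ℝ≥0∞) ^ 3 + 3 * (θ : ℝ≥0∞) ^ 2 + θ) ^ (1 / 3 : ℝ)
      ≤ (((θ : ℝ≥0∞) + 1) ^ 3) ^ (1 / 3 : ℝ) := by
        gcongr
        calc (θ : ℝ≥0∞) ^ 3 + 3 * (θ : ℝ≥0∞) ^ 2 + θ
            ≤ (θ : ℝ≥0∞) ^ 3 + 3 * (θ : ℝ≥0∞) ^ 2 + θ + (2 * θ + 1) := le_self_add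
          _ = _ := by ring
    _ = _ := by
        rw [← ENNReal.rpow_natCast, ← ENNReal.rpow_mul]
        norm_num

lemma variance_poisson (hJ : Measurable J) (hlaw : P.map J = poissonMeasure θ) :
    Var[fun ω => (J ω : ℝ); P] = θ := by
  have hmean : ∫ ω, (J ω : ℝ) ∂P = θ := by
    rw [integral_eq_lintegral_of_nonneg_ae (ae_of_all _ fun ω => Nat.cast_nonneg _)
      (Measurable.aestronglyMeasurable (by fun_prop))]
    simp only [ENNReal.ofReal_natCast]
    rw [lintegral_comp_of_map_eq hJ hlaw fun k => (k : ℝ≥0∞), lintegral_poissonMeasure]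
    rfl
  rw [variance, evariance_eq_lintegral_ofReal, hmean,
    lintegral_comp_of_map_eq hJ hlaw fun k => ENNReal.ofReal (((k : ℝ) - θ) ^ 2),
    lintegral_sq_dev_poissonMeasure]
  rfl

end Poisson

/-! ### Følner sequences -/

section Folner

variable {G : Type*} [Group G] [MetricSpace G] [IsTopologicalGroup G] [LocallyCompactSpace G]
    [SecondCountableTopology G] [MeasurableSpace G] [BorelSpace G]
    {haar : Measure G} [haar.IsHaarMeasure] {A : ℕ → Set G}

lemma IsFolner.haar_ne_zero (hA : IsFolner haar fun n => (A n)⁻¹) (n : ℕ) : haar (A n) ≠ 0 :=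
  fun h0 => (hA.1 n).2.ne' ((measure_inv_null haar).2 h0)

lemma IsFolner.haar_ne_top (hA : IsFolner haar fun n => (A n)⁻¹) (n : ℕ) : haar (A n) ≠ ∞ := by
  have h1 : IsCompact (A n) := by simpa using (hA.1 n).1.inv
  exact h1.measure_lt_top.ne

/-- A set with an almost invariant inverse is not too small. -/
lemma haar_le_two_mul_of_symmDiff_le {K F : Set G} (hK : MeasurableSet K) (hF : MeasurableSet F)
    (hF0 : haar F ≠ 0) (hFt : haar F ≠ ∞)
    (hKF : haar (symmDiff F (K * F)) ≤ haar F / 2) : haar K ≤ 2 * haar F⁻¹ := by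
  set S : Set (G × G) := {y | y.1 ∈ K ∧ y.2 ∈ F ∧ y.1⁻¹ * y.2 ∈ F} with hS
  have hSm : MeasurableSet S := by
    have h1 : Measurable fun y : G × G => y.1⁻¹ * y.2 := by fun_prop
    exact (measurable_fst hK).inter ((measurable_snd hF).inter (h1 hF))
  have lower : haar K * (haar F / 2) ≤ (haar.prod haar) S := by
    rw [Measure.prod_apply hSm, mul_comm, ← setLIntegral_const]
    rw [← lintegral_indicator hK]
    refine lintegral_mono fun k => ?_
    by_cases hk : k ∈ K
    · rw [Set.indicator_of_mem hk]
      have h1 : haar ((fun x => k⁻¹ * x) ⁻¹' F) = haar F := measure_preimage_mul haar k⁻¹ F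
      have h2 : ((fun x => k⁻¹ * x) ⁻¹' F) ⊆ (Prod.mk k ⁻¹' S) ∪ symmDiff F (K * F) := by
        intro x hx
        by_cases hxF : x ∈ F
        · exact Or.inl ⟨hk, hxF, hx⟩
        · exact Or.inr (Or.inr ⟨⟨k, hk, _, hx, by simp⟩, hxF⟩)
      have h3 : haar F ≤ haar (Prod.mk k ⁻¹' S) + haar F / 2 := by
        rw [← h1]
        refine (measure_mono h2).trans ((measure_union_le _ _).trans ?_)
        rw [h1]
        gcongr
      have h4 : haar F / 2 ≠ ∞ := by finiteness
      refine (ENNReal.add_le_add_iff_right h4).1 ?_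
      rwa [ENNReal.add_halves]
    · rw [Set.indicator_of_notMem hk]; exact zero_le
  have upper : (haar.prod haar) S ≤ haar F * haar F⁻¹ := by
    rw [Measure.prod_apply_symm hSm, mul_comm, ← setLIntegral_const, ← lintegral_indicator hF]
    refine lintegral_mono fun x => ?_
    by_cases hx : x ∈ F
    · rw [Set.indicator_of_mem hx]
      have h1 : haar ((fun k => x⁻¹ * k) ⁻¹' F⁻¹) = haar F⁻¹ := measure_preimage_mul haar x⁻¹ F⁻¹
      rw [← h1]
      refine measure_mono fun k hk => ?_
      have h2 : k⁻¹ * x ∈ F := hk.2.2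
      simpa using h2
    · have : (fun k => (k, x)) ⁻¹' S = ∅ := by
        ext k
        simp only [Set.mem_preimage, Set.mem_empty_iff_false, iff_false]
        exact fun hk => hx hk.2.1
      rw [this]; simp
  have h5 := lower.trans upper
  have h6 : haar F * haar K ≤ haar F * (2 * haar F⁻¹) := by
    calc haar F * haar K = 2 * (haar K * (haar F / 2)) := by
          rw [div_eq_mul_inv]
          calc haar F * haar K = haar K * haar F * (2 * 2⁻¹) := by
                rw [ENNReal.mul_inv_cancel (by norm_num) (by norm_num)]; ring
            _ = _ := by ring
      _ ≤ 2 * (haar F * haar F⁻¹) := by gcongr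
      _ = _ := by ring
  exact (ENNReal.mul_le_mul_iff_right hF0 hFt).1 h6

lemma IsFolner.exists_le_haar (hA : IsFolner haar fun n => (A n)⁻¹) :
    ∃ δ : ℝ≥0∞, δ ≠ 0 ∧ ∀ᶠ n in atTop, δ ≤ haar (A n) := by
  obtain ⟨K, hK, hK1⟩ := exists_compact_mem_nhds (1 : G)
  have hKpos : 0 < haar K := Measure.measure_pos_of_mem_nhds haar hK1
  refine ⟨haar K / 2, (ENNReal.div_pos hKpos.ne' (by norm_num)).ne', ?_⟩
  have h1 := hA.2 K hK ⟨1, mem_of_mem_nhds hK1⟩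
  have h2 : ∀ᶠ n in atTop, haar (symmDiff (A n)⁻¹ (K * (A n)⁻¹)) / haar (A n)⁻¹ ≤ 1 / 2 :=
    h1.eventually_le_const (by norm_num)
  filter_upwards [h2] with n hn
  have h0 := (hA.1 n).2.ne'
  have ht := (hA.1 n).1.measure_lt_top (μ := haar) |>.ne
  have h3 : haar (symmDiff (A n)⁻¹ (K * (A n)⁻¹)) ≤ haar (A n)⁻¹ / 2 := by
    rw [ENNReal.div_le_iff h0 ht] at hn
    rwa [one_div, mul_comm] at hn
  have h4 := haar_le_two_mul_of_symmDiff_le hK.measurableSet (hA.1 n).1.measurableSet h0 ht h3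
  rw [inv_inv] at h4
  exact ENNReal.div_le_of_le_mul' h4

end Folner

lemma iSup_lt_top_of_eventually_le {u : ℕ → ℝ≥0∞} {C : ℝ≥0∞} (hu : ∀ n, u n ≠ ∞) (hC : C ≠ ∞)
    (h : ∀ᶠ n in atTop, u n ≤ C) : ⨆ n, u n < ∞ := by
  obtain ⟨N, hN⟩ := eventually_atTop.1 h
  have h1 : ⨆ n, u n ≤ C + ∑ n ∈ Finset.range N, u n := by
    refine iSup_le fun n => ?_
    rcases le_or_gt N n with hn | hn
    · exact (hN n hn).trans le_self_add
    · exact (Finset.single_le_sum (f := u) (fun _ _ => zero_le) (Finset.mem_range.2 hn)).trans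
        le_add_self
  exact h1.trans_lt (ENNReal.add_lt_top.2 ⟨hC.lt_top, ENNReal.sum_lt_top.2 fun n _ => (hu n).lt_top⟩)

/-! ### The limit theorem -/

lemma eventually_le_mul_of_isBigO {a : ℕ → ℝ≥0∞} (ha : ∀ n, a n ≠ ∞) {θ : ℕ → ℝ≥0}
    (h : (fun n => (θ n : ℝ)) =O[atTop] fun n => (a n).toReal) :
    ∃ C : ℝ≥0, ∀ᶠ n in atTop, (θ n : ℝ≥0∞) ≤ C * a n := by
  obtain ⟨C, hC, hb⟩ := h.exists_pos
  refine ⟨C.toNNReal, ?_⟩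
  filter_upwards [hb.bound] with n hn
  rw [Real.norm_of_nonneg (θ n).coe_nonneg, Real.norm_of_nonneg ENNReal.toReal_nonneg] at hn
  calc (θ n : ℝ≥0∞) = ENNReal.ofReal (θ n) := by simp
    _ ≤ ENNReal.ofReal (C * (a n).toReal) := ENNReal.ofReal_le_ofReal hn
    _ = _ := by
      rw [ENNReal.ofReal_mul hC.le, ENNReal.ofReal_toReal (ha n)]
      rfl

section Limit

variable {G : Type*} [Group G] [MetricSpace G] [IsTopologicalGroup G] [LocallyCompactSpace G]
    [SecondCountableTopology G] [MeasurableSpace G] [BorelSpace G]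
    {haar : Measure G} [haar.IsHaarMeasure]
    {𝒳 : Type*} [MeasurableSpace 𝒳] [StandardBorelSpace 𝒳] [Nonempty 𝒳]
    [MulAction G 𝒳] [MeasurableSMul₂ G 𝒳]
    {Ω : Type*} [MeasurableSpace Ω] {P : Measure Ω} [IsProbabilityMeasure P]
    {A : ℕ → Set G} {X : ℕ → Ω → 𝒳} {f : ℕ → 𝒳 → ℕ} {b : ℕ → ℕ}
    {ν : ℕ → Measure G} {Φ : ℕ → ℕ → Ω → G} {J : ℕ → Ω → ℕ}

lemma eLpNorm_condHit {X : Ω → 𝒳} (hX : Measurable X) (f : 𝒳 → ℕ) (p : G) :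
    eLpNorm (fun ω => hitProb (condKernel P G hX ω) (fun (φ : G) x => f (φ • x)) p) 2 P
      = eLpNorm (condHit P X f p) 2 P := by
  refine eLpNorm_congr_enorm_ae (ae_of_all _ fun ω => ?_)
  have h1 : IsProbabilityMeasure (condLaw G P X X (X ω)) :=
    (isMarkovKernel_condKernel P hX).isProbabilityMeasure ω
  rw [condHit, Real.enorm_of_nonneg measureReal_nonneg, ofReal_measureReal]
  rfl

/-- A bound for the mean distance to the compound Poisson approximation, in terms of the mixing
coefficients. -/
lemma meanCondTV_le (hset : RandomizedSetting haar A P X f b ν Φ J) (n : ℕ) {S : ℝ≥0}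
    (hS : ∀ φ ∈ A n, (∀ r : ℕ, 1 ≤ r → ν n (Metric.closedBall φ r) ≤
        S * (haar (Metric.closedBall 1 r) / haar (A n))) ∧
      (∀ r s : ℕ, 1 ≤ r → r < s → ν n (Metric.closedBall φ s \ Metric.closedBall φ r) ≤
        S * (haar (Metric.closedBall 1 s \ Metric.closedBall 1 r) / haar (A n))))
    {M D : ℝ≥0} (hM : ∀ φ ∈ A n, haar (A n) * eLpNorm (condHit P (X n) (f n) φ) 2 P ≤ M)
    (hD : eLpNorm (fun ω => ∫⁻ w : ℕ, (w : ℝ≥0∞)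
      ∂(condLaw G P (X n) (randomSum (X n) (f n) (Φ n) (J n)) (X n ω))) ∞ P ≤ D)
    {ρ : Measure ℕ} [IsProbabilityMeasure ρ] {e m : ℕ} {c : ℝ≥0} (hρJ : P.map (J n) = ρ.map (· + e))
    (hρ : ∀ k : ℕ, ((k + 1 : ℕ) : ℝ≥0∞) * ρ.map (· + e) {k + 1} = c * ρ {k})
    (hmc : (m : ℝ≥0∞) ≤ c) :
    meanCondTV P (X n) (f n) (Φ n) (J n) (b n) m ≤
      2 * ENNReal.ofReal (Real.exp D) *
        (c * ((∫⁻ k, (k : ℝ≥0∞) ∂ρ) * (5 * 2 *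
              (S * (haar (Metric.closedBall 1 (2 * b n)) / haar (A n)))
              * (M / haar (A n) * (M / haar (A n)))
            + 2 * (S / haar (A n)) * (M / haar (A n)) * (residuePsi haar P (X n) (f n) 2 (b n)
              + residueXi haar P (X n) (f n) 2 (b n)))
          + 2 * (∫⁻ k, ((max k (m - 1) - min k (m - 1) : ℕ) : ℝ≥0∞) ∂ρ)
            * (S * (haar (Metric.closedBall 1 (b n)) / haar (A n)) * (M / haar (A n)))
          + 2 * e * (M / haar (A n) * (M / haar (A n))))
        + ((c - m) + (m - c)) * (M / haar (A n))) := by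
  have hX := hset.measurable_X n
  have hf := hset.measurable_f n
  have hΦ := hset.measurable_sample n
  have hlaw := hset.law_sample n
  have hind := hset.indep_sample n
  have hb := hset.radius_pos n
  have hΦm : Measurable fun ω i => Φ n i ω := measurable_pi_lambda _ hΦ
  have : IsProbabilityMeasure (ν n) := by
    rw [← hlaw 0]; exact Measure.isProbabilityMeasure_map (hΦ 0).aemeasurable
  have : IsProbabilityMeasure (ρ.map (· + e)) :=
    Measure.isProbabilityMeasure_map (measurable_of_countable _).aemeasurable
  have hh := measurable_uncurry_comp_smul G hf
  have hXΦ : IndepFun (X n) (fun ω i => Φ n i ω) P :=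
    (hset.indep_X n).comp measurable_id measurable_snd
  have ha0 := hset.folner.haar_ne_zero n
  have hat := hset.folner.haar_ne_top n
  have hcond := condLaw_randomSum hX hf hΦ hlaw hind (hset.measurable_J n) (hset.indep_J n)
    (hset.indep_X n)
  rw [hρJ] at hcond
  have hq : ∀ p ∈ A n, eLpNorm (fun ω => hitProb (condKernel P G hX ω)
      (fun (φ : G) x => f n (φ • x)) p) 2 P ≤ M / haar (A n) := by
    intro p hp
    rw [eLpNorm_condHit hX, ENNReal.le_div_iff_mul_le (Or.inl ha0) (Or.inl hat), mul_comm]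
    exact hM p hp
  have hg : ∀ p ∈ A n, ∀ t : ℕ, 1 ≤ t → ν n (Metric.closedBall p (t + 1 : ℕ) \
      Metric.closedBall p t) ≤ S / haar (A n) * growth haar t := by
    intro p hp t ht
    refine ((hS p hp).2 t (t + 1) ht (Nat.lt_succ_self t)).trans (le_of_eq ?_)
    rw [growth, div_eq_mul_inv, div_eq_mul_inv]
    ring
  have hs₁ : ∀ p ∈ A n, ν n (Metric.closedBall p (b n))
      ≤ S * (haar (Metric.closedBall 1 (b n)) / haar (A n)) := fun p hp => (hS p hp).1 _ hb
  have hs₂ : ∀ p ∈ A n, ν n (Metric.closedBall p (2 * b n : ℕ))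
      ≤ S * (haar (Metric.closedBall 1 (2 * b n)) / haar (A n)) := by
    intro p hp
    have := (hS p hp).1 (2 * b n) (by omega)
    push_cast at this ⊢
    exact this
  have hbound : ∀ᵐ ω ∂P, m * ∫⁻ p, hitProb (condKernel P G hX ω)
      (fun (φ : G) x => f n (φ • x)) p ∂(ν n) ≤ ENNReal.ofReal (D : ℝ) := by
    filter_upwards [hcond, enorm_ae_le_eLpNormEssSup (fun ω => ∫⁻ w : ℕ, (w : ℝ≥0∞)
      ∂(condLaw G P (X n) (randomSum (X n) (f n) (Φ n) (J n)) (X n ω))) P] with ω h1 h2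
    rw [← eLpNorm_exponent_top] at h2
    have h3 := h2.trans hD
    rw [h1, enorm_eq_self, lintegral_hitLaw hh (fun p x => hset.binary n _) _ (ν n) ρ hρ] at h3
    rw [ENNReal.ofReal_coe_nnreal]
    exact le_trans (mul_le_mul_left hmc _) h3
  have hR := clusterRate_spec hX hf hΦ hlaw hind (hset.binary n) hXΦ (b n) m D.coe_nonneg hbound
  have key := lintegral_tvDist_hitLaw_le hh P (condKernel P G hX) (ν n) ρ (hset.supported n) hq hg
    (hset.binary n) hb hs₁ hs₂ (m - 1) e m ENNReal.coe_ne_top hρ hR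
  refine le_trans (le_of_eq ?_) key
  refine lintegral_congr_ae ?_
  filter_upwards [hcond] with ω hω
  rw [hω]

theorem tendsto_meanCondTV (hset : RandomizedSetting haar A P X f b ν Φ J)
    (hrem : RemainingConditions haar A P X f b Φ J) {ρ : ℕ → Measure ℕ}
    [∀ n, IsProbabilityMeasure (ρ n)] {e : ℕ} (he : e ≤ 1) {m : ℕ → ℕ} {c : ℕ → ℝ≥0}
    (hρJ : ∀ n, P.map (J n) = (ρ n).map (· + e))
    (hρ : ∀ n (k : ℕ), ((k + 1 : ℕ) : ℝ≥0∞) * (ρ n).map (· + e) {k + 1} = c n * ρ n {k})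
    (hmc : ∀ n, (m n : ℝ≥0∞) ≤ c n) (hcm : ∀ n, (c n : ℝ≥0∞) ≤ m n + 1)
    (hmean : ∀ n, ∫⁻ k, (k : ℝ≥0∞) ∂(ρ n) ≤ c n)
    (hdev : ∀ n, ∫⁻ k, ((max k (m n - 1) - min k (m n - 1) : ℕ) : ℝ≥0∞) ∂(ρ n)
      ≤ (c n : ℝ≥0∞) ^ (1 / 2 : ℝ) + 2)
    (hbig : (fun n => (c n : ℝ)) =O[atTop] fun n => haar.real (A n)) :
    Tendsto (fun n => meanCondTV P (X n) (f n) (Φ n) (J n) (b n) (m n)) atTop (𝓝 0) := by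
  obtain ⟨S, -, hS⟩ := hset.wellSpread
  obtain ⟨C, hC⟩ := eventually_le_mul_of_isBigO hset.folner.haar_ne_top hbig
  obtain ⟨M, hM⟩ := ENNReal.lt_iff_exists_coe.1 hrem.hit_moment
  obtain ⟨D, hD⟩ := ENNReal.lt_iff_exists_coe.1 hrem.mean_bounded
  replace hM := hM.1
  replace hD := hD.1
  set x : ℕ → ℝ≥0∞ := fun n => haar (Metric.closedBall 1 (2 * b n)) / haar (A n) with hx
  set y : ℕ → ℝ≥0∞ := fun n =>
    haar (Metric.closedBall 1 (b n)) / haar (A n) * haar (A n) ^ (1 / 2 : ℝ) with hy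
  set R : ℕ → ℝ≥0∞ := fun n => residuePsi haar P (X n) (f n) 2 (b n)
    + residueXi haar P (X n) (f n) 2 (b n) with hRdef
  set δ : ℝ≥0∞ := min 1 (haar (Metric.closedBall (1 : G) 1)) with hδ
  have hδ0 : δ ≠ 0 := (lt_min one_pos (Metric.measure_closedBall_pos haar _ one_pos)).ne'
  have hδt : δ ≠ ∞ := ne_top_of_le_ne_top ENNReal.one_ne_top (min_le_left _ _)
  have hx0 : Tendsto x atTop (𝓝 0) := hrem.double_balls
  have hy0 : Tendsto y atTop (𝓝 0) := hrem.small_balls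
  have hR0 : Tendsto R atTop (𝓝 0) := by simpa using hrem.psi_residue.add hrem.xi_residue
  have hE : 2 * ENNReal.ofReal (Real.exp D) ≠ ∞ := by finiteness
  have hinv (n) : (haar (A n))⁻¹ ≤ δ⁻¹ * x n := by
    have h1 : δ ≤ haar (Metric.closedBall 1 (2 * b n)) := by
      refine (min_le_right _ _).trans (measure_mono (Metric.closedBall_subset_closedBall ?_))
      have : (1 : ℝ) ≤ b n := by exact_mod_cast hset.radius_pos n
      linarith
    calc (haar (A n))⁻¹ = δ⁻¹ * (δ * (haar (A n))⁻¹) := by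
          rw [← mul_assoc, ENNReal.inv_mul_cancel hδ0 hδt, one_mul]
      _ ≤ δ⁻¹ * x n := by
          rw [hx]
          simp only
          rw [div_eq_mul_inv]
          gcongr
  have hbd : ∀ᶠ n in atTop, meanCondTV P (X n) (f n) (Φ n) (J n) (b n) (m n)
      ≤ 2 * ENNReal.ofReal (Real.exp D) * (10 * C ^ 2 * S * M ^ 2 * x n + 2 * C ^ 2 * S * M * R n
        + 2 * C * S * M * (C : ℝ≥0∞) ^ (1 / 2 : ℝ) * y n + 4 * C * S * M * x n
        + (2 * C * M ^ 2 + M) * δ⁻¹ * x n) := by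
    filter_upwards [hC] with n hn
    refine (meanCondTV_le hset n (hS n) (M := M) (D := D) (fun φ hφ => ?_) ?_ (hρJ n) (hρ n)
      (hmc n)).trans ?_
    · refine le_trans ?_ hM.le
      exact le_iSup_of_le n (le_iSup₂_of_le (f := fun φ (_ : φ ∈ A n) =>
        haar (A n) * eLpNorm (condHit P (X n) (f n) φ) 2 P) φ hφ le_rfl)
    · refine le_trans ?_ hD.le
      exact le_iSup (fun n => eLpNorm (fun ω => ∫⁻ w : ℕ, (w : ℝ≥0∞)
        ∂(condLaw G P (X n) (randomSum (X n) (f n) (Φ n) (J n)) (X n ω))) ∞ P) n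
    have ha0 := hset.folner.haar_ne_zero n
    have hat := hset.folner.haar_ne_top n
    have hdiff : ((c n : ℝ≥0∞) - m n) + (m n - c n) ≤ 1 := by
      rw [tsub_eq_zero_of_le (hmc n), add_zero]
      exact tsub_le_iff_left.2 (hcm n)
    have hdev' : ∫⁻ k, ((max k (m n - 1) - min k (m n - 1) : ℕ) : ℝ≥0∞) ∂(ρ n)
        ≤ (C : ℝ≥0∞) ^ (1 / 2 : ℝ) * haar (A n) ^ (1 / 2 : ℝ) + 2 := by
      refine (hdev n).trans ?_
      rw [← ENNReal.mul_rpow_of_nonneg _ _ (by norm_num)]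
      gcongr
    have he' : (e : ℝ≥0∞) ≤ 1 := by exact_mod_cast he
    have hmean' := (hmean n).trans hn
    have hballs : haar (Metric.closedBall 1 (b n)) / haar (A n) ≤ x n := by
      rw [hx]
      simp only
      gcongr
      have : (0 : ℝ) ≤ b n := Nat.cast_nonneg _
      linarith
    have hai : haar (A n) * (haar (A n))⁻¹ = 1 := ENNReal.mul_inv_cancel ha0 hat
    set a := haar (A n) with ha
    set i := a⁻¹ with hi
    refine mul_le_mul_right ?_ _
    calc _ ≤ C * a * (C * a * (5 * 2 * (S * x n) * (M / a * (M / a))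
            + 2 * (S / a) * (M / a) * R n)
          + 2 * ((C : ℝ≥0∞) ^ (1 / 2 : ℝ) * a ^ (1 / 2 : ℝ) + 2)
            * (S * (haar (Metric.closedBall 1 (b n)) / a) * (M / a))
          + 2 * 1 * (M / a * (M / a))) + 1 * (M / a) := by gcongr
      _ = 10 * C ^ 2 * S * M ^ 2 * x n * (a * i) ^ 2 + 2 * C ^ 2 * S * M * R n * (a * i) ^ 2
          + 2 * C * S * M * (C : ℝ≥0∞) ^ (1 / 2 : ℝ)
            * (haar (Metric.closedBall 1 (b n)) / a * a ^ (1 / 2 : ℝ)) * (a * i)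
          + 4 * C * S * M * (haar (Metric.closedBall 1 (b n)) / a) * (a * i)
          + (2 * C * M ^ 2 * (a * i) + M) * i := by
          simp only [div_eq_mul_inv, ← hi]
          ring
      _ ≤ _ := by
          rw [hai]
          simp only [one_pow, mul_one]
          have := hinv n
          rw [mul_assoc (2 * (C : ℝ≥0∞) * (M : ℝ≥0∞) ^ 2 + M)]
          gcongr
  have hlim : Tendsto (fun n => 2 * ENNReal.ofReal (Real.exp D) *
      (10 * C ^ 2 * S * M ^ 2 * x n + 2 * C ^ 2 * S * M * R n
        + 2 * C * S * M * (C : ℝ≥0∞) ^ (1 / 2 : ℝ) * y n + 4 * C * S * M * x n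
        + (2 * C * M ^ 2 + M) * δ⁻¹ * x n)) atTop (𝓝 0) := by
    have hmul {K : ℝ≥0∞} (hK : K ≠ ∞) {u : ℕ → ℝ≥0∞} (hu : Tendsto u atTop (𝓝 0)) :
        Tendsto (fun n => K * u n) atTop (𝓝 0) := by
      simpa using ENNReal.Tendsto.const_mul hu (Or.inr hK)
    refine hmul hE ?_
    have hδi : δ⁻¹ ≠ ∞ := ENNReal.inv_ne_top.2 hδ0
    have t1 := hmul (K := 10 * C ^ 2 * S * M ^ 2) (by finiteness) hx0
    have t2 := hmul (K := 2 * C ^ 2 * S * M) (by finiteness) hR0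
    have t3 := hmul (K := 2 * C * S * M * (C : ℝ≥0∞) ^ (1 / 2 : ℝ)) (by finiteness) hy0
    have t4 := hmul (K := 4 * C * S * M) (by finiteness) hx0
    have t5 := hmul (K := (2 * C * M ^ 2 + M) * δ⁻¹) (by finiteness) hx0
    simpa using (((t1.add t2).add t3).add t4).add t5
  exact tendsto_of_tendsto_of_tendsto_of_le_of_le' tendsto_const_nhds hlim
    (Eventually.of_forall fun _ => zero_le) hbd

lemma sampleMoment_of_eventually_le (hA : IsFolner haar fun n => (A n)⁻¹)
    (hfin : ∀ n, eLpNorm (fun ω => (J n ω : ℝ)) 3 P ≠ ∞) {C : ℝ≥0∞} (hC : C ≠ ∞)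
    (h : ∀ᶠ n in atTop, eLpNorm (fun ω => (J n ω : ℝ)) 3 P ≤ C * haar (A n)) :
    SampleMoment haar A P J := by
  refine iSup_lt_top_of_eventually_le
    (fun n => ENNReal.div_ne_top (hfin n) (hA.haar_ne_zero n)) hC ?_
  filter_upwards [h] with n hn
  exact ENNReal.div_le_of_le_mul hn

end Limit

/-! ### Deterministic sample sizes -/

lemma map_add_one_dirac_recursion {j : ℕ} (hj : 0 < j) (k : ℕ) :
    ((k + 1 : ℕ) : ℝ≥0∞) * (Measure.dirac (j - 1)).map (· + 1) {k + 1}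
      = ((j : ℝ≥0) : ℝ≥0∞) * Measure.dirac (j - 1) {k} := by
  rw [Measure.map_dirac' (measurable_of_countable _), Nat.sub_add_cancel hj,
    Measure.dirac_apply' _ (measurableSet_singleton _),
    Measure.dirac_apply' _ (measurableSet_singleton _)]
  by_cases h : j = k + 1
  · subst h; simp
  · have h' : j - 1 ≠ k := by omega
    simp [Set.indicator, h, h']

theorem mainTheorem8
    {G : Type*} [Group G] [MetricSpace G] [IsTopologicalGroup G] [LocallyCompactSpace G]
    [SecondCountableTopology G] [IsIsometricSMul G G] [MeasurableSpace G] [BorelSpace G]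
    (haar : Measure G) [haar.IsHaarMeasure]
    {𝒳 : Type*} [MeasurableSpace 𝒳] [StandardBorelSpace 𝒳] [Nonempty 𝒳]
    [MulAction G 𝒳] [MeasurableSMul₂ G 𝒳]
    {Ω : Type*} [MeasurableSpace Ω] (P : Measure Ω) [IsProbabilityMeasure P]
    (A : ℕ → Set G) (X : ℕ → Ω → 𝒳) (f : ℕ → 𝒳 → ℕ) (b : ℕ → ℕ)
    (ν : ℕ → Measure G) (Φ : ℕ → ℕ → Ω → G) (J : ℕ → Ω → ℕ)
    (hset : RandomizedSetting haar A P X f b ν Φ J) :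
    (∀ j : ℕ → ℕ, (∀ n, 0 < j n) → (∀ n, ∀ᵐ ω ∂P, J n ω = j n) →
      (fun n => (j n : ℝ)) =O[atTop] (fun n => haar.real (A n)) →
        SampleMoment haar A P J ∧
        (SmallBalls haar A b → SampleVariance haar A P b J) ∧
        (RemainingConditions haar A P X f b Φ J →
          Tendsto (fun n => meanCondTV P (X n) (f n) (Φ n) (J n) (b n) (j n)) atTop (𝓝 0))) ∧
    (∀ θ : ℕ → ℝ≥0, (∀ n, P.map (J n) = poissonMeasure (θ n)) →
      (fun n => (θ n : ℝ)) =O[atTop] (fun n => haar.real (A n)) →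
        SampleMoment haar A P J ∧
        (SmallBalls haar A b → SampleVariance haar A P b J) ∧
        (RemainingConditions haar A P X f b Φ J →
          Tendsto (fun n => meanCondTV P (X n) (f n) (Φ n) (J n) (b n) ⌊θ n⌋₊)
            atTop (𝓝 0))) := by
  constructor
  · intro j hj hJ hbig
    have hbig' : (fun n => (((j n : ℕ) : ℝ≥0) : ℝ)) =O[atTop] fun n => haar.real (A n) := by
      simpa using hbig
    have hae (n) : (fun ω => (J n ω : ℝ)) =ᵐ[P] fun _ => (j n : ℝ) := by
      filter_upwards [hJ n] with ω hω
      rw [hω]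
    have hnorm (n) : eLpNorm (fun ω => (J n ω : ℝ)) 3 P = j n := by
      rw [eLpNorm_congr_ae (hae n), eLpNorm_const _ (by norm_num) (IsProbabilityMeasure.ne_zero P)]
      simp
    refine ⟨?_, fun hsmall => ?_, fun hrem => ?_⟩
    · obtain ⟨C, hC⟩ := eventually_le_mul_of_isBigO hset.folner.haar_ne_top hbig'
      refine sampleMoment_of_eventually_le hset.folner (fun n => ?_) (C := C) ENNReal.coe_ne_top ?_
      · rw [hnorm]; exact ENNReal.natCast_ne_top _
      · filter_upwards [hC] with n hn
        rw [hnorm]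
        simpa using hn
    · refine hsmall.congr fun n => ?_
      rw [variance_congr (hae n)]
      simp [variance, evariance]
    · have hmap (n) : P.map (J n) = (Measure.dirac (j n - 1)).map (· + 1) := by
        have h1 : J n =ᵐ[P] fun _ => j n := hJ n
        rw [Measure.map_congr h1, Measure.map_const, measure_univ, one_smul,
          Measure.map_dirac' (measurable_of_countable _), Nat.sub_add_cancel (hj n)]
      refine tendsto_meanCondTV hset hrem (ρ := fun n => Measure.dirac (j n - 1)) le_rfl
        (c := fun n => (j n : ℝ≥0)) hmap (fun n k => map_add_one_dirac_recursion (hj n) k)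
        (fun n => ?_) (fun n => ?_) (fun n => ?_) (fun n => ?_) hbig'
      · simp
      · simp
      · rw [lintegral_dirac' _ (measurable_of_countable _)]
        simp
      · rw [lintegral_dirac' _ (measurable_of_countable _)]
        simp
  · intro θ hθ hbig
    have hmeas := hset.measurable_J
    refine ⟨?_, fun hsmall => ?_, fun hrem => ?_⟩
    · obtain ⟨C, hC⟩ := eventually_le_mul_of_isBigO hset.folner.haar_ne_top hbig
      obtain ⟨δ, hδ0, hδ⟩ := hset.folner.exists_le_haar
      have hδi : δ⁻¹ ≠ ∞ := ENNReal.inv_ne_top.2 hδ0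
      have hle (n) := eLpNorm_three_poisson_le (θ n) (hmeas n) (hθ n)
      refine sampleMoment_of_eventually_le hset.folner
        (fun n => ne_top_of_le_ne_top (by finiteness) (hle n)) (C := C + δ⁻¹) (by finiteness) ?_
      filter_upwards [hC, hδ] with n h1 h2
      refine (hle n).trans ?_
      rw [add_mul]
      refine add_le_add h1 ?_
      have h3 : δ ≠ ∞ := ne_top_of_le_ne_top (hset.folner.haar_ne_top n) h2
      calc (1 : ℝ≥0∞) = δ⁻¹ * δ := (ENNReal.inv_mul_cancel hδ0 h3).symm
        _ ≤ _ := by gcongr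
    · obtain ⟨C, hC⟩ := eventually_le_mul_of_isBigO hset.folner.haar_ne_top hbig
      set K : ℝ≥0∞ := max 1 ((C : ℝ≥0∞) ^ (1 / 2 : ℝ)) with hK
      have hKt : K ≠ ∞ := by rw [hK]; exact (max_lt (by simp) (by finiteness)).ne
      have hlim : Tendsto (fun n => K * (haar (Metric.closedBall 1 (b n)) / haar (A n)
          * haar (A n) ^ (1 / 2 : ℝ))) atTop (𝓝 0) := by
        simpa using ENNReal.Tendsto.const_mul hsmall (Or.inr hKt)
      refine tendsto_of_tendsto_of_tendsto_of_le_of_le' tendsto_const_nhds hlim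
        (Eventually.of_forall fun _ => zero_le) ?_
      filter_upwards [hC] with n hn
      rw [variance_poisson (θ n) (hmeas n) (hθ n)]
      have h1 : ENNReal.ofReal √(θ n : ℝ) = (θ n : ℝ≥0∞) ^ (1 / 2 : ℝ) := by
        rw [Real.sqrt_eq_rpow, ← ENNReal.ofReal_rpow_of_nonneg (θ n).coe_nonneg (by norm_num),
          ENNReal.ofReal_coe_nnreal]
      have h2 : max (haar (A n) ^ (1 / 2 : ℝ)) (ENNReal.ofReal √(θ n : ℝ))
          ≤ K * haar (A n) ^ (1 / 2 : ℝ) := by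
        refine max_le (le_mul_of_one_le_left zero_le (le_max_left _ _)) ?_
        rw [h1]
        calc (θ n : ℝ≥0∞) ^ (1 / 2 : ℝ) ≤ (C * haar (A n)) ^ (1 / 2 : ℝ) := by gcongr
          _ = (C : ℝ≥0∞) ^ (1 / 2 : ℝ) * haar (A n) ^ (1 / 2 : ℝ) :=
              ENNReal.mul_rpow_of_nonneg _ _ (by norm_num)
          _ ≤ _ := by gcongr; exact le_max_right _ _
      calc _ ≤ haar (Metric.closedBall 1 (b n)) / haar (A n)
            * (K * haar (A n) ^ (1 / 2 : ℝ)) := by gcongr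
        _ = _ := by ring
    · have hmap (n) : (poissonMeasure (θ n)).map (· + 0) = poissonMeasure (θ n) := by
        simp only [add_zero]; exact Measure.map_id
      have hfl (n) : ((⌊θ n⌋₊ : ℕ) : ℝ≥0) ≤ θ n := Nat.floor_le zero_le
      have hfl' (n) : θ n ≤ ((⌊θ n⌋₊ : ℕ) : ℝ≥0) + 1 := (Nat.lt_floor_add_one _).le
      refine tendsto_meanCondTV hset hrem (ρ := fun n => poissonMeasure (θ n)) zero_le_one
        (c := θ) (fun n => (hθ n).trans (hmap n).symm) (fun n k => ?_)
        (fun n => by exact_mod_cast hfl n) (fun n => by exact_mod_cast hfl' n)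
        (fun n => (lintegral_poissonMeasure _).le) (fun n => ?_) hbig
      · rw [hmap]; exact poissonMeasure_recursion (θ n) k
      · refine lintegral_dev_poissonMeasure_le (θ n) _ (le_trans ?_ (hfl n)) ((hfl' n).trans ?_)
        · exact_mod_cast Nat.sub_le _ _
        · have : ⌊θ n⌋₊ + 1 ≤ (⌊θ n⌋₊ - 1) + 2 := by omega
          exact_mod_cast this

end
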